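/- Let $\mathfrak a$ be a finite-dimensional real inner product space with inner product $(\cdot,\cdot)$, norm $|\cdot|$ and Lebesgue measure $dx$. Let $G\subset O(\mathfrak a)$ be a finite reflection group with root system $R$ normalized by $(\alpha,\alpha)=2$ for $\alpha\in R$, let $r_\alpha$ be the orthogonal reflection in $\alpha^\perp$, and let $R_+$ be a positive system in $R$. Let $k:R\to\mathbb C$, $\alpha\mapsto k_\alpha$, be a $G$-invariant function with $\operatorname{Re}k_\alpha\ge 0$ for all $\alpha\in R$. For $\xi\in\mathfrak a$ let $$T_\xi(k)f(x)=\partial_\xi f(x)+\sum_{\alpha\in R_+}k_\alpha(\alpha,\xi)\,\frac{f(x)-f(r_\alpha x)}{(\alpha,x)}$$ be the Dunkl operator on smooth functions (the quotient being extended continuously to the hyperplane $(\alpha,x)=0$). For $\mu$ in the complexification $\mathfrak a_{\mathbb C}$, on which $(\cdot,\cdot)$ is extended bilinearly, let $\operatorname{Exp}_G(\mu,k,\cdot)$ be the unique smooth function on $\mathfrak a$ with $T_\xi(k)\operatorname{Exp}_G(\mu,k,\cdot)=(\mu,\xi)\operatorname{Exp}_G(\mu,k,\cdot)$ for all $\xi\in\mathfrak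 a$ and $\operatorname{Exp}_G(\mu,k,0)=1$. Put $w_k(x)=\prod_{\alpha\in R_+}|(\alpha,x)|^{2k_\alpha}$, $c_k=\int_{\mathfrak a}e^{-|x|^2/2}w_k(x)\,dx$, and $$D_kf(\lambda)=\frac1{c_k}\int_{\mathfrak a}f(x)\operatorname{Exp}_G(-i\lambda,k,x)w_k(x)\,dx,\qquad E_kf(x)=\frac1{c_k}\int_{\mathfrak a}f(\lambda)\operatorname{Exp}_G(i\lambda,k,x)w_k(\lambda)\,d\lambda\qquad(\lambda,x\in\mathfrak a).$$ Write $D_0,E_0$ for these transforms with all $k_\alpha$ replaced by $0$. For $\kappa\in\mathbb C$ with $\operatorname{Re}\kappa\ge0$ let $D_{\kappa,\mathbb Z_2}$ and $E_{\kappa,\mathbb Z_2}$ be the transforms obtained for the space $\mathbb R$, the root system $\{\pm\sqrt2\}$ with positive system $\{\sqrt2\}$, and the multiplicity function with constant value $\kappa$. For nonzero $x_0\in\mathfrak a$ and a function $f$ on $\mathfrak a$ put $(\operatorname{Res}_{x_0}f)(s)=f\left(s\,x_0/|x_0|\right)$ for $s\in\mathbb R$. Proposition 4.4. Let $f$ be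 a complex-valued Schwartz function on $\mathfrak a$ which is invariant under the full orthogonal group $O(\mathfrak a)$, and put $\gamma=\sum_{\alpha\in R_+}k_\alpha$. Then $$\operatorname{Res}_{x_0}E_kD_0f=E_{\gamma,\mathbb Z_2}D_{0,\mathbb Z_2}\operatorname{Res}_{x_0}f$$ for all nonzero $x_0\in\mathfrak a$. (In particular, the right-hand side does not involve the dimension of $\mathfrak a$.) -/

import Mathlib

open scoped InnerProductSpace ContDiff SchwartzMap
open MeasureTheory

namespace Dunkl

noncomputable section

section Roots

variable {E : Type*} [NormedAddCommGroup E] [InnerProductSpace ℝ E]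

/-- The orthogonal reflection `r_α` in the hyperplane perpendicular to `α`. -/
def rootRefl (α : E) : E ≃ₗᵢ[ℝ] E := (ℝ ∙ α)ᗮ.reflection

/-- `R` is the root system of a finite reflection group, normalized by `(α, α) = 2`. Since all
roots have the same length, `R` is automatically reduced; it need not span the space. -/
structure IsRootSystem (R : Finset E) : Prop where
  inner_self : ∀ α ∈ R, ⟪α, α⟫_ℝ = 2
  refl_mem : ∀ α ∈ R, ∀ β ∈ R, rootRefl α β ∈ R

/-- `P` is a positive system in `R`: it consists of the roots on one side of a hyperplane
through the origin that contains no root. -/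
def IsPositiveSystem (R P : Finset E) : Prop :=
  ∃ v : E, (∀ α ∈ R, ⟪v, α⟫_ℝ ≠ 0) ∧ ∀ α, α ∈ P ↔ α ∈ R ∧ 0 < ⟪v, α⟫_ℝ

/-- The reflection group `G` of the root system `R`, as a subgroup of the orthogonal group. -/
def reflectionGroup (R : Finset E) : Subgroup (E ≃ₗᵢ[ℝ] E) :=
  Subgroup.closure {g | ∃ α ∈ R, g = rootRefl α}

/-- `k` is a multiplicity function, i.e., it is `G`-invariant on `R`. (The values of `k` outside
of `R` play no role.) -/
def IsMultiplicity (R : Finset E) (k : E → ℂ) : Prop :=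
  ∀ g ∈ reflectionGroup R, ∀ α ∈ R, k (g α) = k α

/-- The operator `f ↦ (f - f ∘ r_α) / (α, ·)`. On the hyperplane `(α, x) = 0` the quotient is
understood by continuous extension: since `(α, α) = 2` one has
`f x - f (r_α x) = f x - f (x - (α, x) α)`, so that the value there is the derivative of `f` in the
direction `α`. -/
def divDiff (α : E) (f : E → ℂ) (x : E) : ℂ :=
  open Classical in
  if ⟪α, x⟫_ℝ = 0 then fderiv ℝ f x α else (f x - f (rootRefl α x)) / (⟪α, x⟫_ℝ : ℂ)

/-- The Dunkl operator `T_ξ(k)` (for the positive system `P`). -/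
def dunklOp (P : Finset E) (k : E → ℂ) (ξ : E) (f : E → ℂ) (x : E) : ℂ :=
  fderiv ℝ f x ξ + ∑ α ∈ P, k α * (⟪α, ξ⟫_ℝ : ℂ) * divDiff α f x

/-- `f` is a normalized smooth solution of the simultaneous eigenfunction problem
`T_ξ(k) f = (μ, ξ) f` for all `ξ`. The spectral parameter `μ` in the complexification of `E` is
represented by the linear functional `ξ ↦ (μ, ξ)`, denoted by `l`. -/
structure IsDunklKernel (P : Finset E) (k : E → ℂ) (l : E →ₗ[ℝ] ℂ) (f : E → ℂ) : Prop where
  contDiff : ContDiff ℝ ∞ f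
  map_zero : f 0 = 1
  eigen : ∀ ξ x, dunklOp P k ξ f x = l ξ * f x

/-- The Dunkl kernel `x ↦ Exp_G(μ, k, x)`: the normalized solution of the eigenfunction problem
(which exists and is unique for regular `k`, in particular if `Re k ≥ 0`; a junk value is
taken if there is none). -/
def dunklExp (P : Finset E) (k : E → ℂ) (l : E →ₗ[ℝ] ℂ) : E → ℂ :=
  Classical.epsilon (IsDunklKernel P k l)

/-- The functional `ξ ↦ (c v, ξ) = c (v, ξ)` representing the element `c v` of the
complexification, where `c` is complex and `v` is real. -/
def smulForm (c : ℂ) (v : E) : E →ₗ[ℝ] ℂ :=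
  c • (Complex.ofRealCLM.toLinearMap ∘ₗ innerₗ E v)

/-- The weight function `w_k(x) = ∏_{α ∈ P} |(α, x)| ^ (2 k_α)`. -/
def weight (P : Finset E) (k : E → ℂ) (x : E) : ℂ :=
  ∏ α ∈ P, ((|⟪α, x⟫_ℝ| : ℝ) : ℂ) ^ (2 * k α)

end Roots

section Transform

variable {E : Type*} [NormedAddCommGroup E] [InnerProductSpace ℝ E] [FiniteDimensional ℝ E]
  [MeasurableSpace E] [BorelSpace E]

/-- The Mehta integral `c_k`, i.e., the integral of `exp (-|x|² / 2) w_k(x)`. -/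
def mehta (P : Finset E) (k : E → ℂ) : ℂ :=
  ∫ x : E, (Real.exp (-‖x‖ ^ 2 / 2) : ℂ) * weight P k x

/-- The Dunkl transform `D_k`. -/
def dunklTransform (P : Finset E) (k : E → ℂ) (f : E → ℂ) (v : E) : ℂ :=
  (mehta P k)⁻¹ * ∫ x : E, f x * dunklExp P k (smulForm (-Complex.I) v) x * weight P k x

/-- The (alleged) inverse Dunkl transform `E_k`. -/
def invDunklTransform (P : Finset E) (k : E → ℂ) (f : E → ℂ) (x : E) : ℂ :=
  (mehta P k)⁻¹ * ∫ v : E, f v * dunklExp P k (smulForm Complex.I v) x * weight P k v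

end Transform

section RankOne

/-- The positive system of the rank one root system `{√2, -√2}` in `ℝ`, with reflection group
`ℤ/2`. -/
def rankOnePos : Finset ℝ := {√2}

/-- The transform `D_{κ, ℤ/2}` on the real line. -/
def dunklTransformZ2 (κ : ℂ) (f : ℝ → ℂ) : ℝ → ℂ :=
  dunklTransform rankOnePos (fun _ => κ) f

/-- The transform `E_{κ, ℤ/2}` on the real line. -/
def invDunklTransformZ2 (κ : ℂ) (f : ℝ → ℂ) : ℝ → ℂ :=
  invDunklTransform rankOnePos (fun _ => κ) f

end RankOne

section Radial

variable {E : Type*} [NormedAddCommGroup E] [InnerProductSpace ℝ E]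

/-- `f` is invariant under the full orthogonal group. -/
def IsRadial (f : E → ℂ) : Prop := ∀ (g : E ≃ₗᵢ[ℝ] E) (x : E), f (g x) = f x

/-- Restriction to the line through `x₀`, parameterized by arc length. -/
def resLine (x₀ : E) (f : E → ℂ) (s : ℝ) : ℂ := f (s • ‖x₀‖⁻¹ • x₀)

end Radial

end

end Dunkl

/-! Both sides, at a point s, are integrals of the same radial Schwartz function g = D_0 f against
kernels of polynomial growth. Let e = x₀/|x₀|. The left side is ∫ g Φ₁ with Φ₁(v) = c_k⁻¹ Exp_G(iv,
k, s e) w_k(v). On the right, the Fourier slice theorem (`fourier_restrict_line`) turns the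
one-dimensional transform of the restriction of f into the integral of g over the hyperplanes
orthogonal to e, so Fubini gives ∫ g Φ₂ with Φ₂(v) depending only on (e, v). It remains to see that
Φ₁ - Φ₂ annihilates radial functions, and by Weierstrass approximation in the variable exp(-|v|²/2)
it is enough to test Gaussians (`integral_radial_eq_zero`).

On Gaussians both kernels are explicit. The Dunkl transform reproduces exp(-|v|²/2)
(`integral_dunklExp_mul_gauss`) and w_k is homogeneous of degree 2γ, so a Gaussian of width r gives
r^(dim + 2γ) exp(-r²s²/2) in both cases: on the right the line contributes the exponent 1 + 2γ and
the orthogonal directions contribute dim - 1. The root system enters only through γ.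

Everything else is the theory of the Dunkl kernel for Re k ≥ 0, and it rests on one fact: ∑ k_α (1 -
r_α) has nonnegative real part on functions on the finite group (`accretive`). Along the orbit of a
ray the kernel solves a linear system whose singular term is this operator; an energy estimate
(`radial_system_bound`) gives uniqueness, symmetry in the two arguments, and boundedness for
imaginary parameter. The inverse of n + ∑ k_α (1 - r_α) produces the homogeneous components of the
kernel recursively, and commutativity of the Dunkl operators upgrades the radial equation to the
full eigenvalue system (`dunklOp_homogeneous_step`). Integration by parts against w_k times the
Gaussian then yields the Gaussian transform, and also c_k ≠ 0, which is not obvious since w_k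
oscillates when k is not real. -/

set_option linter.unusedSectionVars false

namespace Dunkl

/-! ### Reflections, positive systems, and equivariance of Dunkl operators and weight -/

section Basics

variable {E : Type*} [NormedAddCommGroup E] [InnerProductSpace ℝ E]

/-- A root system with a positive system and a multiplicity function of nonnegative real part. -/
structure IsDatum (R P : Finset E) (k : E → ℂ) : Prop where
  root : IsRootSystem R
  pos : IsPositiveSystem R P
  mult : IsMultiplicity R k
  re_nonneg : ∀ α ∈ R, 0 ≤ (k α).re

theorem rootRefl_apply {α : E} (hα : ⟪α, α⟫_ℝ = 2) (x : E) :
    rootRefl α x = x - ⟪α, x⟫_ℝ • α := by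
  have h : ‖α‖ ^ 2 = 2 := by rw [← real_inner_self_eq_norm_sq, hα]
  rw [rootRefl, Submodule.reflection_orthogonal_apply, Submodule.reflection_singleton_apply]
  simp only [h, RCLike.ofReal_real_eq_id, id]
  rw [two_nsmul, ← add_smul, add_halves]
  abel

theorem rootRefl_rootRefl (α x : E) : rootRefl α (rootRefl α x) = x :=
  Submodule.reflection_reflection _ x

theorem rootRefl_mul_self (α : E) : rootRefl α * rootRefl α = 1 := by
  ext x; exact rootRefl_rootRefl α x

theorem inner_rootRefl_left (α x y : E) : ⟪rootRefl α x, y⟫_ℝ = ⟪x, rootRefl α y⟫_ℝ := by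
  rw [← (rootRefl α).inner_map_map x (rootRefl α y), rootRefl_rootRefl]

theorem rootRefl_self (α : E) : rootRefl α α = -α :=
  Submodule.reflection_orthogonalComplement_singleton_eq_neg α

theorem inner_self_rootRefl (α x : E) : ⟪α, rootRefl α x⟫_ℝ = -⟪α, x⟫_ℝ := by
  rw [← inner_rootRefl_left, rootRefl_self, inner_neg_left]

theorem rootRefl_of_inner_eq_zero {α : E} (x : E) (h : ⟪α, x⟫_ℝ = 0) :
    rootRefl α x = x := by
  rw [rootRefl]
  apply Submodule.reflection_mem_subspace_eq_self
  exact Submodule.mem_orthogonal_singleton_iff_inner_right.2 h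

theorem rootRefl_neg (α : E) : rootRefl (-α) = rootRefl α := by
  unfold rootRefl
  congr 2
  simp [← Set.neg_singleton]

theorem rootRefl_map (g : E ≃ₗᵢ[ℝ] E) {α : E} (hα : ⟪α, α⟫_ℝ = 2) (x : E) :
    rootRefl (g α) (g x) = g (rootRefl α x) := by
  rw [rootRefl_apply (by rw [g.inner_map_map, hα]), rootRefl_apply hα, g.inner_map_map]
  simp

variable {R P : Finset E} {k : E → ℂ}

theorem rootRefl_mem_reflectionGroup {α : E} (hα : α ∈ R) : rootRefl α ∈ reflectionGroup R :=
  Subgroup.subset_closure ⟨α, hα, rfl⟩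

theorem IsRootSystem.neg_mem (hR : IsRootSystem R) {α : E} (hα : α ∈ R) : -α ∈ R := by
  rw [← rootRefl_self]; exact hR.refl_mem α hα α hα

theorem IsRootSystem.map_mem (hR : IsRootSystem R) {g : E ≃ₗᵢ[ℝ] E} (hg : g ∈ reflectionGroup R) :
    ∀ α ∈ R, g α ∈ R := by
  induction hg using Subgroup.closure_induction'' with
  | mem g hg => obtain ⟨α, hα, rfl⟩ := hg; exact hR.refl_mem α hα
  | inv_mem g hg =>
    obtain ⟨α, hα, rfl⟩ := hg
    rw [inv_eq_of_mul_eq_one_left (rootRefl_mul_self α)]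
    exact hR.refl_mem α hα
  | one => intro α hα; exact hα
  | mul g h _ _ hg hh => intro α hα; exact hg _ (hh _ hα)

theorem map_eq_of_orthogonal {g : E ≃ₗᵢ[ℝ] E} (hg : g ∈ reflectionGroup R) {x : E}
    (hx : ∀ α ∈ R, ⟪α, x⟫_ℝ = 0) : g x = x := by
  induction hg using Subgroup.closure_induction'' with
  | mem g hg => obtain ⟨α, hα, rfl⟩ := hg; exact rootRefl_of_inner_eq_zero x (hx α hα)
  | inv_mem g hg =>
    obtain ⟨α, hα, rfl⟩ := hg
    rw [inv_eq_of_mul_eq_one_left (rootRefl_mul_self α)]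
    exact rootRefl_of_inner_eq_zero x (hx α hα)
  | one => rfl
  | mul g h _ _ hg hh => rw [LinearIsometryEquiv.coe_mul, Function.comp_apply, hh, hg]

/-- The group permutes R and fixes the orthogonal complement of its span pointwise, so an element is
determined by its permutation of R. -/
theorem IsRootSystem.finite_reflectionGroup [FiniteDimensional ℝ E] (hR : IsRootSystem R) :
    Finite (reflectionGroup R) := by
  let F : reflectionGroup R → (R → R) := fun g α => ⟨g.1 α.1, hR.map_mem g.2 α.1 α.2⟩
  refine Finite.of_injective F ?_
  intro g h hgh
  apply Subtype.ext
  have key : ∀ α ∈ R, g.1 α = h.1 α := fun α hα => congrArg Subtype.val (congrFun hgh ⟨α, hα⟩)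
  ext x
  let S := Submodule.span ℝ (R : Set E)
  obtain ⟨y, hy, z, hz, rfl⟩ := S.exists_add_mem_mem_orthogonal x
  have hz' : ∀ α ∈ R, ⟪α, z⟫_ℝ = 0 := fun α hα =>
    (Submodule.mem_orthogonal S z).1 hz α (Submodule.subset_span hα)
  rw [map_add, map_add, map_eq_of_orthogonal g.2 hz', map_eq_of_orthogonal h.2 hz']
  congr 1
  induction hy using Submodule.span_induction with
  | mem y hy => exact key y hy
  | zero => simp
  | add y z _ _ hy hz => rw [map_add, map_add, hy, hz]
  | smul c y _ hy => rw [map_smul, map_smul, hy]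

theorem IsPositiveSystem.subset (hP : IsPositiveSystem R P) : P ⊆ R := by
  obtain ⟨v, _, hv⟩ := hP
  exact fun α hα => ((hv α).1 hα).1

theorem IsPositiveSystem.mem_or_neg_mem (hR : IsRootSystem R) (hP : IsPositiveSystem R P) {α : E}
    (hα : α ∈ R) : (α ∈ P ∧ -α ∉ P) ∨ (α ∉ P ∧ -α ∈ P) := by
  obtain ⟨v, hv0, hv⟩ := hP
  rcases lt_or_gt_of_ne (hv0 α hα) with h | h
  · right
    refine ⟨fun h' => absurd ((hv α).1 h').2 (by linarith), (hv _).2 ⟨hR.neg_mem hα, ?_⟩⟩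
    rw [inner_neg_right]; linarith
  · left
    refine ⟨(hv _).2 ⟨hα, h⟩, fun h' => ?_⟩
    have := ((hv _).1 h').2
    rw [inner_neg_right] at this; linarith

/-- A function on roots that is insensitive to signs has the same product over a positive system
and over any of its images under the reflection group. -/
theorem prod_map_positive (hR : IsRootSystem R) (hP : IsPositiveSystem R P)
    {M : Type*} [CommMonoid M] (h : E → M) (hh : ∀ α ∈ R, h (-α) = h α) {g : E ≃ₗᵢ[ℝ] E}
    (hg : g ∈ reflectionGroup R) : ∏ α ∈ P, h (g α) = ∏ α ∈ P, h α := by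
  classical
  have hPR := hP.subset
  -- The bijection sends α to whichever of g α and -(g α) is positive.
  refine Finset.prod_bij (fun α _ => if g α ∈ P then g α else -(g α)) ?_ ?_ ?_ ?_
  · intro α hα
    rcases hP.mem_or_neg_mem hR (hR.map_mem hg α (hPR hα)) with h1 | h1 <;> simp [h1]
  · intro α hα β hβ hab
    have aux : g α = g β ∨ g α = g (-β) := by
      rw [map_neg]
      split_ifs at hab
      · exact .inl hab
      · exact .inr hab
      · right; rw [← hab, neg_neg]
      · exact .inl (neg_injective hab)
    rcases aux with h1 | h1
    · exact g.injective h1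
    · exfalso
      have := g.injective h1
      rcases hP.mem_or_neg_mem hR (hPR hβ) with h2 | h2
      · exact h2.2 (this ▸ hα)
      · exact h2.1 hβ
  · intro β hβ
    have hg' := (reflectionGroup R).inv_mem hg
    rcases hP.mem_or_neg_mem hR (hR.map_mem hg' β (hPR hβ)) with h1 | h1
    · exact ⟨_, h1.1, by simp [hβ]⟩
    · refine ⟨_, h1.2, ?_⟩
      have h2 : -β ∉ P := by
        rcases hP.mem_or_neg_mem hR (hPR hβ) with h2 | h2
        · exact h2.2
        · exact absurd hβ h2.1
      simp [h2]
  · intro α hα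
    split_ifs
    · rfl
    · rw [hh _ (hR.map_mem hg α (hPR hα))]

theorem sum_map_positive (hR : IsRootSystem R) (hP : IsPositiveSystem R P)
    {M : Type*} [AddCommMonoid M] (h : E → M) (hh : ∀ α ∈ R, h (-α) = h α) {g : E ≃ₗᵢ[ℝ] E}
    (hg : g ∈ reflectionGroup R) : ∑ α ∈ P, h (g α) = ∑ α ∈ P, h α :=
  prod_map_positive (M := Multiplicative M) hR hP h hh hg

namespace IsDatum

theorem mem (D : IsDatum R P k) {α : E} (hα : α ∈ P) : α ∈ R := D.pos.subset hα

theorem inner_self (D : IsDatum R P k) {α : E} (hα : α ∈ P) : ⟪α, α⟫_ℝ = 2 :=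
  D.root.inner_self α (D.mem hα)

theorem refl_mem (D : IsDatum R P k) {α : E} (hα : α ∈ P) : rootRefl α ∈ reflectionGroup R :=
  rootRefl_mem_reflectionGroup (D.mem hα)

theorem re_nonneg' (D : IsDatum R P k) {α : E} (hα : α ∈ P) : 0 ≤ (k α).re :=
  D.re_nonneg α (D.mem hα)

theorem mult_neg (D : IsDatum R P k) {α : E} (hα : α ∈ R) : k (-α) = k α := by
  rw [← rootRefl_self]; exact D.mult _ (rootRefl_mem_reflectionGroup hα) α hα

/-- The datum with the multiplicity function zero. -/
theorem zero (D : IsDatum R P k) : IsDatum R P 0 :=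
  ⟨D.root, D.pos, fun _ _ _ _ => rfl, fun _ _ => le_rfl⟩

end IsDatum

/-- No case distinction is left after clearing the denominator: on the hyperplane both sides vanish.
-/
theorem inner_mul_divDiff {α : E} (f : E → ℂ) (x : E) :
    (⟪α, x⟫_ℝ : ℂ) * divDiff α f x = f x - f (rootRefl α x) := by
  unfold divDiff
  split_ifs with h
  · rw [rootRefl_of_inner_eq_zero x h, h]; simp
  · field_simp [Complex.ofReal_ne_zero.2 h]

theorem divDiff_neg (α : E) (f : E → ℂ) (x : E) : divDiff (-α) f x = -divDiff α f x := by
  unfold divDiff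
  simp only [inner_neg_left, neg_eq_zero, rootRefl_neg, map_neg, Complex.ofReal_neg, div_neg]
  split_ifs <;> rfl

theorem fderiv_comp_isometry (f : E → ℂ) (g : E ≃ₗᵢ[ℝ] E) (x ξ : E) :
    fderiv ℝ (fun y => f (g y)) x ξ = fderiv ℝ f (g x) (g ξ) := by
  have := g.toContinuousLinearEquiv.comp_right_fderiv (f := f) (x := x)
  have h2 := congrArg (fun L => L ξ) this
  exact h2

theorem divDiff_comp_isometry (g : E ≃ₗᵢ[ℝ] E) {α : E} (hα : ⟪α, α⟫_ℝ = 2) (f : E → ℂ) (x : E) :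
    divDiff α (fun y => f (g y)) x = divDiff (g α) f (g x) := by
  unfold divDiff
  rw [g.inner_map_map, fderiv_comp_isometry, rootRefl_map g hα]

/-- The summand of T_ξ is unchanged under α ↦ -α, so the sum does not depend on the choice of
positive system and may be transported by g. -/
theorem dunklOp_comp_isometry (D : IsDatum R P k) {g : E ≃ₗᵢ[ℝ] E} (hg : g ∈ reflectionGroup R)
    (ξ : E) (f : E → ℂ) (x : E) :
    dunklOp P k ξ (fun y => f (g y)) x = dunklOp P k (g ξ) f (g x) := by
  unfold dunklOp
  rw [fderiv_comp_isometry]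
  congr 1
  rw [← sum_map_positive D.root D.pos
    (fun α => k α * (⟪α, g ξ⟫_ℝ : ℂ) * divDiff α f (g x)) _ hg]
  · refine Finset.sum_congr rfl fun α hα => ?_
    rw [divDiff_comp_isometry g (D.inner_self hα), g.inner_map_map, D.mult g hg α (D.mem hα)]
  · intro α hα
    rw [D.mult_neg hα, divDiff_neg, inner_neg_left]; push_cast; ring

/-- With ξ = x the denominators cancel. What remains is the Euler operator plus ∑ k_α (1 - r_α), the
bridge between Dunkl operators and the finite-dimensional accretive operator. -/
theorem dunklOp_self (f : E → ℂ) (x : E) :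
    dunklOp P k x f x = fderiv ℝ f x x + ∑ α ∈ P, k α * (f x - f (rootRefl α x)) := by
  unfold dunklOp
  simp_rw [mul_assoc, inner_mul_divDiff]

theorem weight_map (D : IsDatum R P k) {g : E ≃ₗᵢ[ℝ] E} (hg : g ∈ reflectionGroup R) (x : E) :
    weight P k (g x) = weight P k x := by
  unfold weight
  have hg' := (reflectionGroup R).inv_mem hg
  rw [← prod_map_positive D.root D.pos
    (fun α => ((|⟪α, x⟫_ℝ| : ℝ) : ℂ) ^ (2 * k α)) _ hg']
  · refine Finset.prod_congr rfl fun α hα => ?_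
    rw [D.mult _ hg' α (D.mem hα), ← g.inner_map_map (g⁻¹ α) x]
    congr
    exact (g.apply_symm_apply α).symm
  · intro α hα
    rw [D.mult_neg hα, inner_neg_left, abs_neg]

end Basics


/-! ### Accretivity of sums of reflections and the energy estimate -/

section Accretive

open ComplexConjugate

variable {ι κ : Type*} [Fintype ι] {S : Finset κ} {σ : κ → ι → ι} {k : κ → ℂ}

/-- Reindexing by τ and averaging turns the form into half a sum of squares; in particular 1 - τ is
a nonnegative Hermitian operator. -/
theorem sum_conj_mul_sub_involution {τ : ι → ι} (hτ : ∀ i, τ (τ i) = i) (u : ι → ℂ) :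
    ∑ i, conj (u i) * (u i - u (τ i)) = ((2⁻¹ * ∑ i, ‖u i - u (τ i)‖ ^ 2 : ℝ) : ℂ) := by
  have h1 : ∑ i, conj (u i) * (u i - u (τ i)) = ∑ i, conj (u (τ i)) * (u (τ i) - u i) := by
    have := Equiv.sum_comp (Function.Involutive.toPerm τ hτ) fun i => conj (u i) * (u i - u (τ i))
    refine this.symm.trans (Finset.sum_congr rfl fun i _ => ?_)
    change conj (u (τ i)) * (u (τ i) - u (τ (τ i))) = _
    rw [hτ]
  have h2 : ∑ i, conj (u i) * (u i - u (τ i)) + ∑ i, conj (u (τ i)) * (u (τ i) - u i)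
      = ((∑ i, ‖u i - u (τ i)‖ ^ 2 : ℝ) : ℂ) := by
    push_cast
    rw [← Finset.sum_add_distrib]
    refine Finset.sum_congr rfl fun i _ => ?_
    rw [← Complex.conj_mul', map_sub]
    ring
  rw [← h1] at h2
  push_cast at h2 ⊢
  rw [← h2]; ring

/-- Each 1 - σ_a has a nonnegative real quadratic form, so only Re k_a matters for the real part.
The involutions need not commute. -/
theorem accretive (hσ : ∀ a ∈ S, ∀ i, σ a (σ a i) = i) (hk : ∀ a ∈ S, 0 ≤ (k a).re) (u : ι → ℂ) :
    0 ≤ (∑ i, conj (u i) * ∑ a ∈ S, k a * (u i - u (σ a i))).re := by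
  have : ∑ i, conj (u i) * ∑ a ∈ S, k a * (u i - u (σ a i)) =
      ∑ a ∈ S, k a * ∑ i, conj (u i) * (u i - u (σ a i)) := by
    simp_rw [Finset.mul_sum]
    rw [Finset.sum_comm]
    exact Finset.sum_congr rfl fun a _ => Finset.sum_congr rfl fun i _ => by ring
  rw [this, Complex.re_sum]
  refine Finset.sum_nonneg fun a ha => ?_
  rw [sum_conj_mul_sub_involution (hσ a ha), Complex.re_mul_ofReal]
  exact mul_nonneg (hk a ha) (by positivity)

theorem accretive_bound (hσ : ∀ a ∈ S, ∀ i, σ a (σ a i) = i) (hk : ∀ a ∈ S, 0 ≤ (k a).re)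
    (n : ℝ) (u v : ι → ℂ) (h : ∀ i, n * u i + ∑ a ∈ S, k a * (u i - u (σ a i)) = v i) :
    n * ∑ i, ‖u i‖ ^ 2 ≤ (∑ i, conj (u i) * v i).re := by
  have h1 : ∑ i, conj (u i) * v i = ((n * ∑ i, ‖u i‖ ^ 2 : ℝ) : ℂ) +
      ∑ i, conj (u i) * ∑ a ∈ S, k a * (u i - u (σ a i)) := by
    push_cast
    rw [Finset.mul_sum, ← Finset.sum_add_distrib]
    refine Finset.sum_congr rfl fun i _ => ?_
    rw [← h i, ← Complex.conj_mul']
    ring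
  rw [h1, Complex.add_re, Complex.ofReal_re]
  linarith [accretive hσ hk u]

theorem accretive_injective (hσ : ∀ a ∈ S, ∀ i, σ a (σ a i) = i) (hk : ∀ a ∈ S, 0 ≤ (k a).re)
    {n : ℝ} (hn : 0 < n) (u : ι → ℂ)
    (h : ∀ i, n * u i + ∑ a ∈ S, k a * (u i - u (σ a i)) = 0) : u = 0 := by
  have h1 := accretive_bound hσ hk n u 0 h
  simp only [Pi.zero_apply, mul_zero, Finset.sum_const_zero, Complex.zero_re] at h1
  have h2 : ∑ i, ‖u i‖ ^ 2 ≤ 0 := by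
    by_contra! h3
    nlinarith [mul_pos hn h3]
  have h3 := (Finset.sum_eq_zero_iff_of_nonneg (fun i _ => by positivity)).1
    (le_antisymm h2 (Finset.sum_nonneg fun i _ => by positivity))
  ext i
  simpa using h3 i (Finset.mem_univ i)

/-- Injectivity on a finite-dimensional space gives the solution c. Pairing the equation with c
yields n ∑ |c_i|² ≤ |c_{i₀}|, which first bounds c_{i₀} by 1/n and then every other coordinate. The
1/n decay later becomes the 1/n! in the kernel expansion. -/
theorem exists_accretive_inverse [DecidableEq ι] (hσ : ∀ a ∈ S, ∀ i, σ a (σ a i) = i)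
    (hk : ∀ a ∈ S, 0 ≤ (k a).re) {n : ℝ} (hn : 0 < n) (i₀ : ι) :
    ∃ c : ι → ℂ, (∀ i, n * c i + ∑ a ∈ S, k a * (c i - c (σ a i)) = Pi.single (M := fun _ => ℂ) i₀ 1 i) ∧
      ∀ i, ‖c i‖ ≤ n⁻¹ := by
  let L : (ι → ℂ) →ₗ[ℂ] (ι → ℂ) :=
    { toFun := fun u i => n * u i + ∑ a ∈ S, k a * (u i - u (σ a i))
      map_add' := fun u v => by
        ext i
        simp only [Pi.add_apply]
        rw [add_add_add_comm, ← Finset.sum_add_distrib, mul_add]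
        congr 1
        exact Finset.sum_congr rfl fun a _ => by ring
      map_smul' := fun c u => by
        ext i
        simp only [Pi.smul_apply, smul_eq_mul, RingHom.id_apply]
        rw [mul_add, Finset.mul_sum]
        congr 1
        · ring
        · exact Finset.sum_congr rfl fun a _ => by ring }
  have hL : Function.Injective L := by
    rw [← LinearMap.ker_eq_bot, LinearMap.ker_eq_bot']
    intro u hu
    exact accretive_injective hσ hk hn u fun i => congrFun hu i
  obtain ⟨c, hc⟩ := (LinearMap.injective_iff_surjective.1 hL) (Pi.single i₀ 1)
  have hc' : ∀ i, n * c i + ∑ a ∈ S, k a * (c i - c (σ a i)) =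
    Pi.single (M := fun _ => ℂ) i₀ 1 i := fun i => congrFun hc i
  refine ⟨c, hc', ?_⟩
  have h1 := accretive_bound hσ hk n c _ hc'
  have h2 : (∑ i, conj (c i) * Pi.single (M := fun _ => ℂ) i₀ 1 i) = conj (c i₀) := by
    rw [Finset.sum_eq_single i₀] <;> simp +contextual
  rw [h2] at h1
  have h3 : (conj (c i₀)).re ≤ ‖c i₀‖ := by
    rw [Complex.conj_re]; exact Complex.re_le_norm _
  have h4 : ∀ i, n * ‖c i‖ ^ 2 ≤ ‖c i₀‖ := fun i => by
    refine le_trans (mul_le_mul_of_nonneg_left ?_ hn.le) (h1.trans h3)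
    exact Finset.single_le_sum (f := fun i => ‖c i‖ ^ 2) (fun i _ => by positivity)
      (Finset.mem_univ i)
  have h5 : ‖c i₀‖ ≤ n⁻¹ := by
    rw [inv_eq_one_div, le_div_iff₀ hn]
    rcases (norm_nonneg (c i₀)).eq_or_lt with h | h
    · rw [← h]; simp
    · refine le_of_mul_le_mul_right ?_ h
      linarith [h4 i₀, sq (‖c i₀‖)]
  intro i
  have h6 : (n * ‖c i‖) ^ 2 ≤ 1 := by
    have := mul_le_mul_of_nonneg_left ((h4 i).trans h5) hn.le
    rw [mul_inv_cancel₀ hn.ne'] at this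
    nlinarith
  have h7 : n * ‖c i‖ ≤ 1 := by nlinarith [norm_nonneg (c i)]
  rw [inv_eq_one_div, le_div_iff₀ hn]
  linarith

/-- Energy estimate for the radial system satisfied along rays by eigenfunctions of Dunkl
operators. -/
theorem radial_system_bound (hσ : ∀ a ∈ S, ∀ i, σ a (σ a i) = i) (hk : ∀ a ∈ S, 0 ≤ (k a).re)
    (a : ι → ℂ) {M : ℝ} (ha : ∀ i, (a i).re ≤ M) (u u' : ι → ℝ → ℂ)
    (hu0 : ∀ i, ContinuousWithinAt (u i) (Set.Ici 0) 0)
    (hu : ∀ i, ∀ t, 0 < t → HasDerivAt (u i) (u' i t) t)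
    (h : ∀ i, ∀ t, 0 < t → t * u' i t = t * (a i * u i t) - ∑ b ∈ S, k b * (u i t - u (σ b i) t))
    {t : ℝ} (ht : 0 ≤ t) :
    ∑ i, ‖u i t‖ ^ 2 ≤ Real.exp (2 * M * t) * ∑ i, ‖u i 0‖ ^ 2 := by
  let F : ℝ → ℝ := fun t => Real.exp (-(2 * M * t)) * ∑ i, ‖u i t‖ ^ 2
  have hF : ∀ t, 0 < t → HasDerivAt F (Real.exp (-(2 * M * t)) * (-(2 * M)) * ∑ i, ‖u i t‖ ^ 2 +
      Real.exp (-(2 * M * t)) * ∑ i, 2 * ⟪u i t, u' i t⟫_ℝ) t := by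
    intro t ht
    refine HasDerivAt.mul ?_ ?_
    · have : HasDerivAt (fun t : ℝ => -(2 * M * t)) (-(2 * M)) t := by
        simpa using ((hasDerivAt_id' t).const_mul (2 * M)).fun_neg
      exact this.exp
    · exact HasDerivAt.fun_sum fun i _ => (hu i t ht).norm_sq
  have hcont : ContinuousOn F (Set.Ici 0) := by
    intro t ht
    rcases (Set.mem_Ici.1 ht).eq_or_lt with rfl | ht
    · refine ContinuousWithinAt.mul (by fun_prop) ?_
      exact tendsto_finsetSum _ fun i _ => ((hu0 i).norm.pow 2)
    · exact (hF t ht).continuousAt.continuousWithinAt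
  -- The system is singular at t = 0, so the derivative is used only for t > 0, with mere continuity
  -- at the end point. Multiplying the equation by t exposes the accretive form, whose sign makes
  -- the weighted energy decrease.
  have hanti : AntitoneOn F (Set.Ici 0) := by
    refine antitoneOn_of_deriv_nonpos (convex_Ici 0) hcont ?_ ?_
    · intro t ht
      rw [interior_Ici] at ht
      exact (hF t ht).differentiableAt.differentiableWithinAt
    · intro t ht
      rw [interior_Ici] at ht
      rw [(hF t ht).deriv]
      have ht : 0 < t := ht
      have key : ∑ i, ⟪u i t, u' i t⟫_ℝ ≤ M * ∑ i, ‖u i t‖ ^ 2 := by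
        have h1 : ∀ i, t * ⟪u i t, u' i t⟫_ℝ = t * ((a i).re * ‖u i t‖ ^ 2) -
            (conj (u i t) * ∑ b ∈ S, k b * (u i t - u (σ b i) t)).re := by
          intro i
          have h2 : (t : ℂ) * (conj (u i t) * u' i t) = t * (a i * (‖u i t‖ ^ 2 : ℝ)) -
            conj (u i t) * ∑ b ∈ S, k b * (u i t - u (σ b i) t) := by
            push_cast
            rw [mul_left_comm, h i t ht, ← Complex.conj_mul']; ring
          have h3 := congrArg Complex.re h2
          rw [Complex.sub_re, Complex.re_ofReal_mul, Complex.re_ofReal_mul,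
            Complex.re_mul_ofReal] at h3
          rw [Complex.inner, mul_comm (u' i t)] 
          exact h3
        have h2 : t * ∑ i, ⟪u i t, u' i t⟫_ℝ ≤ t * (M * ∑ i, ‖u i t‖ ^ 2) := by
          rw [Finset.mul_sum, Finset.sum_congr rfl fun i _ => h1 i, Finset.sum_sub_distrib,
            ← Complex.re_sum]
          have := accretive hσ hk fun i => u i t
          have h4 : ∑ i, t * ((a i).re * ‖u i t‖ ^ 2) ≤ t * (M * ∑ i, ‖u i t‖ ^ 2) := by
            rw [Finset.mul_sum, Finset.mul_sum]
            refine Finset.sum_le_sum fun i _ => ?_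
            gcongr
            exact ha i
          linarith
        exact le_of_mul_le_mul_left h2 ht
      rw [← Finset.mul_sum]
      have := mul_le_mul_of_nonneg_left key (Real.exp_pos (-(2 * M * t))).le
      linarith
  have h0 := hanti Set.self_mem_Ici (Set.mem_Ici.2 ht) ht
  simp only [F, mul_zero, neg_zero, Real.exp_zero, one_mul] at h0
  calc ∑ i, ‖u i t‖ ^ 2
      = Real.exp (2 * M * t) * (Real.exp (-(2 * M * t)) * ∑ i, ‖u i t‖ ^ 2) := by
        rw [← mul_assoc, ← Real.exp_add]; simp
    _ ≤ _ := by gcongr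

end Accretive


/-! ### Algebra of Dunkl operators: linearity and the commutator with linear functions -/

section Linearity

variable {E : Type*} [NormedAddCommGroup E] [InnerProductSpace ℝ E] {P : Finset E} {k : E → ℂ}

theorem divDiff_const (α : E) (c : ℂ) (x : E) : divDiff α (fun _ => c) x = 0 := by
  unfold divDiff; split_ifs <;> simp

theorem dunklOp_const (ξ : E) (c : ℂ) (x : E) : dunklOp P k ξ (fun _ => c) x = 0 := by
  simp [dunklOp, divDiff_const]

theorem divDiff_add (α : E) {f g : E → ℂ} (hf : Differentiable ℝ f) (hg : Differentiable ℝ g)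
    (x : E) : divDiff α (fun y => f y + g y) x = divDiff α f x + divDiff α g x := by
  unfold divDiff
  split_ifs
  · rw [fderiv_fun_add (hf x) (hg x)]; rfl
  · rw [← add_div]; congr 1; ring

theorem divDiff_const_mul (α : E) {f : E → ℂ} (hf : Differentiable ℝ f) (c : ℂ)
    (x : E) : divDiff α (fun y => c * f y) x = c * divDiff α f x := by
  unfold divDiff
  split_ifs
  · rw [fderiv_const_mul (hf x)]; rfl
  · rw [← mul_div_assoc]; congr 1; ring

theorem dunklOp_add (ξ : E) {f g : E → ℂ} (hf : Differentiable ℝ f) (hg : Differentiable ℝ g)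
    (x : E) : dunklOp P k ξ (fun y => f y + g y) x = dunklOp P k ξ f x + dunklOp P k ξ g x := by
  unfold dunklOp
  simp_rw [divDiff_add _ hf hg, mul_add]
  rw [fderiv_fun_add (hf x) (hg x), Finset.sum_add_distrib, add_apply]
  ring

theorem dunklOp_const_mul (ξ : E) {f : E → ℂ} (hf : Differentiable ℝ f) (c : ℂ)
    (x : E) : dunklOp P k ξ (fun y => c * f y) x = c * dunklOp P k ξ f x := by
  unfold dunklOp
  simp_rw [divDiff_const_mul _ hf]
  rw [fderiv_const_mul (hf x), mul_add, Finset.mul_sum]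
  congr 1
  exact Finset.sum_congr rfl fun α _ => by ring

theorem dunklOp_sub (ξ : E) {f g : E → ℂ} (hf : Differentiable ℝ f) (hg : Differentiable ℝ g)
    (x : E) : dunklOp P k ξ (fun y => f y - g y) x = dunklOp P k ξ f x - dunklOp P k ξ g x := by
  have h := dunklOp_add (P := P) (k := k) ξ hf (hg.const_mul (-1 : ℂ)) x
  rw [dunklOp_const_mul ξ hg] at h
  simp only [neg_one_mul, ← sub_eq_add_neg] at h
  exact h

theorem dunklOp_sum {ι : Type*} (s : Finset ι) (ξ : E) {f : ι → E → ℂ}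
    (hf : ∀ i, Differentiable ℝ (f i)) (x : E) :
    dunklOp P k ξ (fun y => ∑ i ∈ s, f i y) x = ∑ i ∈ s, dunklOp P k ξ (f i) x := by
  classical
  induction s using Finset.induction_on with
  | empty => simpa using dunklOp_const ξ 0 x
  | insert i s hi ih =>
    simp_rw [Finset.sum_insert hi]
    rw [dunklOp_add ξ (hf i) (Differentiable.fun_sum fun j _ => hf j), ih]

theorem dunklOp_sub_smul_left (ξ η : E) (c : ℝ) (f : E → ℂ) (x : E) :
    dunklOp P k (ξ - c • η) f x = dunklOp P k ξ f x - c * dunklOp P k η f x := by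
  unfold dunklOp
  rw [map_sub, map_smul, mul_add, Finset.mul_sum]
  simp only [inner_sub_right, inner_smul_right, Complex.ofReal_sub, Complex.ofReal_mul, mul_sub,
    sub_mul, Finset.sum_sub_distrib, Complex.real_smul]
  have : ∑ α ∈ P, k α * (c * (⟪α, η⟫_ℝ : ℂ)) * divDiff α f x =
    ∑ α ∈ P, c * (k α * (⟪α, η⟫_ℝ : ℂ) * divDiff α f x) :=
    Finset.sum_congr rfl fun α _ => by ring
  rw [this]; ring

theorem dunklOp_eq_sum_coord [FiniteDimensional ℝ E] (ξ : E) (f : E → ℂ) (x : E) :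
    dunklOp P k ξ f x =
      ∑ i, (⟪stdOrthonormalBasis ℝ E i, ξ⟫_ℝ : ℂ) * dunklOp P k (stdOrthonormalBasis ℝ E i) f x := by
  have hlin : ∃ L : E →ₗ[ℝ] ℂ, ∀ ξ, L ξ = dunklOp P k ξ f x := by
    refine ⟨{ toFun := fun ξ => dunklOp P k ξ f x, map_add' := ?_, map_smul' := ?_ }, fun _ => rfl⟩
    · intro ξ η
      have := dunklOp_sub_smul_left (P := P) (k := k) ξ η (-1) f x
      simpa using this
    · intro c η
      have := dunklOp_sub_smul_left (P := P) (k := k) 0 η (-c) f x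
      have h0 : dunklOp P k 0 f x = 0 := by simp [dunklOp]
      simpa [h0] using this
  obtain ⟨L, hL⟩ := hlin
  rw [← hL]
  conv_lhs => rw [← (stdOrthonormalBasis ℝ E).sum_repr' ξ]
  simp only [map_sum, map_smul, Complex.real_smul]
  simp only [hL]

variable [FiniteDimensional ℝ E]

theorem differentiable_linear (l : E →ₗ[ℝ] ℂ) : Differentiable ℝ l :=
  (LinearMap.toContinuousLinearMap l).differentiable

theorem fderiv_linear (l : E →ₗ[ℝ] ℂ) (x ξ : E) : fderiv ℝ l x ξ = l ξ := by
  have := (LinearMap.toContinuousLinearMap l).fderiv (x := x)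
  exact congrArg (fun L => L ξ) this

theorem fderiv_linear_mul (l : E →ₗ[ℝ] ℂ) {f : E → ℂ} (hf : Differentiable ℝ f) (x ξ : E) :
    fderiv ℝ (fun y => l y * f y) x ξ = l x * fderiv ℝ f x ξ + l ξ * f x := by
  rw [fderiv_fun_mul (differentiable_linear l x) (hf x)]
  simp [fderiv_linear, mul_comm]

theorem divDiff_linear_mul {α : E} (hα : ⟪α, α⟫_ℝ = 2) (l : E →ₗ[ℝ] ℂ) {f : E → ℂ}
    (hf : Differentiable ℝ f) (x : E) :
    divDiff α (fun y => l y * f y) x = l x * divDiff α f x + l α * f (rootRefl α x) := by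
  unfold divDiff
  split_ifs with h
  · rw [fderiv_linear_mul l hf, rootRefl_of_inner_eq_zero x h]
  · have h' : (⟪α, x⟫_ℝ : ℂ) ≠ 0 := Complex.ofReal_ne_zero.2 h
    have h2 : l (rootRefl α x) = l x - ⟪α, x⟫_ℝ * l α := by
      rw [rootRefl_apply hα, map_sub, map_smul, Complex.real_smul]
    simp only [h2]
    field_simp
    ring

/-- The commutator [T_ξ, l] = l(ξ) + ∑ k_α (α, ξ) l(α) r_α involves no derivatives; this is what
makes induction over polynomials work. -/
theorem dunklOp_linear_mul (hP : ∀ α ∈ P, ⟪α, α⟫_ℝ = 2) (ξ : E) (l : E →ₗ[ℝ] ℂ) {f : E → ℂ}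
    (hf : Differentiable ℝ f) (x : E) :
    dunklOp P k ξ (fun y => l y * f y) x = l x * dunklOp P k ξ f x + l ξ * f x +
      ∑ α ∈ P, k α * (⟪α, ξ⟫_ℝ : ℂ) * l α * f (rootRefl α x) := by
  unfold dunklOp
  rw [fderiv_linear_mul l hf, Finset.sum_congr rfl fun α hα => by
    rw [divDiff_linear_mul (hP α hα) l hf], mul_add, Finset.mul_sum]
  simp_rw [mul_add]
  rw [Finset.sum_add_distrib]
  have h1 : ∑ α ∈ P, k α * (⟪α, ξ⟫_ℝ : ℂ) * (l x * divDiff α f x) =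
    ∑ α ∈ P, l x * (k α * (⟪α, ξ⟫_ℝ : ℂ) * divDiff α f x) :=
    Finset.sum_congr rfl fun α _ => by ring
  have h2 : ∑ α ∈ P, k α * (⟪α, ξ⟫_ℝ : ℂ) * (l α * f (rootRefl α x)) =
    ∑ α ∈ P, k α * (⟪α, ξ⟫_ℝ : ℂ) * l α * f (rootRefl α x) :=
    Finset.sum_congr rfl fun α _ => by ring
  rw [h1, h2]; ring

end Linearity

/-! ### Polynomial functions and commutativity of Dunkl operators -/

section Polynomials

variable {E : Type*} [NormedAddCommGroup E] [InnerProductSpace ℝ E] [FiniteDimensional ℝ E]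

/-- `PolyLE n f` says that `f` is a complex polynomial function of degree at most `n`. -/
inductive PolyLE : ℕ → (E → ℂ) → Prop
  | const (n : ℕ) (c : ℂ) : PolyLE n (fun _ => c)
  | add {n : ℕ} {f g : E → ℂ} : PolyLE n f → PolyLE n g → PolyLE n (fun x => f x + g x)
  | linear_mul {n : ℕ} {f : E → ℂ} (l : E →ₗ[ℝ] ℂ) :
      PolyLE n f → PolyLE (n + 1) (fun x => l x * f x)

namespace PolyLE

variable {n m : ℕ} {f g : E → ℂ} {R P : Finset E} {k : E → ℂ}

theorem contDiff (hf : PolyLE n f) : ContDiff ℝ ∞ f := by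
  induction hf with
  | const n c => exact contDiff_const
  | add _ _ hf hg => exact hf.add hg
  | linear_mul l _ hf => exact (LinearMap.toContinuousLinearMap l).contDiff.mul hf

theorem differentiable (hf : PolyLE n f) : Differentiable ℝ f :=
  hf.contDiff.differentiable (by simp)

theorem succ (hf : PolyLE n f) : PolyLE (n + 1) f := by
  induction hf with
  | const n c => exact const _ c
  | add _ _ hf hg => exact hf.add hg
  | linear_mul l _ hf => exact hf.linear_mul l

theorem comp_isometry (hf : PolyLE n f) (g : E ≃ₗᵢ[ℝ] E) : PolyLE n (fun x => f (g x)) := by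
  induction hf with
  | const n c => exact const _ c
  | add _ _ hf hg => exact hf.add hg
  | linear_mul l _ hf => exact hf.linear_mul (l ∘ₗ g.toLinearEquiv.toLinearMap)

theorem const_mul (hf : PolyLE n f) (c : ℂ) : PolyLE n (fun x => c * f x) := by
  induction hf with
  | const n c' => exact const _ (c * c')
  | add _ _ hf hg => simp_rw [mul_add]; exact hf.add hg
  | linear_mul l _ hf => simp_rw [mul_left_comm c]; exact hf.linear_mul l

theorem sub (hf : PolyLE n f) (hg : PolyLE n g) : PolyLE n (fun x => f x - g x) := by
  have := hf.add (hg.const_mul (-1))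
  simpa only [neg_one_mul, ← sub_eq_add_neg] using this

theorem sum {ι : Type*} (s : Finset ι) {f : ι → E → ℂ} (hf : ∀ i ∈ s, PolyLE n (f i)) :
    PolyLE n (fun x => ∑ i ∈ s, f i x) := by
  classical
  induction s using Finset.induction_on with
  | empty => simpa using const n (0 : ℂ)
  | insert i s hi ih =>
    simp_rw [Finset.sum_insert hi]
    exact (hf i (Finset.mem_insert_self i s)).add
      (ih fun j hj => hf j (Finset.mem_insert_of_mem hj))

/-- The true degree drops by one, but preserving the bound is enough here: the inductions compare
T_ξ f with a product l f, whose bound is one higher. -/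
theorem dunklOp (hP : ∀ α ∈ P, ⟪α, α⟫_ℝ = 2) (ξ : E) (hf : PolyLE n f) :
    PolyLE n (dunklOp P k ξ f) := by
  induction hf with
  | const n c => simpa only [funext (dunklOp_const ξ c)] using const n (0 : ℂ)
  | add hf hg ihf ihg =>
    rw [funext (dunklOp_add ξ hf.differentiable hg.differentiable)]
    exact ihf.add ihg
  | linear_mul l hf ih =>
    rw [funext (dunklOp_linear_mul hP ξ l hf.differentiable)]
    refine ((ih.linear_mul l).add (hf.succ.const_mul _)).add (sum P fun α _ => ?_)
    exact ((hf.comp_isometry _).succ).const_mul _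

end PolyLE

variable {R P : Finset E} {k : E → ℂ}

theorem dunklOp_comp_rootRefl (D : IsDatum R P k) {α : E} (hα : α ∈ P) (ξ : E) (f : E → ℂ) (x : E) :
    dunklOp P k ξ (fun y => f (rootRefl α y)) x =
      dunklOp P k ξ f (rootRefl α x) - ⟪α, ξ⟫_ℝ * dunklOp P k α f (rootRefl α x) := by
  rw [dunklOp_comp_isometry D (D.refl_mem hα), rootRefl_apply (D.inner_self hα) ξ,
    dunklOp_sub_smul_left]

/-- Dunkl operators commute on polynomials. -/
theorem dunklOp_comm (D : IsDatum R P k) (ξ η : E) {n : ℕ} {f : E → ℂ} (hf : PolyLE n f) (x : E) :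
    dunklOp P k ξ (dunklOp P k η f) x = dunklOp P k η (dunklOp P k ξ f) x := by
  have hP : ∀ α ∈ P, ⟪α, α⟫_ℝ = 2 := fun α hα => D.inner_self hα
  induction hf generalizing x with
  | const n c =>
    rw [funext (dunklOp_const η c), funext (dunklOp_const ξ c), dunklOp_const, dunklOp_const]
  | add hf hg ihf ihg =>
    rw [funext (dunklOp_add ξ hf.differentiable hg.differentiable),
      funext (dunklOp_add η hf.differentiable hg.differentiable),
      dunklOp_add _ (hf.dunklOp hP _).differentiable (hg.dunklOp hP _).differentiable,
      dunklOp_add _ (hf.dunklOp hP _).differentiable (hg.dunklOp hP _).differentiable, ihf, ihg]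
  | @linear_mul n f l hf ih =>
    -- Apply the commutator formula twice and move T_ξ past r_α using equivariance. Every term
    -- besides T_ξ T_η f is then visibly symmetric in ξ and η, so commutativity passes from f to l f
    -- with no rank-two computation.
    have key : ∀ ξ η, dunklOp P k ξ (dunklOp P k η (fun y => l y * f y)) x =
        l x * dunklOp P k ξ (dunklOp P k η f) x +
        (l ξ * dunklOp P k η f x + l η * dunklOp P k ξ f x) +
        ∑ α ∈ P, k α * l α * (⟪α, ξ⟫_ℝ * dunklOp P k η f (rootRefl α x) +
          ⟪α, η⟫_ℝ * dunklOp P k ξ f (rootRefl α x) -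
          ⟪α, η⟫_ℝ * ⟪α, ξ⟫_ℝ * dunklOp P k α f (rootRefl α x)) := by
      intro ξ η
      have h1 := (hf.dunklOp (k := k) hP η).differentiable
      have hc : ∀ α, Differentiable ℝ fun y => f (rootRefl α y) :=
        fun α => (hf.comp_isometry _).differentiable
      have h2 : Differentiable ℝ fun y => l y * dunklOp P k η f y :=
        (differentiable_linear l).mul h1
      have h3 : Differentiable ℝ fun y => l η * f y := hf.differentiable.const_mul _
      rw [funext (dunklOp_linear_mul hP η l hf.differentiable),
        dunklOp_add ξ (h2.fun_add h3) (Differentiable.fun_sum fun α _ => (hc α).const_mul _),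
        dunklOp_add ξ h2 h3,
        dunklOp_linear_mul hP ξ l h1, dunklOp_const_mul ξ hf.differentiable,
        dunklOp_sum P ξ fun α => (hc α).const_mul _]
      simp_rw [fun α => dunklOp_const_mul (P := P) (k := k) ξ (hc α)]
      rw [add_right_comm _ (Finset.sum P _), add_assoc _ (Finset.sum P _),
        ← Finset.sum_add_distrib]
      congr 1
      · ring
      · refine Finset.sum_congr rfl fun α hα => ?_
        rw [dunklOp_comp_rootRefl D hα ξ f x]
        ring
    rw [key ξ η, key η ξ, ih]
    congr 1
    · ring
    · exact Finset.sum_congr rfl fun α _ => by ring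

end Polynomials


/-! ### Homogeneity: Euler's relation and dilations -/

section Homogeneous

variable {E : Type*} [NormedAddCommGroup E] [InnerProductSpace ℝ E] {P : Finset E} {k : E → ℂ}

theorem fderiv_self_of_homogeneous {f : E → ℂ} (hf : Differentiable ℝ f) {n : ℕ}
    (h : ∀ t : ℝ, t ≠ 0 → ∀ x, f (t • x) = t ^ n * f x) (x : E) : fderiv ℝ f x x = n * f x := by
  have h1 : HasDerivAt (fun t : ℝ => f (t • x)) (fderiv ℝ f x x) 1 := by
    have h0 : HasDerivAt (fun t : ℝ => t • x) x 1 := by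
      simpa using (hasDerivAt_id' (1 : ℝ)).smul_const x
    have h2 := (hf ((1 : ℝ) • x)).hasFDerivAt
    have := h2.comp_hasDerivAt (1 : ℝ) h0
    rw [one_smul] at this
    exact this
  have h2 : HasDerivAt (fun t : ℝ => (t : ℂ) ^ n * f x) (n * f x) 1 := by
    have h0 : HasDerivAt (fun t : ℝ => (t : ℂ)) 1 1 := Complex.ofRealCLM.hasDerivAt
    simpa using (h0.fun_pow n).mul_const (f x)
  refine h1.unique (h2.congr_of_eventuallyEq ?_)
  filter_upwards [isOpen_ne.mem_nhds one_ne_zero] with t ht using h t ht x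

theorem dunklOp_comp_smul (ξ : E) (f : E → ℂ) (t : ℝ) (x : E) :
    dunklOp P k ξ (fun y => f (t • y)) x = t * dunklOp P k ξ f (t • x) := by
  have hfd : ∀ η, fderiv ℝ (fun y => f (t • y)) x η = t * fderiv ℝ f (t • x) η := fun η => by
    rw [fderiv_comp_smul]; simp
  have hd : ∀ α, divDiff α (fun y => f (t • y)) x = t * divDiff α f (t • x) := by
    intro α
    rcases eq_or_ne t 0 with rfl | ht
    · simp [divDiff_const]
    unfold divDiff
    have : ⟪α, t • x⟫_ℝ = 0 ↔ ⟪α, x⟫_ℝ = 0 := by simp [inner_smul_right, ht]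
    simp only [this]
    split_ifs with h0
    · exact hfd α
    · rw [map_smul, inner_smul_right]
      have h1 : (⟪α, x⟫_ℝ : ℂ) ≠ 0 := Complex.ofReal_ne_zero.2 h0
      have h2 : (t : ℂ) ≠ 0 := Complex.ofReal_ne_zero.2 ht
      push_cast
      field_simp
  unfold dunklOp
  rw [hfd, mul_add, Finset.mul_sum]
  congr 1
  refine Finset.sum_congr rfl fun α _ => ?_
  rw [hd, mul_left_comm]

theorem dunklOp_smul_point {f : E → ℂ} {t : ℝ} {c : ℂ}
    (h : ∀ x, f (t • x) = c * f x) (hf : Differentiable ℝ f) (ξ x : E) :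
    t * dunklOp P k ξ f (t • x) = c * dunklOp P k ξ f x := by
  rw [← dunklOp_comp_smul, funext h, dunklOp_const_mul ξ hf]

end Homogeneous

/-! ### The inverse of n + ∑ k_α (1 - r_α) -/

section Resolvent

variable {E : Type*} [NormedAddCommGroup E] [InnerProductSpace ℝ E] {R P : Finset E} {k : E → ℂ}

open Classical in
/-- The reflection `r_α` as an element of the reflection group (the identity if `α` is not a
root). -/
noncomputable def reflElt (R : Finset E) (α : E) : reflectionGroup R :=
  if h : α ∈ R then ⟨rootRefl α, rootRefl_mem_reflectionGroup h⟩ else 1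

theorem coe_reflElt {α : E} (h : α ∈ R) : (reflElt R α : E ≃ₗᵢ[ℝ] E) = rootRefl α := by
  simp [reflElt, h]

theorem reflElt_mul_self (α : E) : reflElt R α * reflElt R α = 1 := by
  unfold reflElt
  split_ifs with h
  · exact Subtype.ext (rootRefl_mul_self α)
  · exact mul_one 1

theorem reflElt_mul_cancel_left (α : E) (g : reflectionGroup R) :
    reflElt R α * (reflElt R α * g) = g := by rw [← mul_assoc, reflElt_mul_self, one_mul]

theorem reflElt_mul_cancel_right (α : E) (g : reflectionGroup R) :
    g * reflElt R α * reflElt R α = g := by rw [mul_assoc, reflElt_mul_self, mul_one]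

/-- The operator `n + ∑ k_α (1 - r_α)` is inverted by an element of the group algebra. -/
theorem exists_resolvent (D : IsDatum R P k) [Fintype (reflectionGroup R)] {n : ℕ} (hn : 0 < n) :
    ∃ c : reflectionGroup R → ℂ, (∀ g, ‖c g‖ ≤ (n : ℝ)⁻¹) ∧ ∀ (q p : E → ℂ),
      (∀ x, p x = ∑ g, c g * q (g.1 x)) →
      ∀ x, n * p x + ∑ α ∈ P, k α * (p x - p (rootRefl α x)) = q x := by
  classical
  obtain ⟨c, hc, hb⟩ := exists_accretive_inverse (S := P) (k := k)
    -- Composing ∑ c(g) q ∘ g with r_α multiplies the group index on the right, hence right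
    -- translations here. In the equivariant version below the reflection acts after g, hence left
    -- translations there.
    (σ := fun α (g : reflectionGroup R) => g * reflElt R α)
    (fun α _ g => reflElt_mul_cancel_right α g) (fun α hα => D.re_nonneg' hα)
    (n := n) (by exact_mod_cast hn) 1
  refine ⟨c, hb, fun q p hp x => ?_⟩
  have h1 : ∀ α ∈ P, p (rootRefl α x) = ∑ g, c (g * reflElt R α) * q (g.1 x) := by
    intro α hα
    rw [hp, ← Equiv.sum_comp (Equiv.mulRight (reflElt R α))]
    refine Finset.sum_congr rfl fun g _ => ?_
    simp only [Equiv.coe_mulRight, Subgroup.coe_mul, coe_reflElt (D.mem hα),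
      LinearIsometryEquiv.coe_mul, Function.comp_apply, rootRefl_rootRefl]
  rw [Finset.sum_congr rfl fun α hα => by rw [h1 α hα, hp x], hp x]
  simp_rw [← Finset.sum_sub_distrib, ← sub_mul, Finset.mul_sum]
  rw [Finset.sum_comm, ← Finset.sum_add_distrib]
  have h2 : ∀ g : reflectionGroup R, (n : ℂ) * (c g * q (g.1 x)) +
      ∑ α ∈ P, k α * ((c g - c (g * reflElt R α)) * q (g.1 x)) =
      Pi.single (M := fun _ => ℂ) 1 1 g * q (g.1 x) := by
    intro g
    rw [← hc g, add_mul, Finset.sum_mul, Complex.ofReal_natCast, mul_assoc]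
    simp_rw [mul_assoc]
  rw [Finset.sum_congr rfl fun g _ => h2 g, Finset.sum_eq_single 1]
  · simp
  · intro g _ hg; simp [hg]
  · simp

/-- An eigenvector-valued form of injectivity of `n + ∑ k_α (1 - r_α)`. -/
theorem equivariant_resolvent_injective (D : IsDatum R P k) [Finite (reflectionGroup R)] {n : ℕ}
    (hn : 0 < n) (q : E → E → ℂ)
    (h : ∀ ξ x, n * q ξ x + ∑ α ∈ P, k α * (q ξ x - q (rootRefl α ξ) (rootRefl α x)) = 0)
    (ξ x : E) : q ξ x = 0 := by
  have := Fintype.ofFinite (reflectionGroup R)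
  have h1 := accretive_injective (S := P) (k := k)
    (σ := fun α (g : reflectionGroup R) => reflElt R α * g)
    (fun α _ g => reflElt_mul_cancel_left α g) (fun α hα => D.re_nonneg' hα)
    (n := n) (by exact_mod_cast hn) (fun g => q (g.1 ξ) (g.1 x)) ?_
  · exact congrFun h1 1
  · intro g
    rw [← h (g.1 ξ) (g.1 x)]
    congr 1
    refine Finset.sum_congr rfl fun α hα => ?_
    simp only [Subgroup.coe_mul, coe_reflElt (D.mem hα), LinearIsometryEquiv.coe_mul,
      Function.comp_apply]

end Resolvent

/-! ### Construction of the Dunkl kernel as a convergent power series -/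

section Recursion

variable {E : Type*} [NormedAddCommGroup E] [InnerProductSpace ℝ E] [FiniteDimensional ℝ E]
  {R P : Finset E} {k : E → ℂ}

/-- One step of the homogeneous expansion of the Dunkl kernel. -/
theorem dunklOp_homogeneous_step (D : IsDatum R P k) (l : E →ₗ[ℝ] ℂ) {n : ℕ} {e e' e'' : E → ℂ}
    (he : PolyLE (n + 1) e) (he' : PolyLE n e')
    (hom : ∀ t : ℝ, t ≠ 0 → ∀ x, e (t • x) = t ^ (n + 1) * e x)
    (hom' : ∀ t : ℝ, t ≠ 0 → ∀ x, e' (t • x) = t ^ n * e' x)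
    (heig : ∀ ξ x, dunklOp P k ξ e' x = l ξ * e'' x)
    (hres : ∀ x, (n + 1 : ℕ) * e x + ∑ α ∈ P, k α * (e x - e (rootRefl α x)) = l x * e' x)
    (ξ x : E) : dunklOp P k ξ e x = l ξ * e' x := by
  have hP : ∀ α ∈ P, ⟪α, α⟫_ℝ = 2 := fun α hα => D.inner_self hα
  have := D.root.finite_reflectionGroup
  let b := stdOrthonormalBasis ℝ E
  -- The defect in the equation for T_ξ. It is linear in ξ, and the radial equation says exactly
  -- that it vanishes on the diagonal ξ = x.
  let q : E → E → ℂ := fun ξ x => dunklOp P k ξ e x - l ξ * e' x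
  have hq : ∀ ξ, PolyLE (n + 1) (q ξ) := fun ξ => (he.dunklOp hP ξ).sub (he'.succ.const_mul _)
  have hqd : ∀ ξ, Differentiable ℝ (q ξ) := fun ξ => (hq ξ).differentiable
  have hTe : ∀ ξ, Differentiable ℝ (dunklOp P k ξ e) := fun ξ => (he.dunklOp hP ξ).differentiable
  have hqself : ∀ x, q x x = 0 := by
    intro x
    simp only [q]
    rw [dunklOp_self, fderiv_self_of_homogeneous he.differentiable hom, hres, sub_self]
  have hqlin : ∀ ξ x, q ξ x = ∑ i, (⟪b i, ξ⟫_ℝ : ℂ) * q (b i) x := by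
    intro ξ x
    simp only [q, mul_sub, Finset.sum_sub_distrib]
    rw [dunklOp_eq_sum_coord ξ e x]
    congr 1
    conv_lhs => rw [← b.sum_repr' ξ]
    rw [map_sum, Finset.sum_mul]
    refine Finset.sum_congr rfl fun i _ => ?_
    rw [map_smul, Complex.real_smul, mul_assoc]
  have hqsub : ∀ ξ α x (c : ℝ), q (ξ - c • α) x = q ξ x - c * q α x := by
    intro ξ α x c
    simp only [q]
    rw [dunklOp_sub_smul_left, map_sub, map_smul, Complex.real_smul]; ring
  -- Integrability condition: T_η T_ξ e is symmetric by commutativity, and T_η (l(ξ) e') = l(ξ) l(η)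
  -- e'' is symmetric by the previous stage of the recursion.
  have hsymm : ∀ ξ η x, dunklOp P k η (q ξ) x = dunklOp P k ξ (q η) x := by
    intro ξ η x
    simp only [q]
    rw [dunklOp_sub η (hTe ξ) (he'.differentiable.const_mul _),
      dunklOp_sub ξ (hTe η) (he'.differentiable.const_mul _), dunklOp_comm D η ξ he,
      dunklOp_const_mul η he'.differentiable, dunklOp_const_mul ξ he'.differentiable, heig, heig]
    ring
  have hqhom : ∀ ξ, ∀ t : ℝ, t ≠ 0 → ∀ x, q ξ (t • x) = t ^ n * q ξ x := by
    intro ξ t ht x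
    have h1 := dunklOp_smul_point (P := P) (k := k) (hom t ht) he.differentiable ξ x
    have h2 : (t : ℂ) ≠ 0 := Complex.ofReal_ne_zero.2 ht
    simp only [q]
    rw [hom' t ht]
    have h3 : dunklOp P k ξ e (t • x) = t ^ n * dunklOp P k ξ e x := by
      apply mul_left_cancel₀ h2
      rw [h1]; ring
    rw [h3]; ring
  -- Apply T_η to the identity ∑ x_i q_i(x) = 0. Symmetry turns ∑ x_i T_η q_i into T_x q_η, which is
  -- computed from homogeneity of degree n; the commutator supplies one more q_η (so n becomes n +
  -- 1) and the terms (α, η) q_α(r_α x). Since q_{r_α η} = q_η - (α, η) q_α, the result is the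
  -- homogeneous accretive equation for the pair (η, x) moved jointly by the group.
  have key : ∀ η x, (n + 1 : ℕ) * q η x +
      ∑ α ∈ P, k α * (q η x - q (rootRefl α η) (rootRefl α x)) = 0 := by
    intro η x
    let li : ∀ i, E →ₗ[ℝ] ℂ := fun i => Complex.ofRealCLM.toLinearMap ∘ₗ innerₗ E (b i)
    have hli : ∀ i y, li i y = (⟪b i, y⟫_ℝ : ℂ) := fun i y => rfl
    have h0 : (fun y => ∑ i, li i y * q (b i) y) = fun _ => 0 := by
      funext y
      simp_rw [hli]
      rw [← hqlin, hqself]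
    have h1 := dunklOp_sum (P := P) (k := k) Finset.univ η
      (f := fun i y => li i y * q (b i) y) (fun i => (differentiable_linear _).mul (hqd _)) x
    rw [h0, dunklOp_const] at h1
    rw [Finset.sum_congr rfl fun i _ => dunklOp_linear_mul hP η (li i) (hqd (b i)) x] at h1
    rw [Finset.sum_add_distrib, Finset.sum_add_distrib] at h1
    simp_rw [hsymm (b _) η, hli] at h1
    rw [← dunklOp_eq_sum_coord, ← hqlin, dunklOp_self,
      fderiv_self_of_homogeneous (hqd η) (hqhom η), Finset.sum_comm] at h1
    rw [Finset.sum_congr rfl fun α hα => show ∑ i, k α * (⟪α, η⟫_ℝ : ℂ) * (⟪b i, α⟫_ℝ : ℂ) *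
      q (b i) (rootRefl α x) = k α * (⟪α, η⟫_ℝ : ℂ) * q α (rootRefl α x) by
        rw [hqlin α, Finset.mul_sum]
        exact Finset.sum_congr rfl fun i _ => by ring] at h1
    rw [h1, Finset.sum_congr rfl fun α hα => show
      k α * (q η x - q (rootRefl α η) (rootRefl α x)) = k α * (q η x - q η (rootRefl α x)) +
        k α * (⟪α, η⟫_ℝ : ℂ) * q α (rootRefl α x) by
      rw [rootRefl_apply (D.inner_self hα) η, hqsub]; ring, Finset.sum_add_distrib]
    push_cast
    ring
  exact sub_eq_zero.1 (equivariant_resolvent_injective D n.succ_pos q key ξ x)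

/-- The homogeneous components, as multilinear maps, of a solution of the radial equation. -/
noncomputable def kernelSeries [Fintype (reflectionGroup R)] (l : E →L[ℝ] ℂ)
    (c : ℕ → reflectionGroup R → ℂ) : (n : ℕ) → ContinuousMultilinearMap ℝ (fun _ : Fin n => E) ℂ
  | 0 => ContinuousMultilinearMap.constOfIsEmpty ℝ (fun _ : Fin 0 => E) 1
  | n + 1 => ∑ g : reflectionGroup R, c n g • ContinuousLinearMap.uncurryLeft
      (ContinuousLinearMap.smulRight (l ∘L (g.1.toContinuousLinearEquiv : E →L[ℝ] E))
        ((kernelSeries l c n).compContinuousLinearMap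
          fun _ => (g.1.toContinuousLinearEquiv : E →L[ℝ] E)))

section KernelSeries

variable [Fintype (reflectionGroup R)] (l : E →L[ℝ] ℂ) (c : ℕ → reflectionGroup R → ℂ)

/-- The homogeneous polynomial functions belonging to `kernelSeries`. -/
noncomputable def kernelTerm (n : ℕ) (x : E) : ℂ := kernelSeries l c n fun _ => x

theorem kernelTerm_zero (x : E) : kernelTerm l c 0 x = 1 := rfl

theorem kernelTerm_succ (n : ℕ) (x : E) :
    kernelTerm l c (n + 1) x = ∑ g : reflectionGroup R, c n g * (l (g.1 x) * kernelTerm l c n (g.1 x)) := by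
  simp only [kernelTerm, kernelSeries, sum_apply,
    smul_apply, ContinuousLinearMap.uncurryLeft_apply]
  rfl

/-- Each stage sums over the group, multiplies by l, and gains the factor 1/(n + 1) from the
resolvent coefficients. The factorials make the series entire. -/
theorem norm_kernelSeries_le (hc : ∀ n g, ‖c n g‖ ≤ ((n + 1 : ℕ) : ℝ)⁻¹) (n : ℕ) :
    ‖kernelSeries l c n‖ ≤ (Fintype.card (reflectionGroup R) * ‖l‖) ^ n / n.factorial := by
  induction n with
  | zero => simp [kernelSeries]
  | succ n ih =>
    rw [kernelSeries]
    refine (norm_sum_le _ _).trans ((Finset.sum_le_card_nsmul _ _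
      (((n + 1 : ℕ) : ℝ)⁻¹ * (‖l‖ * ‖kernelSeries l c n‖)) fun g _ => ?_).trans ?_)
    · rw [norm_smul, ContinuousLinearMap.uncurryLeft_norm]
      refine mul_le_mul (hc n g) ?_ (ContinuousLinearMap.opNorm_nonneg _) (by positivity)
      refine ContinuousLinearMap.opNorm_le_bound _ (by positivity) fun y => ?_
      rw [ContinuousLinearMap.smulRight_apply, norm_smul, mul_right_comm]
      gcongr
      · have := l.le_opNorm (g.1 y)
        rw [g.1.norm_map] at this
        exact this
      · exact (ContinuousMultilinearMap.norm_compContinuous_linearIsometryEquiv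
          (kernelSeries l c n) (fun _ => g.1)).le
    rw [Finset.card_univ, nsmul_eq_mul]
    calc _ ≤ Fintype.card (reflectionGroup R) * (((n + 1 : ℕ) : ℝ)⁻¹ * (‖l‖ *
          ((Fintype.card (reflectionGroup R) * ‖l‖) ^ n / n.factorial))) := by gcongr
      _ = _ := by
        rw [Nat.factorial_succ, pow_succ]
        push_cast
        field_simp

theorem norm_kernelTerm_le (hc : ∀ n g, ‖c n g‖ ≤ ((n + 1 : ℕ) : ℝ)⁻¹) (n : ℕ) (x : E) :
    ‖kernelTerm l c n x‖ ≤ (Fintype.card (reflectionGroup R) * ‖l‖ * ‖x‖) ^ n / n.factorial := by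
  have h1 := (kernelSeries l c n).le_opNorm fun _ => x
  have h2 := norm_kernelSeries_le l c hc n
  simp only [Finset.prod_const, Finset.card_univ, Fintype.card_fin] at h1
  calc _ ≤ _ := h1
    _ ≤ (Fintype.card (reflectionGroup R) * ‖l‖) ^ n / n.factorial * ‖x‖ ^ n := by gcongr
    _ = _ := by rw [mul_pow _ ‖x‖]; ring

theorem polyLE_kernelTerm (n : ℕ) : PolyLE n (kernelTerm l c n) := by
  induction n with
  | zero => exact PolyLE.const 0 1
  | succ n ih =>
    rw [funext (kernelTerm_succ l c n)]
    refine PolyLE.sum _ fun g _ => PolyLE.const_mul ?_ _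
    exact (ih.linear_mul l.toLinearMap).comp_isometry g.1

theorem kernelTerm_smul (n : ℕ) (t : ℝ) (x : E) :
    kernelTerm l c n (t • x) = t ^ n * kernelTerm l c n x := by
  have := (kernelSeries l c n).map_smul_univ (fun _ => t) fun _ => x
  simpa [kernelTerm] using this

theorem norm_fderiv_kernelTerm_succ_le (hc : ∀ n g, ‖c n g‖ ≤ ((n + 1 : ℕ) : ℝ)⁻¹) (n : ℕ) (x : E)
    {B : ℝ} (hB : ∀ y, ‖y‖ = ‖x‖ → ‖fderiv ℝ (kernelTerm l c n) y‖ ≤ B) :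
    ‖fderiv ℝ (kernelTerm l c (n + 1)) x‖ ≤ Fintype.card (reflectionGroup R) * ‖l‖ *
      (‖x‖ * B + (Fintype.card (reflectionGroup R) * ‖l‖ * ‖x‖) ^ n / n.factorial) / (n + 1) := by
  have hB0 : 0 ≤ B := (norm_nonneg _).trans (hB x rfl)
  have hd : ∀ g : reflectionGroup R, Differentiable ℝ
      fun y => l (g.1 y) * kernelTerm l c n (g.1 y) := fun g =>
    (((polyLE_kernelTerm l c n).linear_mul l.toLinearMap).comp_isometry g.1).differentiable
  refine ContinuousLinearMap.opNorm_le_bound _ (by positivity) fun ξ => ?_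
  rw [funext (kernelTerm_succ l c n), fderiv_fun_sum fun g _ =>
    (hd g x).const_mul (c n g), sum_apply]
  refine (norm_sum_le _ _).trans ((Finset.sum_le_card_nsmul _ _
    (((n + 1 : ℕ) : ℝ)⁻¹ * (‖l‖ * ‖x‖ * (B * ‖ξ‖) + ‖l‖ * ‖ξ‖ *
      ((Fintype.card (reflectionGroup R) * ‖l‖ * ‖x‖) ^ n / n.factorial))) fun g _ => ?_).trans ?_)
  · rw [fderiv_const_mul (hd g x)]
    have h1 := fderiv_comp_isometry (fun y => l y * kernelTerm l c n y) g.1 x ξ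
    have h2 := fderiv_linear_mul l.toLinearMap (polyLE_kernelTerm l c n).differentiable
      (g.1 x) (g.1 ξ)
    have h3 : fderiv ℝ (fun y => l (g.1 y) * kernelTerm l c n (g.1 y)) x ξ = l (g.1 x) *
          fderiv ℝ (kernelTerm l c n) (g.1 x) (g.1 ξ) + l (g.1 ξ) * kernelTerm l c n (g.1 x) :=
      h1.trans h2
    rw [smul_apply, norm_smul, h3]
    have hx : ‖g.1 x‖ = ‖x‖ := g.1.norm_map x
    have hξ : ‖g.1 ξ‖ = ‖ξ‖ := g.1.norm_map ξ
    refine mul_le_mul (hc n g) ((norm_add_le _ _).trans ?_) (norm_nonneg _) (by positivity)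
    rw [norm_mul, norm_mul]
    have h4 := norm_kernelTerm_le l c hc n (g.1 x)
    have h5 := l.le_opNorm (g.1 x)
    have h6 := l.le_opNorm (g.1 ξ)
    have h7 := ((fderiv ℝ (kernelTerm l c n) (g.1 x)).le_opNorm (g.1 ξ)).trans
      (mul_le_mul_of_nonneg_right (hB _ hx) (norm_nonneg _))
    rw [hx] at h4 h5
    rw [hξ] at h6 h7
    gcongr
  · rw [Finset.card_univ, nsmul_eq_mul]
    apply le_of_eq
    push_cast
    field_simp

/-- The bound reproduces itself under the recursion, since (1/n! + 1/(n + 1)!)/(n + 2) = 1/(n + 1)!.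
It justifies termwise differentiation and sums to the exponential bound on the gradient. -/
theorem norm_fderiv_kernelTerm_le (hc : ∀ n g, ‖c n g‖ ≤ ((n + 1 : ℕ) : ℝ)⁻¹) (n : ℕ) (x : E) :
    ‖fderiv ℝ (kernelTerm l c (n + 1)) x‖ ≤ Fintype.card (reflectionGroup R) * ‖l‖ *
      ((Fintype.card (reflectionGroup R) * ‖l‖ * ‖x‖) ^ n / n.factorial) := by
  induction n generalizing x with
  | zero =>
    refine (norm_fderiv_kernelTerm_succ_le l c hc 0 x (B := 0) fun y _ => ?_).trans (by simp)
    rw [funext (kernelTerm_zero l c)]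
    simp
  | succ n ih =>
    refine (norm_fderiv_kernelTerm_succ_le l c hc (n + 1) x
      (B := Fintype.card (reflectionGroup R) * ‖l‖ *
        ((Fintype.card (reflectionGroup R) * ‖l‖ * ‖x‖) ^ n / n.factorial))
      fun y hy => ?_).trans_eq ?_
    · rw [← hy]; exact ih y
    · rw [Nat.factorial_succ, pow_succ]
      push_cast
      field_simp

end KernelSeries

theorem hasSum_divDiff {α : E} {e : ℕ → E → ℂ} {f : E → ℂ} {x : E} (h : ∀ y, HasSum (fun n => e n y) (f y))
    (h' : HasSum (fun n => fderiv ℝ (e n) x α) (fderiv ℝ f x α)) :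
    HasSum (fun n => divDiff α (e n) x) (divDiff α f x) := by
  unfold divDiff
  split_ifs
  · exact h'
  · exact ((h _).sub (h _)).div_const _

/-- Existence of the Dunkl kernel, with exponential bounds on its first-order jet. -/
theorem exists_isDunklKernel (D : IsDatum R P k) (l : E →ₗ[ℝ] ℂ) :
    ∃ f, IsDunklKernel P k l f ∧ ∃ C : ℝ, ∀ x, ‖fderiv ℝ f x‖ ≤ C * Real.exp (C * ‖x‖) := by
  have := D.root.finite_reflectionGroup
  have := Fintype.ofFinite (reflectionGroup R)
  let L : E →L[ℝ] ℂ := LinearMap.toContinuousLinearMap l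
  have hL : ∀ x, L x = l x := fun x => rfl
  -- The index is shifted: the coefficients c n invert the operator with constant n + 1 and produce
  -- the term of degree n + 1.
  choose c hc hres using fun n : ℕ => exists_resolvent D n.succ_pos
  set M : ℝ := Fintype.card (reflectionGroup R) * ‖L‖ with hM
  let e : ℕ → E → ℂ := kernelTerm L c
  have hM0 : 0 ≤ M := by positivity
  have he : ∀ n, PolyLE n (e n) := polyLE_kernelTerm L c
  have heig : ∀ n ξ x, dunklOp P k ξ (e (n + 1)) x = l ξ * e n x := by
    have hr : ∀ n x, (n + 1 : ℕ) * e (n + 1) x +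
        ∑ α ∈ P, k α * (e (n + 1) x - e (n + 1) (rootRefl α x)) = l x * e n x := fun n =>
      hres n (fun x => l x * e n x) (e (n + 1)) (kernelTerm_succ L c n)
    intro n
    induction n with
    | zero =>
      refine dunklOp_homogeneous_step D l (e'' := 0) (he 1) (he 0)
        (fun t _ => kernelTerm_smul L c 1 t) (fun t _ => kernelTerm_smul L c 0 t) ?_ (hr 0)
      intro ξ x
      rw [show e 0 = fun _ => 1 from rfl, dunklOp_const]; simp
    | succ n ih =>
      exact dunklOp_homogeneous_step D l (he _) (he _) (fun t _ => kernelTerm_smul L c _ t)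
        (fun t _ => kernelTerm_smul L c _ t) ih (hr _)
  let p : FormalMultilinearSeries ℝ E ℂ := kernelSeries L c
  have hrad : p.radius = ⊤ := by
    refine FormalMultilinearSeries.radius_eq_top_of_summable_norm p fun r => ?_
    refine Summable.of_nonneg_of_le (fun n => by positivity) (fun n => ?_)
      (Real.summable_pow_div_factorial (M * r))
    have := norm_kernelSeries_le L c hc n
    calc ‖p n‖ * (r : ℝ) ^ n ≤ M ^ n / n.factorial * r ^ n := by gcongr
      _ = _ := by rw [mul_pow]; ring
  let f : E → ℂ := p.sum
  have hball : HasFPowerSeriesOnBall f p 0 ⊤ := by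
    rw [← hrad]; exact p.hasFPowerSeriesOnBall (by rw [hrad]; exact ENNReal.zero_lt_top)
  have hsmooth : ContDiff ℝ ∞ f := by
    have h1 := hball.analyticOnNhd
    rw [Metric.eball_top] at h1
    exact h1.contDiff
  have hf : ∀ x, HasSum (fun n => e n x) (f x) := by
    intro x
    have := hball.hasSum (y := x) (by simp)
    rw [zero_add] at this
    exact this
  -- Splitting off the constant term matches the derivative bounds, which are available only from
  -- degree one on.
  have hf' : ∀ x, f x = 1 + ∑' n, e (n + 1) x := by
    intro x
    rw [← (hf x).tsum_eq, (hf x).summable.tsum_eq_zero_add]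
    rfl
  have hsum : ∀ x : E, Summable fun n : ℕ => M * ((M * ‖x‖) ^ n / n.factorial) := fun x =>
    (Real.summable_pow_div_factorial _).mul_left _
  have hfd : ∀ x, HasSum (fun n => fderiv ℝ (e (n + 1)) x) (fderiv ℝ f x) := by
    intro x
    have hu : Summable fun n : ℕ => M * ((M * (‖x‖ + 1)) ^ n / n.factorial) :=
      (Real.summable_pow_div_factorial _).mul_left _
    have h1 := hasFDerivAt_tsum_of_isPreconnected (𝕜 := ℝ) (f := fun n => e (n + 1))
      (f' := fun n => fderiv ℝ (e (n + 1))) (x₀ := x) (x := x) hu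
      (Metric.isOpen_ball (x := (0 : E)) (ε := ‖x‖ + 1)) (convex_ball _ _).isPreconnected
      (fun n y _ => ((he _).differentiable y).hasFDerivAt) ?_ (by simp)
      ((summable_nat_add_iff 1).2 (hf x).summable) (by simp)
    · have h2 : HasFDerivAt f (∑' n, fderiv ℝ (e (n + 1)) x) x := by
        rw [funext hf']; exact h1.const_add 1
      rw [h2.fderiv]
      exact (Summable.of_norm_bounded (hsum x)
        fun n => norm_fderiv_kernelTerm_le L c hc n x).hasSum
    · intro n y hy
      refine (norm_fderiv_kernelTerm_le L c hc n y).trans ?_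
      have : ‖y‖ ≤ ‖x‖ + 1 := by simpa using (Metric.mem_ball.1 hy).le
      gcongr
  refine ⟨f, ⟨hsmooth, ?_, ?_⟩, M, ?_⟩
  · rw [hf']
    have : ∀ n, e (n + 1) 0 = 0 := fun n => by
      have := kernelTerm_smul L c (n + 1) 0 0
      simpa using this
    simp [this]
  · intro ξ x
    have h1 : HasSum (fun n => dunklOp P k ξ (e (n + 1)) x) (dunklOp P k ξ f x) := by
      unfold dunklOp
      have hx : ∀ η, HasSum (fun n => fderiv ℝ (e (n + 1)) x η) (fderiv ℝ f x η) := fun η =>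
        (hfd x).mapL (ContinuousLinearMap.apply ℝ ℂ η)
      refine (hx ξ).add (hasSum_sum fun α _ => HasSum.mul_left _ ?_)
      have h2 : ∀ y, HasSum (fun n => e (n + 1) y) (f y - 1) := fun y => by
        have := (hasSum_nat_add_iff' 1).2 (hf y)
        simpa [e, kernelTerm_zero] using this
      have h3 := hasSum_divDiff (f := fun y => f y - 1) (x := x) (α := α) h2
        (by rw [fderiv_sub_const]; exact hx α)
      convert! h3 using 1
      simp [divDiff, fderiv_sub_const]
    simp_rw [heig] at h1
    exact h1.unique ((hf x).mul_left _)
  · intro x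
    have h1 : HasSum (fun n : ℕ => M * ((M * ‖x‖) ^ n / n.factorial)) (M * Real.exp (M * ‖x‖)) := by
      have := NormedSpace.expSeries_div_hasSum_exp (𝔸 := ℝ) (M * ‖x‖)
      rw [← Real.exp_eq_exp_ℝ] at this
      exact this.mul_left M
    rw [← (hfd x).tsum_eq, ← h1.tsum_eq]
    exact tsum_of_norm_bounded (hsum x).hasSum fun n => norm_fderiv_kernelTerm_le L c hc n x

end Recursion


/-! ### Uniqueness, symmetry and boundedness of the Dunkl kernel -/

section Kernel

variable {E : Type*} [NormedAddCommGroup E] [InnerProductSpace ℝ E] [FiniteDimensional ℝ E]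
  {R P : Finset E} {k : E → ℂ}

namespace IsDunklKernel

variable {l : E →ₗ[ℝ] ℂ} {f : E → ℂ}

theorem differentiable (hf : IsDunklKernel P k l f) : Differentiable ℝ f :=
  hf.contDiff.differentiable (by simp)

theorem hasDerivAt_ray (hf : IsDunklKernel P k l f) (y : E) (t : ℝ) :
    HasDerivAt (fun t : ℝ => f (t • y)) (fderiv ℝ f (t • y) y) t := by
  have h0 : HasDerivAt (fun t : ℝ => t • y) y t := by
    simpa using (hasDerivAt_id' t).smul_const y
  exact (hf.differentiable (t • y)).hasFDerivAt.comp_hasDerivAt t h0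

/-- The eigenvalue equation at the point ty in the direction ty. Since r_α y is another point of the
orbit, the restrictions to the rays of one orbit form a closed linear system. -/
theorem ray_equation (hf : IsDunklKernel P k l f) (y : E) (t : ℝ) :
    t * fderiv ℝ f (t • y) y = t * (l y * f (t • y)) -
      ∑ α ∈ P, k α * (f (t • y) - f (t • rootRefl α y)) := by
  have h := hf.eigen (t • y) (t • y)
  rw [dunklOp_self, map_smul, map_smul, Complex.real_smul, Complex.real_smul] at h
  simp_rw [map_smul] at h
  rw [← mul_assoc, ← h]; ring

/-- The difference of two solutions has zero energy at t = 0 on every ray of the orbit of x, hence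
zero energy at t = 1. -/
theorem unique (D : IsDatum R P k) {f₁ f₂ : E → ℂ} (h₁ : IsDunklKernel P k l f₁)
    (h₂ : IsDunklKernel P k l f₂) : f₁ = f₂ := by
  have := D.root.finite_reflectionGroup
  have := Fintype.ofFinite (reflectionGroup R)
  funext x
  have key := radial_system_bound (S := P) (k := k)
    (σ := fun α (g : reflectionGroup R) => reflElt R α * g)
    (fun α _ g => reflElt_mul_cancel_left α g) (fun α hα => D.re_nonneg' hα)
    (fun g => l (g.1 x)) (M := ‖LinearMap.toContinuousLinearMap l‖ * ‖x‖) ?_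
    (fun g t => f₁ (t • g.1 x) - f₂ (t • g.1 x))
    (fun g t => fderiv ℝ f₁ (t • g.1 x) (g.1 x) - fderiv ℝ f₂ (t • g.1 x) (g.1 x))
    ?_ ?_ ?_ zero_le_one
  · simp only [one_smul, zero_smul, h₁.map_zero, h₂.map_zero, sub_self, norm_zero, ne_eq,
      OfNat.ofNat_ne_zero, not_false_eq_true, zero_pow, Finset.sum_const_zero, mul_zero] at key
    have h3 := (Finset.sum_eq_zero_iff_of_nonneg (fun i _ => by positivity)).1
      (le_antisymm key (Finset.sum_nonneg fun i _ => by positivity)) 1 (Finset.mem_univ _)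
    simpa [sub_eq_zero] using h3
  · intro g
    refine (Complex.re_le_norm _).trans ?_
    have := (LinearMap.toContinuousLinearMap l).le_opNorm (g.1 x)
    rwa [g.1.norm_map] at this
  · intro g
    exact ((h₁.hasDerivAt_ray _ 0).sub (h₂.hasDerivAt_ray _ 0)).continuousAt.continuousWithinAt
  · intro g t _
    exact (h₁.hasDerivAt_ray _ t).sub (h₂.hasDerivAt_ray _ t)
  · intro g t _
    rw [mul_sub, h₁.ray_equation, h₂.ray_equation, sub_sub_sub_comm, ← Finset.sum_sub_distrib]
    congr 1
    · ring
    · refine Finset.sum_congr rfl fun α hα => ?_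
      simp only [Subgroup.coe_mul, coe_reflElt (D.mem hα), LinearIsometryEquiv.coe_mul,
        Function.comp_apply]
      ring

end IsDunklKernel

theorem IsDatum.isDunklKernel (D : IsDatum R P k) (l : E →ₗ[ℝ] ℂ) :
    IsDunklKernel P k l (dunklExp P k l) := by
  obtain ⟨f, hf, _⟩ := exists_isDunklKernel D l
  exact Classical.epsilon_spec ⟨f, hf⟩

theorem IsDatum.eq_dunklExp (D : IsDatum R P k) {l : E →ₗ[ℝ] ℂ} {f : E → ℂ}
    (hf : IsDunklKernel P k l f) : f = dunklExp P k l :=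
  hf.unique D (D.isDunklKernel l)

theorem IsDatum.exists_norm_fderiv_dunklExp_le (D : IsDatum R P k) (l : E →ₗ[ℝ] ℂ) :
    ∃ C : ℝ, ∀ x, ‖fderiv ℝ (dunklExp P k l) x‖ ≤ C * Real.exp (C * ‖x‖) := by
  obtain ⟨f, hf, h⟩ := exists_isDunklKernel D l
  rwa [D.eq_dunklExp hf] at h

theorem smulForm_apply (c : ℂ) (v ξ : E) : smulForm c v ξ = c * ⟪v, ξ⟫_ℝ := rfl

theorem dunklExp_zero_right (D : IsDatum R P k) (l : E →ₗ[ℝ] ℂ) : dunklExp P k l 0 = 1 :=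
  (D.isDunklKernel l).map_zero

theorem dunklExp_smul (D : IsDatum R P k) (c : ℂ) (t : ℝ) (v x : E) :
    dunklExp P k (smulForm c (t • v)) x = dunklExp P k (smulForm c v) (t • x) := by
  have h := D.isDunklKernel (smulForm c v)
  refine (congrFun (D.eq_dunklExp (l := smulForm c (t • v))
    (f := fun x => dunklExp P k (smulForm c v) (t • x)) ⟨?_, ?_, ?_⟩) x).symm
  · exact h.contDiff.comp (contDiff_const_smul t)
  · simp [h.map_zero]
  · intro ξ x
    rw [dunklOp_comp_smul, h.eigen, smulForm_apply, smulForm_apply, real_inner_smul_left]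
    push_cast; ring

/-- By uniqueness: the function x ↦ Exp(g v, g x) is normalized and, by equivariance of the Dunkl
operators, solves the system with parameter v. -/
theorem dunklExp_map (D : IsDatum R P k) (c : ℂ) {g : E ≃ₗᵢ[ℝ] E} (hg : g ∈ reflectionGroup R)
    (v x : E) : dunklExp P k (smulForm c (g v)) (g x) = dunklExp P k (smulForm c v) x := by
  have h := D.isDunklKernel (smulForm c (g v))
  refine congrFun (D.eq_dunklExp (l := smulForm c v)
    (f := fun x => dunklExp P k (smulForm c (g v)) (g x)) ⟨?_, ?_, ?_⟩) x
  · exact h.contDiff.comp g.contDiff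
  · simp [h.map_zero]
  · intro ξ x
    rw [dunklOp_comp_isometry D hg, h.eigen, smulForm_apply, smulForm_apply, g.inner_map_map]

/-- Symmetry of the Dunkl kernel. -/
theorem dunklExp_comm (D : IsDatum R P k) (c : ℂ) (v x : E) :
    dunklExp P k (smulForm c v) x = dunklExp P k (smulForm c x) v := by
  have := D.root.finite_reflectionGroup
  have := Fintype.ofFinite (reflectionGroup R)
  have hK := fun v : E => D.isDunklKernel (smulForm c v)
  -- For each g compare t ↦ Exp(v, t g x) with t ↦ Exp(g x, t v). Equivariance moves r_α from the
  -- second argument of the latter to the first, so both families solve the same system over the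
  -- orbit of x and agree at t = 0.
  have key := radial_system_bound (S := P) (k := k)
    (σ := fun α (g : reflectionGroup R) => reflElt R α * g)
    (fun α _ g => reflElt_mul_cancel_left α g) (fun α hα => D.re_nonneg' hα)
    (fun g => smulForm c v (g.1 x)) (M := ‖c‖ * (‖v‖ * ‖x‖)) ?_
    (fun g t => dunklExp P k (smulForm c v) (t • g.1 x) -
      dunklExp P k (smulForm c (g.1 x)) (t • v))
    (fun g t => fderiv ℝ (dunklExp P k (smulForm c v)) (t • g.1 x) (g.1 x) -
      fderiv ℝ (dunklExp P k (smulForm c (g.1 x))) (t • v) v)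
    ?_ ?_ ?_ zero_le_one
  · simp only [one_smul, zero_smul, (hK _).map_zero, sub_self, norm_zero, ne_eq,
      OfNat.ofNat_ne_zero, not_false_eq_true, zero_pow, Finset.sum_const_zero, mul_zero] at key
    have h3 := (Finset.sum_eq_zero_iff_of_nonneg (fun i _ => by positivity)).1
      (le_antisymm key (Finset.sum_nonneg fun i _ => by positivity)) 1 (Finset.mem_univ _)
    simpa [sub_eq_zero] using h3
  · intro g
    refine (Complex.re_le_norm _).trans ?_
    rw [smulForm_apply, norm_mul, Complex.norm_real]
    have := norm_inner_le_norm (𝕜 := ℝ) v (g.1 x)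
    rw [g.1.norm_map] at this
    gcongr
  · intro g
    exact (((hK v).hasDerivAt_ray _ 0).sub
      ((hK _).hasDerivAt_ray _ 0)).continuousAt.continuousWithinAt
  · intro g t _
    exact ((hK v).hasDerivAt_ray _ t).sub ((hK _).hasDerivAt_ray _ t)
  · intro g t _
    rw [mul_sub, (hK v).ray_equation, (hK (g.1 x)).ray_equation, sub_sub_sub_comm,
      ← Finset.sum_sub_distrib]
    congr 1
    · rw [smulForm_apply, smulForm_apply, real_inner_comm]; ring
    · refine Finset.sum_congr rfl fun α hα => ?_
      simp only [Subgroup.coe_mul, coe_reflElt (D.mem hα), LinearIsometryEquiv.coe_mul,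
        Function.comp_apply]
      have := dunklExp_map D c (D.refl_mem hα) (rootRefl α (g.1 x)) (t • v)
      rw [rootRefl_rootRefl, map_smul] at this
      rw [this]
      ring

/-- The Dunkl kernel is bounded for imaginary spectral parameter. -/
theorem exists_norm_dunklExp_le (D : IsDatum R P k) :
    ∃ B : ℝ, ∀ v x : E, ‖dunklExp P k (smulForm Complex.I v) x‖ ≤ B := by
  have := D.root.finite_reflectionGroup
  have := Fintype.ofFinite (reflectionGroup R)
  refine ⟨Fintype.card (reflectionGroup R), fun v x => ?_⟩
  have hK := D.isDunklKernel (smulForm Complex.I v)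
  -- For imaginary parameter Re i(v, g x) = 0, so M = 0 and the energy never exceeds its initial
  -- value |G|.
  have key := radial_system_bound (S := P) (k := k)
    (σ := fun α (g : reflectionGroup R) => reflElt R α * g)
    (fun α _ g => reflElt_mul_cancel_left α g) (fun α hα => D.re_nonneg' hα)
    (fun g => smulForm Complex.I v (g.1 x)) (M := 0) ?_
    (fun g t => dunklExp P k (smulForm Complex.I v) (t • g.1 x))
    (fun g t => fderiv ℝ (dunklExp P k (smulForm Complex.I v)) (t • g.1 x) (g.1 x))
    ?_ ?_ ?_ zero_le_one
  · simp only [one_smul, zero_smul, hK.map_zero, mul_zero, Real.exp_zero, one_mul,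
      norm_one, one_pow, Finset.sum_const, Finset.card_univ, nsmul_eq_mul, mul_one] at key
    have h1 : ‖dunklExp P k (smulForm Complex.I v) x‖ ^ 2 ≤ Fintype.card (reflectionGroup R) :=
      le_trans (Finset.single_le_sum (f := fun g : reflectionGroup R =>
        ‖dunklExp P k (smulForm Complex.I v) (g.1 x)‖ ^ 2) (fun i _ => by positivity)
        (Finset.mem_univ 1)) key
    have h2 : (1 : ℝ) ≤ Fintype.card (reflectionGroup R) := by
      exact_mod_cast Fintype.card_pos
    nlinarith [norm_nonneg (dunklExp P k (smulForm Complex.I v) x)]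
  · intro g
    rw [smulForm_apply]; simp
  · intro g
    exact (hK.hasDerivAt_ray _ 0).continuousAt.continuousWithinAt
  · intro g t _
    exact hK.hasDerivAt_ray _ t
  · intro g t _
    rw [hK.ray_equation]
    congr 1
    refine Finset.sum_congr rfl fun α hα => ?_
    simp only [Subgroup.coe_mul, coe_reflElt (D.mem hα), LinearIsometryEquiv.coe_mul,
      Function.comp_apply]

theorem dunklExp_zero_mult (D : IsDatum R P k) (c : ℂ) (v x : E) :
    dunklExp P 0 (smulForm c v) x = Complex.exp (c * ⟪v, x⟫_ℝ) := by
  refine (congrFun (D.zero.eq_dunklExp (l := smulForm c v)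
    (f := fun x => Complex.exp (c * ⟪v, x⟫_ℝ)) ⟨?_, ?_, ?_⟩) x).symm
  · have : ContDiff ℝ ∞ (LinearMap.toContinuousLinearMap (smulForm c v)) :=
      ContinuousLinearMap.contDiff _
    exact this.cexp
  · simp
  · intro ξ x
    have h1 : HasFDerivAt (fun x => (smulForm c v) x) (LinearMap.toContinuousLinearMap (smulForm c v)) x :=
      (LinearMap.toContinuousLinearMap (smulForm c v)).hasFDerivAt
    have h2 := h1.cexp.fderiv
    simp only [dunklOp, Pi.zero_apply, zero_mul, Finset.sum_const_zero, add_zero]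
    simp only [smulForm_apply] at h2
    rw [h2]
    simp [smulForm_apply, mul_comm]

end Kernel


/-! ### Growth classes for functions, kernels and weights -/

section Growth

variable {E : Type*} [NormedAddCommGroup E] [InnerProductSpace ℝ E]

/-- At most exponential growth. -/
def ExpGrowth (h : E → ℂ) : Prop := ∃ C : ℝ, ∀ x, ‖h x‖ ≤ C * Real.exp (C * ‖x‖)

/-- At most polynomial growth. -/
def PolyGrowth (h : E → ℂ) : Prop := ∃ (C : ℝ) (N : ℕ), ∀ x, ‖h x‖ ≤ C * (1 + ‖x‖) ^ N

namespace ExpGrowth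

variable {h h' : E → ℂ}

/-- One constant serves as both prefactor and rate in the definition; this merges separate ones. -/
theorem of_le (A B : ℝ) (hh : ∀ x, ‖h x‖ ≤ A * Real.exp (B * ‖x‖)) : ExpGrowth h := by
  refine ⟨max |A| |B|, fun x => (hh x).trans ?_⟩
  have h1 : A ≤ max |A| |B| := (le_abs_self A).trans (le_max_left _ _)
  have h2 : B ≤ max |A| |B| := (le_abs_self B).trans (le_max_right _ _)
  gcongr

theorem nonneg {C : ℝ} (hh : ∀ x, ‖h x‖ ≤ C * Real.exp (C * ‖x‖)) : 0 ≤ C := by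
  have := (norm_nonneg _).trans (hh 0)
  simpa using this

theorem mono {h' : E → ℂ} (hh : ExpGrowth h) (hle : ∀ x, ‖h' x‖ ≤ ‖h x‖) : ExpGrowth h' := by
  obtain ⟨C, hC⟩ := hh
  exact ⟨C, fun x => (hle x).trans (hC x)⟩

theorem const (c : ℂ) : ExpGrowth fun _ : E => c :=
  of_le ‖c‖ 0 fun x => by simp

theorem add (hh : ExpGrowth h) (hh' : ExpGrowth h') : ExpGrowth fun x => h x + h' x := by
  obtain ⟨C, hC⟩ := hh
  obtain ⟨C', hC'⟩ := hh'
  have h0 := nonneg hC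
  have h0' := nonneg hC'
  refine ⟨C + C', fun x => (norm_add_le _ _).trans ?_⟩
  rw [add_mul]
  refine add_le_add ((hC x).trans ?_) ((hC' x).trans ?_)
  · gcongr; linarith
  · gcongr; linarith

theorem mul (hh : ExpGrowth h) (hh' : ExpGrowth h') : ExpGrowth fun x => h x * h' x := by
  obtain ⟨C, hC⟩ := hh
  obtain ⟨C', hC'⟩ := hh'
  have h0 := nonneg hC
  refine of_le (C * C') (C + C') fun x => ?_
  rw [norm_mul]
  calc ‖h x‖ * ‖h' x‖ ≤ (C * Real.exp (C * ‖x‖)) * (C' * Real.exp (C' * ‖x‖)) := by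
        gcongr
        · exact hC x
        · exact hC' x
    _ = _ := by rw [add_mul, Real.exp_add]; ring

theorem sum {ι : Type*} (s : Finset ι) {h : ι → E → ℂ} (hh : ∀ i ∈ s, ExpGrowth (h i)) :
    ExpGrowth fun x => ∑ i ∈ s, h i x := by
  classical
  induction s using Finset.induction_on with
  | empty => simpa using const (E := E) 0
  | insert i s hi ih =>
    simp_rw [Finset.sum_insert hi]
    exact (hh i (Finset.mem_insert_self i s)).add
      (ih fun j hj => hh j (Finset.mem_insert_of_mem hj))

theorem comp_isometry (hh : ExpGrowth h) (g : E ≃ₗᵢ[ℝ] E) : ExpGrowth fun x => h (g x) := by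
  obtain ⟨C, hC⟩ := hh
  exact ⟨C, fun x => by simpa using hC (g x)⟩

theorem inner (ξ : E) : ExpGrowth fun x : E => (⟪ξ, x⟫_ℝ : ℂ) := by
  refine of_le ‖ξ‖ 1 fun x => ?_
  rw [Complex.norm_real, one_mul]
  refine (norm_inner_le_norm _ _).trans ?_
  gcongr
  linarith [Real.add_one_le_exp ‖x‖]

theorem of_fderiv {f : E → ℂ} (hf : Differentiable ℝ f) {C : ℝ}
    (h : ∀ x, ‖fderiv ℝ f x‖ ≤ C * Real.exp (C * ‖x‖)) : ExpGrowth f := by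
  have hC : 0 ≤ C := by
    have := (norm_nonneg _).trans (h 0)
    simpa using this
  refine of_le (‖f 0‖ + C) (C + 1) fun x => ?_
  have h1 : ‖f x - f 0‖ ≤ C * Real.exp (C * ‖x‖) * ‖x - 0‖ := by
    refine (convex_closedBall (0 : E) ‖x‖).norm_image_sub_le_of_norm_fderiv_le (𝕜 := ℝ)
      (fun y _ => hf y) (fun y hy => (h y).trans ?_) (by simp) (by simp)
    have : ‖y‖ ≤ ‖x‖ := by simpa using hy
    gcongr
  rw [sub_zero] at h1
  have h2 : ‖x‖ ≤ Real.exp ‖x‖ := by linarith [Real.add_one_le_exp ‖x‖]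
  have h3 : 1 ≤ Real.exp ((C + 1) * ‖x‖) := Real.one_le_exp (by positivity)
  have h4 : C * Real.exp (C * ‖x‖) * ‖x‖ ≤ C * Real.exp ((C + 1) * ‖x‖) := by
    rw [add_mul, Real.exp_add, one_mul, ← mul_assoc]
    gcongr
  calc ‖f x‖ = ‖f 0 + (f x - f 0)‖ := by congr 1; ring
    _ ≤ ‖f 0‖ + ‖f x - f 0‖ := norm_add_le _ _
    _ ≤ ‖f 0‖ * Real.exp ((C + 1) * ‖x‖) + C * Real.exp ((C + 1) * ‖x‖) := by
      refine add_le_add (le_mul_of_one_le_right (norm_nonneg _) h3) (h1.trans h4)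
    _ = _ := by ring

end ExpGrowth

namespace PolyGrowth

variable {h h' : E → ℂ}

theorem const (c : ℂ) : PolyGrowth fun _ : E => c := ⟨‖c‖, 0, fun x => by simp⟩

theorem of_bounded (B : ℝ) (hB : ∀ x, ‖h x‖ ≤ B) : PolyGrowth h :=
  ⟨B, 0, fun x => by simpa using hB x⟩

theorem mul (hh : PolyGrowth h) (hh' : PolyGrowth h') : PolyGrowth fun x => h x * h' x := by
  obtain ⟨C, N, hC⟩ := hh
  obtain ⟨C', N', hC'⟩ := hh'
  have h0 : 0 ≤ C := by simpa using (norm_nonneg _).trans (hC 0)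
  refine ⟨C * C', N + N', fun x => ?_⟩
  rw [norm_mul, pow_add]
  calc ‖h x‖ * ‖h' x‖ ≤ (C * (1 + ‖x‖) ^ N) * (C' * (1 + ‖x‖) ^ N') := by
        gcongr
        · exact hC x
        · exact hC' x
    _ = _ := by ring

theorem prod {ι : Type*} (s : Finset ι) {h : ι → E → ℂ} (hh : ∀ i ∈ s, PolyGrowth (h i)) :
    PolyGrowth fun x => ∏ i ∈ s, h i x := by
  classical
  induction s using Finset.induction_on with
  | empty => simpa using const (E := E) 1
  | insert i s hi ih =>
    simp_rw [Finset.prod_insert hi]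
    exact (hh i (Finset.mem_insert_self i s)).mul
      (ih fun j hj => hh j (Finset.mem_insert_of_mem hj))

theorem expGrowth (hh : PolyGrowth h) : ExpGrowth h := by
  obtain ⟨C, N, hC⟩ := hh
  have h0 : 0 ≤ C := by simpa using (norm_nonneg _).trans (hC 0)
  refine ExpGrowth.of_le C N fun x => (hC x).trans ?_
  rw [Real.exp_nat_mul]
  gcongr
  linarith [Real.add_one_le_exp ‖x‖]

theorem inner_cpow (α : E) {c : ℂ} (hc : 0 ≤ c.re) :
    PolyGrowth fun x : E => ((|⟪α, x⟫_ℝ| : ℝ) : ℂ) ^ c := by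
  refine ⟨(1 + ‖α‖) ^ ⌈c.re⌉₊, ⌈c.re⌉₊, fun x => ?_⟩
  have h1 : |⟪α, x⟫_ℝ| ≤ ‖α‖ * ‖x‖ := abs_real_inner_le_norm α x
  have h2 : ‖((|⟪α, x⟫_ℝ| : ℝ) : ℂ) ^ c‖ ≤ (1 + |⟪α, x⟫_ℝ|) ^ c.re := by
    rcases (abs_nonneg ⟪α, x⟫_ℝ).eq_or_lt with h | h
    · rw [← h]
      by_cases hc0 : c = 0
      · simp [hc0]
      · simp [Complex.zero_cpow hc0]
    · rw [Complex.norm_cpow_eq_rpow_re_of_pos h]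
      exact Real.rpow_le_rpow h.le (by linarith) hc
  refine h2.trans ?_
  rw [← mul_pow]
  calc (1 + |⟪α, x⟫_ℝ|) ^ c.re ≤ (1 + |⟪α, x⟫_ℝ|) ^ ((⌈c.re⌉₊ : ℕ) : ℝ) :=
        Real.rpow_le_rpow_of_exponent_le (by linarith [abs_nonneg ⟪α, x⟫_ℝ]) (Nat.le_ceil _)
    _ = (1 + |⟪α, x⟫_ℝ|) ^ ⌈c.re⌉₊ := Real.rpow_natCast _ _
    _ ≤ _ := by
      gcongr
      nlinarith [norm_nonneg α, norm_nonneg x]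

end PolyGrowth

variable {R P : Finset E} {k : E → ℂ}

theorem polyGrowth_weight (D : IsDatum R P k) : PolyGrowth (weight P k) :=
  PolyGrowth.prod P fun α hα => PolyGrowth.inner_cpow α (by simpa using D.re_nonneg' hα)

/-- The segment from x to r_α x stays in the ball of radius ‖x‖, and ‖x - r_α x‖ = |(α, x)| ‖α‖
cancels the denominator in the mean value estimate. -/
theorem expGrowth_divDiff {α : E} (hα : ⟪α, α⟫_ℝ = 2) {f : E → ℂ} (hf : Differentiable ℝ f) {C : ℝ}
    (h : ∀ x, ‖fderiv ℝ f x‖ ≤ C * Real.exp (C * ‖x‖)) : ExpGrowth (divDiff α f) := by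
  refine ExpGrowth.of_le (C * ‖α‖) C fun x => ?_
  unfold divDiff
  split_ifs with h0
  · refine ((fderiv ℝ f x).le_opNorm α).trans ?_
    rw [mul_right_comm]
    gcongr
    exact h x
  · have h1 : ‖f x - f (rootRefl α x)‖ ≤ C * Real.exp (C * ‖x‖) * ‖x - rootRefl α x‖ := by
      have hC : 0 ≤ C := by
        have := (norm_nonneg _).trans (h 0)
        simpa using this
      refine (convex_closedBall (0 : E) ‖x‖).norm_image_sub_le_of_norm_fderiv_le (𝕜 := ℝ)
        (fun y _ => hf y) (fun y hy => (h y).trans ?_) (by simp) (by simp)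
      have : ‖y‖ ≤ ‖x‖ := by simpa using hy
      gcongr
    rw [rootRefl_apply hα, sub_sub_cancel, norm_smul] at h1
    rw [norm_div, Complex.norm_real, div_le_iff₀ (norm_pos_iff.2 h0), rootRefl_apply hα]
    refine h1.trans_eq ?_
    ring

end Growth

/-! ### The Gaussian and a smooth regularization of the weight -/

section Gaussian

variable {E : Type*} [NormedAddCommGroup E] [InnerProductSpace ℝ E]

/-- The Gaussian `exp (-|x|² / 2)` as a complex function. -/
noncomputable def gauss (x : E) : ℂ := (Real.exp (-‖x‖ ^ 2 / 2) : ℂ)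

theorem gauss_eq_cexp (x : E) : gauss x = Complex.exp (-(‖x‖ ^ 2 : ℝ) / 2) := by
  rw [gauss, Complex.ofReal_exp]; push_cast; rfl

theorem gauss_map (g : E ≃ₗᵢ[ℝ] E) (x : E) : gauss (g x) = gauss x := by
  rw [gauss, gauss, g.norm_map]

theorem norm_gauss (x : E) : ‖gauss x‖ = Real.exp (-‖x‖ ^ 2 / 2) := by
  rw [gauss, Complex.norm_real, Real.norm_of_nonneg (Real.exp_pos _).le]

theorem continuous_gauss : Continuous (gauss : E → ℂ) := by
  unfold gauss; fun_prop

/-- A smooth regularization of the weight function. -/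
noncomputable def regWeight (P : Finset E) (k : E → ℂ) (δ : ℝ) (x : E) : ℂ :=
  Complex.exp (∑ α ∈ P, k α * (Real.log (⟪α, x⟫_ℝ ^ 2 + δ) : ℂ))

variable {R P : Finset E} {k : E → ℂ}

theorem regWeight_map (D : IsDatum R P k) (δ : ℝ) {g : E ≃ₗᵢ[ℝ] E} (hg : g ∈ reflectionGroup R)
    (x : E) : regWeight P k δ (g x) = regWeight P k δ x := by
  unfold regWeight
  congr 1
  have hg' := (reflectionGroup R).inv_mem hg
  rw [← sum_map_positive D.root D.pos
    (fun α => k α * (Real.log (⟪α, x⟫_ℝ ^ 2 + δ) : ℂ)) _ hg']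
  · refine Finset.sum_congr rfl fun α hα => ?_
    rw [D.mult _ hg' α (D.mem hα), ← g.inner_map_map (g⁻¹ α) x]
    congr
    exact (g.apply_symm_apply α).symm
  · intro α hα
    rw [D.mult_neg hα, inner_neg_left, neg_sq]

theorem continuous_regWeight {δ : ℝ} (hδ : 0 < δ) : Continuous (regWeight P k δ) := by
  unfold regWeight
  refine Complex.continuous_exp.comp (continuous_finsetSum _ fun α _ => continuous_const.mul
    (Complex.continuous_ofReal.comp (Continuous.log (by fun_prop) fun x => ?_)))
  positivity

/-- The bound is uniform in 0 < δ ≤ 1, as dominated convergence requires. It uses Re k ≥ 0: only an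
upper bound on the logarithm is then needed. -/
theorem norm_regWeight_le (D : IsDatum R P k) : ∃ C : ℝ, ∀ δ : ℝ, 0 < δ → δ ≤ 1 → ∀ x : E,
    ‖regWeight P k δ x‖ ≤ C * Real.exp (C * ‖x‖) := by
  have hb : ∀ δ : ℝ, 0 < δ → δ ≤ 1 → ∀ x : E,
    ‖regWeight P k δ x‖ ≤ 1 * Real.exp ((∑ α ∈ P, (k α).re * (2 * ‖α‖)) * ‖x‖) := by
    intro δ hδ hδ1 x
    rw [regWeight, Complex.norm_exp, one_mul]
    gcongr
    rw [Complex.re_sum, Finset.sum_mul]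
    refine Finset.sum_le_sum fun α hα => ?_
    rw [Complex.re_mul_ofReal, mul_assoc]
    refine mul_le_mul_of_nonneg_left ?_ (D.re_nonneg' hα)
    have h1 : |⟪α, x⟫_ℝ| ≤ ‖α‖ * ‖x‖ := abs_real_inner_le_norm α x
    rw [Real.log_le_iff_le_exp (by positivity)]
    calc ⟪α, x⟫_ℝ ^ 2 + δ ≤ (|⟪α, x⟫_ℝ| + 1) ^ 2 := by
          rw [← sq_abs ⟪α, x⟫_ℝ]; nlinarith [abs_nonneg ⟪α, x⟫_ℝ]
      _ ≤ (Real.exp (‖α‖ * ‖x‖)) ^ 2 := by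
          gcongr
          linarith [Real.add_one_le_exp (‖α‖ * ‖x‖)]
      _ = _ := by rw [← Real.exp_nat_mul]; congr 1; push_cast; ring
  set B := ∑ α ∈ P, (k α).re * (2 * ‖α‖)
  refine ⟨max 1 B, fun δ hδ hδ1 x => (hb δ hδ hδ1 x).trans ?_⟩
  have h1 := le_max_left 1 B
  have h2 := le_max_right 1 B
  gcongr

/-- Convergence is claimed only off the hyperplanes: on them it can fail, for instance when some k_α
is purely imaginary and nonzero. They form a null set. -/
theorem regWeight_tendsto {x : E} (hx : ∀ α ∈ P, ⟪α, x⟫_ℝ ≠ 0) :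
    Filter.Tendsto (fun n : ℕ => regWeight P k (1 / ((n : ℝ) + 1)) x) Filter.atTop
      (nhds (weight P k x)) := by
  have h1 : weight P k x = Complex.exp (∑ α ∈ P, k α * (Real.log (⟪α, x⟫_ℝ ^ 2 + 0) : ℂ)) := by
    rw [Complex.exp_sum]
    refine Finset.prod_congr rfl fun α hα => ?_
    have h2 : ((|⟪α, x⟫_ℝ| : ℝ) : ℂ) ≠ 0 := Complex.ofReal_ne_zero.2 (abs_ne_zero.2 (hx α hα))
    rw [Complex.cpow_def_of_ne_zero h2, ← Complex.ofReal_log (abs_nonneg _), add_zero,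
      ← sq_abs, Real.log_pow]
    congr 1
    push_cast; ring
  rw [h1]
  refine (Complex.continuous_exp.tendsto _).comp (tendsto_finsetSum _ fun α hα =>
    Filter.Tendsto.const_mul _ ((Complex.continuous_ofReal.tendsto _).comp
      (Filter.Tendsto.log ?_ ?_)))
  · exact tendsto_one_div_add_atTop_nhds_zero_nat.const_add _
  · rw [add_zero]; exact pow_ne_zero 2 (hx α hα)

theorem hasFDerivAt_gauss_mul_regWeight {δ : ℝ} (hδ : 0 < δ) (x : E) :
    ∃ L : E →L[ℝ] ℂ, HasFDerivAt (fun y => gauss y * regWeight P k δ y) L x ∧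
      ∀ ξ, L ξ = gauss x * regWeight P k δ x *
        (-(⟪ξ, x⟫_ℝ : ℂ) + ∑ α ∈ P, k α * (⟪α, ξ⟫_ℝ : ℂ) *
          (2 * ((⟪α, x⟫_ℝ / (⟪α, x⟫_ℝ ^ 2 + δ) : ℝ) : ℂ))) := by
  have h1 : HasFDerivAt (fun y : E => -((‖y‖ ^ 2 : ℝ) : ℂ) / 2)
      ((2⁻¹ : ℂ) • (-(Complex.ofRealCLM ∘L (2 • innerSL ℝ x)))) x := by
    have := ((Complex.ofRealCLM.hasFDerivAt.comp x
      (hasStrictFDerivAt_norm_sq x).hasFDerivAt).fun_neg.const_mul (2⁻¹ : ℂ))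
    refine this.congr_of_eventuallyEq (Filter.Eventually.of_forall fun y => ?_)
    simp [div_eq_inv_mul]
  have h2 : ∀ α ∈ P, HasFDerivAt (fun y : E => k α * (Real.log (⟪α, y⟫_ℝ ^ 2 + δ) : ℂ))
      (k α • (Complex.ofRealCLM ∘L ((⟪α, x⟫_ℝ ^ 2 + δ)⁻¹ • ((2 * ⟪α, x⟫_ℝ) • innerSL ℝ α)))) x := by
    intro α _
    have h3 : HasFDerivAt (fun y : E => ⟪α, y⟫_ℝ) (innerSL ℝ α) x := (innerSL ℝ α).hasFDerivAt
    have h4 := ((h3.pow 2).add_const δ).log (by positivity)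
    have h5 := (Complex.ofRealCLM.hasFDerivAt.comp x h4).const_mul (k α)
    simpa using h5
  have h3 := (h1.add (HasFDerivAt.fun_sum h2)).cexp
  refine ⟨_, h3.congr_of_eventuallyEq (Filter.Eventually.of_forall fun y => ?_), fun ξ => ?_⟩
  · simp only [Pi.add_apply]
    rw [gauss_eq_cexp, regWeight, ← Complex.exp_add]
  · simp only [Pi.add_apply]
    rw [gauss_eq_cexp, regWeight, ← Complex.exp_add, smul_apply, smul_eq_mul]
    congr 1
    simp [sum_apply, real_inner_comm x ξ]
    refine Finset.sum_congr rfl fun α _ => ?_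
    ring

end Gaussian


/-! ### Integration by parts for Dunkl operators -/

section SkewAdjoint

variable {E : Type*} [NormedAddCommGroup E] [InnerProductSpace ℝ E] [FiniteDimensional ℝ E]
  [MeasurableSpace E] [BorelSpace E] {R P : Finset E} {k : E → ℂ}

theorem integrable_exp_mul_gaussian (C : ℝ) :
    Integrable fun x : E => Real.exp (C * ‖x‖) * Real.exp (-‖x‖ ^ 2 / 2) := by
  -- Completing the square: C t - t²/2 ≤ C² - t²/4.
  have h1 : Integrable fun x : E => Real.exp (C ^ 2) * Real.exp (-(1 / 4) * ‖x‖ ^ 2) := by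
    have h2 := (GaussianFourier.integrable_cexp_neg_mul_sq_norm_add (V := E) (b := (1 / 4 : ℝ))
      (by simp) 0 0).norm
    refine Integrable.const_mul (h2.congr (Filter.Eventually.of_forall fun x => ?_)) _
    simp only [Complex.norm_exp]
    congr 1
    simp [← Complex.ofReal_pow]
  refine h1.mono' (by fun_prop) (Filter.Eventually.of_forall fun x => ?_)
  rw [← Real.exp_add, ← Real.exp_add, Real.norm_of_nonneg (Real.exp_pos _).le]
  refine Real.exp_le_exp.2 ?_
  nlinarith [sq_nonneg (C - ‖x‖ / 2)]

theorem ExpGrowth.integrable {h : E → ℂ} (hh : ExpGrowth h) (hm : AEStronglyMeasurable h) :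
    Integrable fun x => h x * gauss x := by
  obtain ⟨C, hC⟩ := hh
  refine ((integrable_exp_mul_gaussian (E := E) C).const_mul C).mono'
    (hm.mul continuous_gauss.aestronglyMeasurable) (Filter.Eventually.of_forall fun x => ?_)
  rw [norm_mul, norm_gauss, ← mul_assoc]
  gcongr
  exact hC x

theorem ae_inner_ne_zero (D : IsDatum R P k) : ∀ᵐ x : E, ∀ α ∈ P, ⟪α, x⟫_ℝ ≠ 0 := by
  rw [Filter.eventually_all_finset]
  intro α hα
  have h1 : (LinearMap.ker (innerₗ E α)) ≠ ⊤ := by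
    intro h
    have h2 : α ∈ LinearMap.ker (innerₗ E α) := by rw [h]; trivial
    have h3 : ⟪α, α⟫_ℝ = 0 := h2
    rw [D.inner_self hα] at h3
    norm_num at h3
  have h2 := Measure.addHaar_submodule volume _ h1
  filter_upwards [measure_eq_zero_iff_ae_notMem.1 h2] with x hx h
  exact hx h

theorem measurable_weight : Measurable (weight P k) := by
  unfold weight
  refine Finset.measurable_fun_prod _ fun α _ => ?_
  fun_prop

theorem measurable_divDiff (α : E) {f : E → ℂ} (hf : ContDiff ℝ 1 f) : Measurable (divDiff α f) := by
  unfold divDiff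
  refine Measurable.ite ?_ ?_ ?_
  · exact (isClosed_eq (by fun_prop) continuous_const).measurableSet
  · exact ((hf.continuous_fderiv one_ne_zero).clm_apply continuous_const).measurable
  · refine Measurable.div ?_ (by fun_prop)
    exact (hf.continuous.sub (hf.continuous.comp (rootRefl α).continuous)).measurable

theorem integral_map_isometry (g : E ≃ₗᵢ[ℝ] E) (h : E → ℂ) : ∫ x, h (g x) = ∫ x, h x :=
  (g.measurePreserving).integral_comp g.toHomeomorph.measurableEmbedding h

/-- Integration by parts for Dunkl operators against a regularized weight. -/
theorem integral_dunklOp_regWeight (D : IsDatum R P k) (ξ : E) {f : E → ℂ} (hf : ContDiff ℝ 1 f)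
    {C : ℝ} (hC : ∀ x, ‖fderiv ℝ f x‖ ≤ C * Real.exp (C * ‖x‖)) {δ : ℝ} (hδ : 0 < δ) (hδ1 : δ ≤ 1) :
    ∫ x, (fderiv ℝ f x ξ + ∑ α ∈ P, k α * (⟪α, ξ⟫_ℝ : ℂ) * divDiff α f x *
      ((⟪α, x⟫_ℝ ^ 2 / (⟪α, x⟫_ℝ ^ 2 + δ) : ℝ) : ℂ)) * regWeight P k δ x * gauss x =
    ∫ x, f x * (⟪ξ, x⟫_ℝ : ℂ) * regWeight P k δ x * gauss x := by
  have hfd : Differentiable ℝ f := hf.differentiable one_ne_zero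
  have hW : ExpGrowth (regWeight P k δ) := by
    obtain ⟨C, hC⟩ := norm_regWeight_le D
    exact ⟨C, hC δ hδ hδ1⟩
  have hWc : Continuous (regWeight P k δ) := continuous_regWeight hδ
  have hfg : ExpGrowth f := ExpGrowth.of_fderiv hfd hC
  have hf'c : Continuous fun x => fderiv ℝ f x ξ :=
    (hf.continuous_fderiv one_ne_zero).clm_apply continuous_const
  have hf'g : ExpGrowth fun x => fderiv ℝ f x ξ := ExpGrowth.of_le (C * ‖ξ‖) C fun x => by
    refine ((fderiv ℝ f x).le_opNorm ξ).trans ?_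
    rw [mul_right_comm]
    gcongr
    exact hC x
  -- Up to the factors 2 k_α (α, ξ), the contribution of α to the logarithmic derivative of the
  -- regularized weight; a bounded substitute for 1/(α, x).
  let s : E → E → ℂ := fun α x => ((⟪α, x⟫_ℝ / (⟪α, x⟫_ℝ ^ 2 + δ) : ℝ) : ℂ)
  have hsc : ∀ α, Continuous (s α) := fun α =>
    Complex.continuous_ofReal.comp (Continuous.div (by fun_prop) (by fun_prop)
      fun x => by positivity)
  have hsg : ∀ α, ExpGrowth (s α) := fun α => by
    refine ((ExpGrowth.const ((δ⁻¹ : ℝ) : ℂ)).mul (ExpGrowth.inner α)).mono fun x => ?_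
    rw [norm_mul, Complex.norm_real, Complex.norm_real, Complex.norm_real, norm_div,
      Real.norm_of_nonneg (by positivity : 0 ≤ δ⁻¹),
      Real.norm_of_nonneg (by positivity : 0 ≤ ⟪α, x⟫_ℝ ^ 2 + δ), div_eq_inv_mul]
    gcongr
    nlinarith [sq_nonneg ⟪α, x⟫_ℝ]
  have hsum : ∀ x, fderiv ℝ (fun y => gauss y * regWeight P k δ y) x ξ = gauss x * regWeight P k δ x *
      (-(⟪ξ, x⟫_ℝ : ℂ) + ∑ α ∈ P, k α * (⟪α, ξ⟫_ℝ : ℂ) * (2 * s α x)) := by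
    intro x
    obtain ⟨L, hL, hL'⟩ := hasFDerivAt_gauss_mul_regWeight (P := P) (k := k) hδ x
    rw [hL.fderiv, hL']
  have hinc : Continuous fun x : E => (⟪ξ, x⟫_ℝ : ℂ) := by fun_prop
  have hI1 : Integrable fun x => fderiv ℝ f x ξ * regWeight P k δ x * gauss x :=
    (hf'g.mul hW).integrable (hf'c.mul hWc).aestronglyMeasurable
  have hI2 : Integrable fun x => f x * (⟪ξ, x⟫_ℝ : ℂ) * regWeight P k δ x * gauss x :=
    ((hfg.mul (ExpGrowth.inner ξ)).mul hW).integrable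
      ((hf.continuous.mul hinc).mul hWc).aestronglyMeasurable
  have hI3 : ∀ α, Integrable fun x => f x * s α x * regWeight P k δ x * gauss x := fun α =>
    ((hfg.mul (hsg α)).mul hW).integrable
      ((hf.continuous.mul (hsc α)).mul hWc).aestronglyMeasurable
  have hI4 : Integrable fun x => f x * regWeight P k δ x * gauss x :=
    (hfg.mul hW).integrable (hf.continuous.mul hWc).aestronglyMeasurable
  have hsplit : ∀ x, f x * fderiv ℝ (fun y => gauss y * regWeight P k δ y) x ξ =
      -(f x * (⟪ξ, x⟫_ℝ : ℂ) * regWeight P k δ x * gauss x) +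
      ∑ α ∈ P, k α * (⟪α, ξ⟫_ℝ : ℂ) * (2 * (f x * s α x * regWeight P k δ x * gauss x)) := by
    intro x
    rw [hsum, mul_add, mul_add, Finset.mul_sum, Finset.mul_sum]
    congr 1
    · ring
    · exact Finset.sum_congr rfl fun α _ => by ring
  have hI5 : Integrable fun x => ∑ α ∈ P, k α * (⟪α, ξ⟫_ℝ : ℂ) *
      (2 * (f x * s α x * regWeight P k δ x * gauss x)) :=
    integrable_finsetSum _ fun α _ => ((hI3 α).const_mul _).const_mul _
  have hparts : ∫ x, f x * fderiv ℝ (fun y => gauss y * regWeight P k δ y) x ξ =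
      -∫ x, fderiv ℝ f x ξ * (gauss x * regWeight P k δ x) := by
    refine integral_mul_fderiv_eq_neg_fderiv_mul_of_integrable ?_ ?_ ?_ (fun x _ => hfd x)
      (fun x _ => ?_)
    · exact hI1.congr (Filter.Eventually.of_forall fun x => by ring)
    · simp_rw [hsplit]
      exact hI2.neg.add hI5
    · exact hI4.congr (Filter.Eventually.of_forall fun x => by ring)
    · obtain ⟨L, hL, _⟩ := hasFDerivAt_gauss_mul_regWeight (P := P) (k := k) hδ x
      exact hL.differentiableAt
  -- Here s_α is odd under r_α while the regularized weight and the Gaussian are even. Averaging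
  -- with the reflected integral replaces 2f by f - f ∘ r_α = (α, x) `divDiff` α f, which produces
  -- the difference part of the Dunkl operator.
  have hodd : ∀ α ∈ P, 2 * ∫ x, f x * s α x * regWeight P k δ x * gauss x =
      ∫ x, divDiff α f x * ((⟪α, x⟫_ℝ ^ 2 / (⟪α, x⟫_ℝ ^ 2 + δ) : ℝ) : ℂ) *
        regWeight P k δ x * gauss x := by
    intro α hα
    have h1 : ∫ x, f x * s α x * regWeight P k δ x * gauss x =
        ∫ x, -(f (rootRefl α x) * s α x * regWeight P k δ x * gauss x) := by
      rw [← integral_map_isometry (rootRefl α)]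
      refine integral_congr_ae (Filter.Eventually.of_forall fun x => ?_)
      simp only [s]
      rw [regWeight_map D δ (D.refl_mem hα), gauss_map, inner_self_rootRefl, neg_sq, neg_div]
      push_cast; ring
    have h2 : Integrable fun x => -(f (rootRefl α x) * s α x * regWeight P k δ x * gauss x) :=
      ((((hfg.comp_isometry (rootRefl α)).mul (hsg α)).mul hW).integrable
        (((hf.continuous.comp (rootRefl α).continuous).mul (hsc α)).mul
          hWc).aestronglyMeasurable).neg
    rw [two_mul]
    conv_lhs => rw [h1]; enter [1]; rw [← h1]
    rw [← integral_add (hI3 α) h2]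
    refine integral_congr_ae (Filter.Eventually.of_forall fun x => ?_)
    have h3 : ((⟪α, x⟫_ℝ ^ 2 / (⟪α, x⟫_ℝ ^ 2 + δ) : ℝ) : ℂ) = (⟪α, x⟫_ℝ : ℂ) * s α x := by
      simp only [s]; push_cast; ring
    simp only []
    rw [h3, mul_left_comm (divDiff α f x), ← mul_assoc (⟪α, x⟫_ℝ : ℂ), inner_mul_divDiff]
    ring
  have hI6 : ∀ α ∈ P, Integrable fun x => divDiff α f x *
      ((⟪α, x⟫_ℝ ^ 2 / (⟪α, x⟫_ℝ ^ 2 + δ) : ℝ) : ℂ) * regWeight P k δ x * gauss x := by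
    intro α hα
    have h3 : ∀ x, ((⟪α, x⟫_ℝ ^ 2 / (⟪α, x⟫_ℝ ^ 2 + δ) : ℝ) : ℂ) = (⟪α, x⟫_ℝ : ℂ) * s α x := by
      intro x; simp only [s]; push_cast; ring
    simp_rw [h3]
    refine (((expGrowth_divDiff (D.inner_self hα) hfd hC).mul
      ((ExpGrowth.inner α).mul (hsg α))).mul hW).integrable ?_
    refine Measurable.aestronglyMeasurable ?_
    refine ((measurable_divDiff α hf).mul (Continuous.measurable ?_)).mul hWc.measurable
    exact (show Continuous fun x : E => (⟪α, x⟫_ℝ : ℂ) by fun_prop).mul (hsc α)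
  have hI7 : Integrable fun x => ∑ α ∈ P, k α * (⟪α, ξ⟫_ℝ : ℂ) * (divDiff α f x *
      ((⟪α, x⟫_ℝ ^ 2 / (⟪α, x⟫_ℝ ^ 2 + δ) : ℝ) : ℂ) * regWeight P k δ x * gauss x) :=
    integrable_finsetSum _ fun α hα => (hI6 α hα).const_mul _
  have hfin : ∀ x, (fderiv ℝ f x ξ + ∑ α ∈ P, k α * (⟪α, ξ⟫_ℝ : ℂ) * divDiff α f x *
      ((⟪α, x⟫_ℝ ^ 2 / (⟪α, x⟫_ℝ ^ 2 + δ) : ℝ) : ℂ)) * regWeight P k δ x * gauss x =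
      fderiv ℝ f x ξ * regWeight P k δ x * gauss x + ∑ α ∈ P, k α * (⟪α, ξ⟫_ℝ : ℂ) * (divDiff α f x *
      ((⟪α, x⟫_ℝ ^ 2 / (⟪α, x⟫_ℝ ^ 2 + δ) : ℝ) : ℂ) * regWeight P k δ x * gauss x) := by
    intro x
    rw [add_mul, add_mul, Finset.sum_mul, Finset.sum_mul]
    congr 1
    exact Finset.sum_congr rfl fun α _ => by ring
  simp_rw [hfin]
  rw [integral_add hI1 hI7, integral_finsetSum _ fun α hα => (hI6 α hα).const_mul _]
  simp_rw [hsplit] at hparts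
  have hI2n : Integrable fun x => -(f x * (⟪ξ, x⟫_ℝ : ℂ) * regWeight P k δ x * gauss x) := hI2.neg
  rw [integral_add hI2n hI5, integral_finsetSum _ fun α _ => ((hI3 α).const_mul _).const_mul _,
    integral_neg] at hparts
  simp_rw [integral_const_mul] at hparts ⊢
  rw [Finset.sum_congr rfl fun α hα => by rw [hodd α hα]] at hparts
  have h8 : ∫ x, fderiv ℝ f x ξ * (gauss x * regWeight P k δ x) =
      ∫ x, fderiv ℝ f x ξ * regWeight P k δ x * gauss x := by
    refine integral_congr_ae (Filter.Eventually.of_forall fun x => ?_)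
    simp only []; ring
  rw [h8] at hparts
  linear_combination hparts

/-- Dunkl operators are skew-adjoint for the weight, in the form of integration by parts against a
Gaussian. -/
theorem integral_dunklOp_mul_gauss (D : IsDatum R P k) (ξ : E) {f : E → ℂ} (hf : ContDiff ℝ 1 f)
    {C : ℝ} (hC : ∀ x, ‖fderiv ℝ f x‖ ≤ C * Real.exp (C * ‖x‖)) :
    ∫ x, dunklOp P k ξ f x * weight P k x * gauss x =
    ∫ x, f x * (⟪ξ, x⟫_ℝ : ℂ) * weight P k x * gauss x := by
  have hfd : Differentiable ℝ f := hf.differentiable one_ne_zero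
  have hfg : ExpGrowth f := ExpGrowth.of_fderiv hfd hC
  have hf'c : Continuous fun x => fderiv ℝ f x ξ :=
    (hf.continuous_fderiv one_ne_zero).clm_apply continuous_const
  have hf'g : ExpGrowth fun x => fderiv ℝ f x ξ := ExpGrowth.of_le (C * ‖ξ‖) C fun x => by
    refine ((fderiv ℝ f x).le_opNorm ξ).trans ?_
    rw [mul_right_comm]
    gcongr
    exact hC x
  obtain ⟨W, hW⟩ := norm_regWeight_le D
  have hδ : ∀ n : ℕ, (0 : ℝ) < 1 / ((n : ℝ) + 1) := fun n => by positivity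
  have hδ1 : ∀ n : ℕ, 1 / ((n : ℝ) + 1) ≤ 1 := fun n => by
    rw [div_le_one (by positivity)]; linarith [(Nat.cast_nonneg n : (0 : ℝ) ≤ n)]
  have hδ0 := tendsto_one_div_add_atTop_nhds_zero_nat (𝕜 := ℝ)
  -- dominated convergence for integrals against the regularized weight
  have hlim : ∀ (F : ℕ → E → ℂ) (G : E → ℂ), (∀ n, Measurable (F n)) →
      (∃ A, ∀ n x, ‖F n x‖ ≤ A * Real.exp (A * ‖x‖)) →
      (∀ᵐ x, Filter.Tendsto (fun n => F n x) Filter.atTop (nhds (G x))) →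
      Filter.Tendsto (fun n : ℕ => ∫ x, F n x * regWeight P k (1 / ((n : ℝ) + 1)) x * gauss x)
        Filter.atTop (nhds (∫ x, G x * weight P k x * gauss x)) := by
    intro F G hF ⟨A, hA⟩ hFG
    have hA0 : 0 ≤ A := ExpGrowth.nonneg (hA 0)
    refine tendsto_integral_of_dominated_convergence
      (fun x => (A * W) * (Real.exp ((A + W) * ‖x‖) * Real.exp (-‖x‖ ^ 2 / 2))) (fun n => ?_) ?_
      (fun n => Filter.Eventually.of_forall fun x => ?_) ?_
    · exact ((hF n).mul (continuous_regWeight (hδ n)).measurable).aestronglyMeasurable.mul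
        continuous_gauss.aestronglyMeasurable
    · exact (integrable_exp_mul_gaussian _).const_mul _
    · rw [norm_mul, norm_mul, norm_gauss, add_mul, Real.exp_add]
      calc _ ≤ (A * Real.exp (A * ‖x‖)) * (W * Real.exp (W * ‖x‖)) * Real.exp (-‖x‖ ^ 2 / 2) := by
            gcongr
            · exact hA n x
            · exact hW _ (hδ n) (hδ1 n) x
        _ = _ := by ring
    · filter_upwards [hFG, ae_inner_ne_zero D] with x hx hx'
      exact (hx.mul (regWeight_tendsto hx')).mul_const _
  have hle : ∀ (α : E) (n : ℕ) (x : E),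
      ‖((⟪α, x⟫_ℝ ^ 2 / (⟪α, x⟫_ℝ ^ 2 + 1 / ((n : ℝ) + 1)) : ℝ) : ℂ)‖ ≤ 1 := by
    intro α n x
    have h2 := hδ n
    rw [Complex.norm_real, Real.norm_of_nonneg (by positivity), div_le_one (by positivity)]
    linarith
  have h1 := hlim (fun n x => fderiv ℝ f x ξ + ∑ α ∈ P, k α * (⟪α, ξ⟫_ℝ : ℂ) * divDiff α f x *
      ((⟪α, x⟫_ℝ ^ 2 / (⟪α, x⟫_ℝ ^ 2 + 1 / ((n : ℝ) + 1)) : ℝ) : ℂ)) (dunklOp P k ξ f) ?_ ?_ ?_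
  · have h2 := hlim (fun n x => f x * (⟪ξ, x⟫_ℝ : ℂ)) (fun x => f x * (⟪ξ, x⟫_ℝ : ℂ)) ?_ ?_ ?_
    · simp_rw [integral_dunklOp_regWeight D ξ hf hC (hδ _) (hδ1 _)] at h1
      exact tendsto_nhds_unique h1 h2
    · exact fun n => (hf.continuous.mul (by fun_prop)).measurable
    · obtain ⟨A, hA⟩ := hfg.mul (ExpGrowth.inner ξ)
      exact ⟨A, fun _ => hA⟩
    · exact Filter.Eventually.of_forall fun x => tendsto_const_nhds
  · intro n
    refine hf'c.measurable.add (Finset.measurable_fun_sum _ fun α _ => ?_)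
    exact ((measurable_divDiff α hf).const_mul _).mul (by fun_prop)
  -- Summing the norms of the separate terms gives a majorant independent of n, because the damping
  -- factors are at most 1.
  · have h2 : ExpGrowth fun x => (‖fderiv ℝ f x ξ‖ : ℂ) +
        ∑ α ∈ P, (‖k α * (⟪α, ξ⟫_ℝ : ℂ) * divDiff α f x‖ : ℂ) := by
      refine (hf'g.mono fun x => by simp).add (ExpGrowth.sum P fun α hα => ?_)
      exact ((ExpGrowth.const (k α * (⟪α, ξ⟫_ℝ : ℂ))).mul
        (expGrowth_divDiff (D.inner_self hα) hfd hC)).mono fun x => by simp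
    obtain ⟨A, hA⟩ := h2
    refine ⟨A, fun n x => le_trans ?_ (hA x)⟩
    have h3 : ‖(‖fderiv ℝ f x ξ‖ : ℂ) + ∑ α ∈ P, (‖k α * (⟪α, ξ⟫_ℝ : ℂ) * divDiff α f x‖ : ℂ)‖ =
        ‖fderiv ℝ f x ξ‖ + ∑ α ∈ P, ‖k α * (⟪α, ξ⟫_ℝ : ℂ) * divDiff α f x‖ := by
      rw [← Complex.ofReal_sum, ← Complex.ofReal_add, Complex.norm_real,
        Real.norm_of_nonneg (by positivity)]
    rw [h3]
    refine (norm_add_le _ _).trans (add_le_add le_rfl ((norm_sum_le _ _).trans ?_))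
    refine Finset.sum_le_sum fun α _ => ?_
    rw [norm_mul]
    exact mul_le_of_le_one_right (norm_nonneg _) (hle α n x)
  · filter_upwards [ae_inner_ne_zero D] with x hx
    refine (tendsto_finsetSum _ fun α hα => ?_).const_add _
    have h4 : Filter.Tendsto (fun n : ℕ =>
        ((⟪α, x⟫_ℝ ^ 2 / (⟪α, x⟫_ℝ ^ 2 + 1 / ((n : ℝ) + 1)) : ℝ) : ℂ)) Filter.atTop (nhds 1) := by
      have h5 : (1 : ℂ) = ((⟪α, x⟫_ℝ ^ 2 / (⟪α, x⟫_ℝ ^ 2 + 0) : ℝ) : ℂ) := by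
        rw [add_zero, div_self (pow_ne_zero 2 (hx α hα))]; simp
      rw [h5]
      refine (Complex.continuous_ofReal.tendsto _).comp ?_
      exact tendsto_const_nhds.div (hδ0.const_add _) (by simpa using hx α hα)
    simpa using h4.const_mul (k α * (⟪α, ξ⟫_ℝ : ℂ) * divDiff α f x)

end SkewAdjoint


/-! ### Nonvanishing of the Mehta integral and the transform of the Gaussian -/

section Mehta

variable {E : Type*} [NormedAddCommGroup E] [InnerProductSpace ℝ E] [FiniteDimensional ℝ E]
  [MeasurableSpace E] [BorelSpace E] {R P : Finset E} {k : E → ℂ}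

theorem PolyLE.exists_norm_fderiv_le {n : ℕ} {f : E → ℂ} (hf : PolyLE n f) :
    ∃ C : ℝ, ∀ x, ‖fderiv ℝ f x‖ ≤ C * Real.exp (C * ‖x‖) := by
  have key : ExpGrowth fun x => (‖fderiv ℝ f x‖ : ℂ) := by
    induction hf with
    | const n c => simpa using ExpGrowth.const (E := E) 0
    | @add n f g hf hg ihf ihg =>
      refine (ihf.add ihg).mono fun x => ?_
      rw [fderiv_fun_add (hf.differentiable x) (hg.differentiable x), ← Complex.ofReal_add,
        Complex.norm_real, Complex.norm_real, norm_norm, Real.norm_of_nonneg (by positivity)]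
      exact norm_add_le _ _
    | @linear_mul n f l hf ih =>
      let L := LinearMap.toContinuousLinearMap l
      have hL : ExpGrowth fun x => (‖L x‖ : ℂ) := by
        refine ExpGrowth.of_le ‖L‖ 1 fun x => ?_
        rw [Complex.norm_real, norm_norm, one_mul]
        refine (L.le_opNorm x).trans ?_
        gcongr
        linarith [Real.add_one_le_exp ‖x‖]
      obtain ⟨C, hC⟩ := ih
      have hfg : ExpGrowth f := ExpGrowth.of_fderiv hf.differentiable (C := C) fun x => by
        simpa using hC x
      have hfg' : ExpGrowth fun x => (‖f x‖ : ℂ) := hfg.mono fun x => by simp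
      refine ((hL.mul ⟨C, hC⟩).add ((ExpGrowth.const (‖L‖ : ℂ)).mul hfg')).mono fun x => ?_
      have h1 : fderiv ℝ (fun y => l y * f y) x = L x • fderiv ℝ f x + f x • L := by
        ext ξ
        rw [fderiv_linear_mul l hf.differentiable]
        simp [L, mul_comm]
      rw [h1, ← Complex.ofReal_mul, ← Complex.ofReal_mul, ← Complex.ofReal_add, Complex.norm_real,
        Complex.norm_real, norm_norm, Real.norm_of_nonneg (by positivity)]
      refine (norm_add_le _ _).trans ?_
      rw [norm_smul, norm_smul, mul_comm ‖f x‖]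
  obtain ⟨C, hC⟩ := key
  exact ⟨C, fun x => by simpa using hC x⟩

theorem ExpGrowth.integrable_weight (D : IsDatum R P k) {h : E → ℂ} (hh : ExpGrowth h)
    (hm : Measurable h) : Integrable fun x => h x * weight P k x * gauss x :=
  (hh.mul (polyGrowth_weight D).expGrowth).integrable (hm.mul measurable_weight).aestronglyMeasurable

theorem mehta_eq : mehta P k = ∫ x : E, weight P k x * gauss x := by
  unfold mehta gauss
  exact integral_congr_ae (Filter.Eventually.of_forall fun x => mul_comm _ _)

/-- Integration by parts trades a factor (b_i, x) for the operator T_{b_i}, which lowers the degree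
bound of the integrand. All moments thus reduce to the constant one, a multiple of c_k. -/
theorem integral_poly_eq_zero (D : IsDatum R P k) (h0 : mehta P k = 0) {n : ℕ} {f : E → ℂ}
    (hf : PolyLE n f) : ∫ x, f x * weight P k x * gauss x = 0 := by
  have hP : ∀ α ∈ P, ⟪α, α⟫_ℝ = 2 := fun α hα => D.inner_self hα
  have hint : ∀ {m : ℕ} {f : E → ℂ}, PolyLE m f → Integrable fun x => f x * weight P k x * gauss x := by
    intro m f hf
    obtain ⟨C, hC⟩ := hf.exists_norm_fderiv_le
    exact (ExpGrowth.of_fderiv hf.differentiable hC).integrable_weight D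
      hf.differentiable.continuous.measurable
  -- An outer induction on the degree is needed because T_{b_i} f is not a subterm in the structural
  -- induction.
  induction n using Nat.strong_induction_on generalizing f with
  | _ n ihn =>
  induction hf with
  | const n c =>
    simp_rw [mul_assoc]
    rw [integral_const_mul, ← mehta_eq, h0, mul_zero]
  | add hf hg ihf ihg =>
    simp_rw [add_mul]
    rw [integral_add (hint hf) (hint hg), ihf ihn, ihg ihn, add_zero]
  | @linear_mul n f l hf ih =>
    let b := stdOrthonormalBasis ℝ E
    have h1 : ∀ x, l x * f x * weight P k x * gauss x =
        ∑ i, l (b i) * (f x * (⟪b i, x⟫_ℝ : ℂ) * weight P k x * gauss x) := by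
      intro x
      conv_lhs => rw [← b.sum_repr' x, map_sum]
      simp_rw [map_smul, Complex.real_smul, Finset.sum_mul]
      rw [b.sum_repr' x]
      exact Finset.sum_congr rfl fun i _ => by ring
    simp_rw [h1]
    obtain ⟨C, hC⟩ := hf.exists_norm_fderiv_le
    have hfg := ExpGrowth.of_fderiv hf.differentiable hC
    rw [integral_finsetSum]
    · refine Finset.sum_eq_zero fun i _ => ?_
      rw [integral_const_mul, ← integral_dunklOp_mul_gauss D (b i) (hf.contDiff.of_le (by simp)) hC,
        ihn n (Nat.lt_succ_self n) (hf.dunklOp hP (b i)), mul_zero]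
    · intro i _
      exact ((hfg.mul (ExpGrowth.inner (b i))).integrable_weight D
        (hf.differentiable.continuous.measurable.mul (by fun_prop))).const_mul _

theorem weight_ne_zero {v : E} (hv : ∀ α ∈ P, ⟪α, v⟫_ℝ ≠ 0) : weight P k v ≠ 0 := by
  refine Finset.prod_ne_zero_iff.2 fun α hα h => ?_
  rw [Complex.cpow_eq_zero_iff] at h
  exact hv α hα (by simpa using h.1)

theorem continuousAt_weight {v : E} (hv : ∀ α ∈ P, ⟪α, v⟫_ℝ ≠ 0) :
    ContinuousAt (weight P k) v := by
  unfold weight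
  refine tendsto_finsetProd _ fun α hα => ?_
  refine ContinuousAt.cpow (f := fun x : E => ((|⟪α, x⟫_ℝ| : ℝ) : ℂ)) (by fun_prop)
    continuousAt_const ?_
  exact Complex.ofReal_mem_slitPlane.2 (abs_pos.2 (hv α hα))

/-- The Mehta integral does not vanish. -/
theorem mehta_ne_zero (D : IsDatum R P k) : mehta P k ≠ 0 := by
  intro h0
  have hI : Integrable fun x : E => weight P k x * gauss x :=
    (polyGrowth_weight D).expGrowth.integrable measurable_weight.aestronglyMeasurable
  have hpow : ∀ (v : E) (n : ℕ), PolyLE n fun x => (⟪v, x⟫_ℝ : ℂ) ^ n := by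
    intro v n
    induction n with
    | zero => simpa using PolyLE.const 0 (1 : ℂ)
    | succ n ih =>
      simp_rw [pow_succ']
      exact ih.linear_mul (Complex.ofRealCLM.toLinearMap ∘ₗ innerₗ E v)
  -- Expanding the exponential reduces this to vanishing moments; the Gaussian dominates exp |(v,
  -- x)| and allows termwise integration.
  have hzero : ∀ v : E, ∫ x, Complex.exp (Complex.I * (⟪v, x⟫_ℝ : ℂ)) * weight P k x * gauss x = 0 := by
    intro v
    have h1 := hasSum_integral_of_dominated_convergence (μ := (volume : Measure E))
      (F := fun (n : ℕ) x => (Complex.I * (⟪v, x⟫_ℝ : ℂ)) ^ n / n.factorial * weight P k x * gauss x)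
      (f := fun x => Complex.exp (Complex.I * (⟪v, x⟫_ℝ : ℂ)) * weight P k x * gauss x)
      (fun n x => |⟪v, x⟫_ℝ| ^ n / n.factorial * ‖weight P k x * gauss x‖) ?_ ?_ ?_ ?_ ?_
    · refine h1.unique ?_
      convert! hasSum_zero (α := ℂ) (β := ℕ) with n
      have h2 := integral_poly_eq_zero D h0 ((hpow v n).const_mul (Complex.I ^ n / n.factorial))
      rw [← h2]
      refine integral_congr_ae (Filter.Eventually.of_forall fun x => ?_)
      simp only []
      rw [mul_pow]; ring
    · intro n
      exact (((by fun_prop : Measurable fun x : E =>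
        (Complex.I * (⟪v, x⟫_ℝ : ℂ)) ^ n / n.factorial).mul measurable_weight).mul
        continuous_gauss.measurable).aestronglyMeasurable
    · intro n
      refine Filter.Eventually.of_forall fun x => ?_
      rw [mul_assoc, norm_mul]
      simp
    · refine Filter.Eventually.of_forall fun x => ?_
      exact (Real.summable_pow_div_factorial _).mul_right _
    · have h2 : ∀ x : E, ∑' n : ℕ, |⟪v, x⟫_ℝ| ^ n / n.factorial * ‖weight P k x * gauss x‖ =
          Real.exp |⟪v, x⟫_ℝ| * ‖weight P k x * gauss x‖ := by
        intro x
        rw [tsum_mul_right, Real.exp_eq_exp_ℝ, NormedSpace.exp_eq_tsum_div]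
      simp_rw [h2]
      have h3 : ExpGrowth fun x : E => (Real.exp |⟪v, x⟫_ℝ| : ℂ) := by
        refine ExpGrowth.of_le 1 ‖v‖ fun x => ?_
        rw [Complex.norm_real, Real.norm_of_nonneg (Real.exp_pos _).le, one_mul]
        exact Real.exp_le_exp.2 (abs_real_inner_le_norm v x)
      refine (h3.integrable_weight D (by fun_prop)).norm.congr (Filter.Eventually.of_forall fun x => ?_)
      simp only []
      rw [mul_assoc, norm_mul, Complex.norm_real, Real.norm_of_nonneg (Real.exp_pos _).le]
    · refine Filter.Eventually.of_forall fun x => ?_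
      refine HasSum.mul_right _ (HasSum.mul_right _ ?_)
      have := NormedSpace.expSeries_div_hasSum_exp (𝔸 := ℂ) (Complex.I * (⟪v, x⟫_ℝ : ℂ))
      rwa [← Complex.exp_eq_exp_ℂ] at this
  have hF : FourierTransform.fourier (fun x : E => weight P k x * gauss x) = (fun _ => 0 : E → ℂ) := by
    funext v
    rw [Real.fourier_eq', ← hzero ((-2 * Real.pi) • v)]
    refine integral_congr_ae (Filter.Eventually.of_forall fun x => ?_)
    simp only [smul_eq_mul]
    rw [mul_assoc (Complex.exp _), inner_smul_left, real_inner_comm]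
    congr 2
    simp
    ring
  -- The vector defining the positive system lies on no root hyperplane, so the weight is continuous
  -- and nonzero there. Fourier inversion at this point contradicts the vanishing of the Fourier
  -- transform.
  obtain ⟨v, hv, hv'⟩ := D.pos
  have hv1 : ∀ α ∈ P, ⟪α, v⟫_ℝ ≠ 0 := fun α hα => by
    rw [real_inner_comm]; exact hv α (D.mem hα)
  have h1 := hI.fourierInv_fourier_eq (v := v) (by rw [hF]; exact integrable_zero _ _ _)
    ((continuousAt_weight hv1).mul continuous_gauss.continuousAt)
  rw [hF] at h1
  rw [Real.fourierInv_eq'] at h1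
  simp only [smul_zero, integral_zero] at h1
  refine mul_ne_zero (weight_ne_zero hv1) ?_ h1.symm
  rw [gauss]
  exact Complex.ofReal_ne_zero.2 (Real.exp_pos _).ne'

/-- The (unnormalized) Dunkl transform of the Gaussian. -/
theorem integral_dunklExp_mul_gauss (D : IsDatum R P k) (x : E) :
    ∫ v, dunklExp P k (smulForm Complex.I v) x * weight P k v * gauss v = mehta P k * gauss x := by
  obtain ⟨B, hB⟩ := exists_norm_dunklExp_le D
  have hB0 : 0 ≤ B := (norm_nonneg _).trans (hB 0 0)
  have hcont : ∀ y, Continuous fun v => dunklExp P k (smulForm Complex.I v) y := fun y => by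
    simp_rw [dunklExp_comm D Complex.I _ y]
    exact (D.isDunklKernel _).contDiff.continuous
  have hg : ∀ y : E, ExpGrowth fun v => dunklExp P k (smulForm Complex.I v) y := fun y =>
    (PolyGrowth.of_bounded B fun v => hB v y).expGrowth
  have hint : ∀ y, Integrable fun v => dunklExp P k (smulForm Complex.I v) y * weight P k v * gauss v :=
    fun y => (hg y).integrable_weight D (hcont y).measurable
  let φ : E → ℂ := fun y => ∫ v, dunklExp P k (smulForm Complex.I v) y * weight P k v * gauss v
  have hwint : Integrable fun v : E => ‖weight P k v * gauss v‖ :=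
    ((polyGrowth_weight D).expGrowth.integrable measurable_weight.aestronglyMeasurable).norm
  have hφcont : Continuous φ := by
    refine continuous_of_dominated (bound := fun v => B * ‖weight P k v * gauss v‖)
      (fun y => (hint y).aestronglyMeasurable) (fun y => Filter.Eventually.of_forall fun v => ?_)
      (hwint.const_mul B) (Filter.Eventually.of_forall fun v => ?_)
    · rw [mul_assoc, norm_mul]
      gcongr
      exact hB v y
    · exact ((D.isDunklKernel _).contDiff.continuous.mul continuous_const).mul continuous_const
  have hφ0 : φ 0 = mehta P k := by
    rw [mehta_eq]
    refine integral_congr_ae (Filter.Eventually.of_forall fun v => ?_)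
    simp only []
    rw [dunklExp_zero_right D, one_mul]
  -- Invariance under reflections makes the difference terms of the ray equation drop out after
  -- integration.
  have hφrefl : ∀ α ∈ P, ∀ y, φ (rootRefl α y) = φ y := by
    intro α hα y
    simp only [φ]
    rw [← integral_map_isometry (rootRefl α)]
    refine integral_congr_ae (Filter.Eventually.of_forall fun v => ?_)
    simp only []
    rw [dunklExp_map D _ (D.refl_mem hα), weight_map D (D.refl_mem hα), gauss_map]
  have hderiv : ∀ t : ℝ, 0 < t → HasDerivAt (fun t : ℝ => φ (t • x))
      (-((t * ‖x‖ ^ 2 : ℝ) : ℂ) * φ (t • x)) t := by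
    intro t ht
    -- The ray equation, divided by t, expresses the radial derivative through values of the kernel.
    -- These are bounded by B, so the domination is uniform for parameters beyond t/2 without
    -- bounding the gradient of the kernel in terms of v.
    let K' : ℝ → E → ℂ := fun t v => Complex.I * (⟪x, v⟫_ℝ : ℂ) *
      dunklExp P k (smulForm Complex.I v) (t • x) -
      (t⁻¹ : ℝ) * ∑ α ∈ P, k α * (dunklExp P k (smulForm Complex.I v) (t • x) -
        dunklExp P k (smulForm Complex.I v) (t • rootRefl α x))
    have hK' : ∀ s : ℝ, 0 < s → ∀ v, HasDerivAt
        (fun t : ℝ => dunklExp P k (smulForm Complex.I v) (t • x)) (K' s v) s := by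
      intro s hs v
      have hk := D.isDunklKernel (smulForm Complex.I v)
      have h1 := hk.ray_equation x s
      have hs' : (s : ℂ) ≠ 0 := Complex.ofReal_ne_zero.2 hs.ne'
      convert! hk.hasDerivAt_ray x s using 1
      apply mul_left_cancel₀ hs'
      rw [h1, smulForm_apply, real_inner_comm]
      simp only [K']
      rw [mul_sub, ← mul_assoc (s : ℂ) ((s⁻¹ : ℝ) : ℂ), Complex.ofReal_inv, mul_inv_cancel₀ hs',
        one_mul]
    have hK'c : ∀ s, Continuous (K' s) := fun s => by
      refine ((by fun_prop : Continuous fun v : E => Complex.I * (⟪x, v⟫_ℝ : ℂ)).mul (hcont _)).sub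
        (continuous_const.mul (continuous_finsetSum _ fun α _ => continuous_const.mul
          ((hcont _).sub (hcont _))))
    have hsumb : ∀ (s : ℝ) (v : E), ‖∑ α ∈ P, k α * (dunklExp P k (smulForm Complex.I v) (s • x) -
        dunklExp P k (smulForm Complex.I v) (s • rootRefl α x))‖ ≤ ∑ α ∈ P, ‖k α‖ * (B + B) := by
      intro s v
      refine (norm_sum_le _ _).trans (Finset.sum_le_sum fun α _ => ?_)
      rw [norm_mul]
      gcongr
      exact (norm_sub_le _ _).trans (add_le_add (hB _ _) (hB _ _))
    have hdom := hasDerivAt_integral_of_dominated_loc_of_deriv_le (μ := (volume : Measure E))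
      (F := fun (t : ℝ) v => dunklExp P k (smulForm Complex.I v) (t • x) * weight P k v * gauss v)
      (F' := fun t v => K' t v * weight P k v * gauss v) (x₀ := t) (s := Set.Ioi (t / 2))
      (bound := fun v => (‖x‖ * ‖v‖ * B + (t / 2)⁻¹ * ∑ α ∈ P, ‖k α‖ * (B + B)) *
        ‖weight P k v * gauss v‖)
      (Ioi_mem_nhds (by linarith)) (Filter.Eventually.of_forall fun s => (hint _).aestronglyMeasurable)
      (hint _) ?_ ?_ ?_ ?_
    · have h2 := hdom.2
      convert! h2 using 1
      have h3 : ∀ v, K' t v * weight P k v * gauss v =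
          Complex.I * (dunklExp P k (smulForm Complex.I v) (t • x) * (⟪x, v⟫_ℝ : ℂ) *
            weight P k v * gauss v) -
          ((t⁻¹ : ℝ) : ℂ) * ∑ α ∈ P, k α *
            (dunklExp P k (smulForm Complex.I v) (t • x) * weight P k v * gauss v -
            dunklExp P k (smulForm Complex.I v) (t • rootRefl α x) * weight P k v * gauss v) := by
        intro v
        simp only [K', sub_mul, Finset.mul_sum, Finset.sum_mul, mul_sub]
        congr 1
        · ring
        · exact Finset.sum_congr rfl fun α _ => by ring
      simp_rw [h3]
      obtain ⟨C, hC⟩ := D.exists_norm_fderiv_dunklExp_le (smulForm Complex.I (t • x))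
      have hk := D.isDunklKernel (smulForm Complex.I (t • x))
      -- By symmetry the kernel in v is an eigenfunction with parameter i t x. Integrating T_x by
      -- parts turns the factor (x, v) into the eigenvalue i t |x|²; with the other factor i this
      -- gives -t |x|².
      have h4 := integral_dunklOp_mul_gauss D x (hk.contDiff.of_le (by simp)) hC
      simp_rw [hk.eigen, smulForm_apply, real_inner_smul_left, real_inner_self_eq_norm_sq,
        dunklExp_comm D Complex.I (t • x)] at h4
      rw [integral_sub, integral_const_mul, integral_const_mul, ← h4, integral_finsetSum]
      · have h5 : ∀ α ∈ P, ∫ v, k α * (dunklExp P k (smulForm Complex.I v) (t • x) *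
            weight P k v * gauss v - dunklExp P k (smulForm Complex.I v) (t • rootRefl α x) *
            weight P k v * gauss v) = 0 := by
          intro α hα
          rw [integral_const_mul, integral_sub (hint _) (hint _), ← map_smul]
          have := hφrefl α hα (t • x)
          simp only [φ] at this
          rw [this, sub_self, mul_zero]
        rw [Finset.sum_eq_zero h5, mul_zero, sub_zero]
        simp_rw [mul_assoc]
        rw [integral_const_mul, integral_const_mul]
        simp only [φ, mul_assoc]
        rw [← mul_assoc Complex.I Complex.I, Complex.I_mul_I]
        ring
      · intro α _
        exact ((hint _).sub (hint _)).const_mul _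
      · refine Integrable.const_mul ?_ _
        exact ((hg _).mul (ExpGrowth.inner x)).integrable_weight D
          ((hcont _).mul (by fun_prop)).measurable
      · exact (integrable_finsetSum _ fun α _ => ((hint _).sub (hint _)).const_mul _).const_mul _
    · exact (((hK'c t).measurable.mul measurable_weight).mul
        continuous_gauss.measurable).aestronglyMeasurable
    · refine Filter.Eventually.of_forall fun v s hs => ?_
      have hs : t / 2 < s := hs
      have hs0 : 0 < s := by linarith
      rw [mul_assoc, norm_mul]
      gcongr
      refine (norm_sub_le _ _).trans (add_le_add ?_ ?_)
      · rw [norm_mul, norm_mul, Complex.norm_I, one_mul, Complex.norm_real]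
        gcongr
        · exact norm_inner_le_norm x v
        · exact hB _ _
      · rw [norm_mul, Complex.norm_real, Real.norm_of_nonneg (inv_nonneg.2 hs0.le)]
        have := hsumb s v
        gcongr
    · have h5 : ExpGrowth fun v : E =>
          ((‖x‖ * ‖v‖ * B + (t / 2)⁻¹ * ∑ α ∈ P, ‖k α‖ * (B + B) : ℝ) : ℂ) := by
        have h6 : ExpGrowth fun v : E => (‖v‖ : ℂ) := ExpGrowth.of_le 1 1 fun v => by
          rw [Complex.norm_real, norm_norm, one_mul, one_mul]
          linarith [Real.add_one_le_exp ‖v‖]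
        have h7 := ((((ExpGrowth.const (E := E) (‖x‖ : ℂ)).mul h6).mul (ExpGrowth.const (B : ℂ))).add
          (ExpGrowth.const (((t / 2)⁻¹ * ∑ α ∈ P, ‖k α‖ * (B + B) : ℝ) : ℂ)))
        refine h7.mono fun v => ?_
        push_cast
        exact le_rfl
      refine (h5.integrable_weight D (by fun_prop)).norm.congr (Filter.Eventually.of_forall fun v => ?_)
      simp only []
      rw [mul_assoc, norm_mul, Complex.norm_real, Real.norm_of_nonneg (by positivity)]
    · refine Filter.Eventually.of_forall fun v s hs => ?_
      have hs : t / 2 < s := hs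
      exact ((hK' s (by linarith) v).mul_const _).mul_const _
  have hconst : ∀ t : ℝ, 0 < t → φ (t • x) * Complex.exp ((t ^ 2 * ‖x‖ ^ 2 / 2 : ℝ) : ℂ) =
      φ ((1 : ℝ) • x) * Complex.exp (((1 : ℝ) ^ 2 * ‖x‖ ^ 2 / 2 : ℝ) : ℂ) := by
    have hd : ∀ t : ℝ, 0 < t → HasDerivAt
        (fun t : ℝ => φ (t • x) * Complex.exp ((t ^ 2 * ‖x‖ ^ 2 / 2 : ℝ) : ℂ)) 0 t := by
      intro t ht
      have h1 : HasDerivAt (fun t : ℝ => ((t ^ 2 * ‖x‖ ^ 2 / 2 : ℝ) : ℂ)) ((t * ‖x‖ ^ 2 : ℝ) : ℂ) t := by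
        have h2 : HasDerivAt (fun t : ℝ => t ^ 2 * ‖x‖ ^ 2 / 2) (t * ‖x‖ ^ 2) t := by
          have := (((hasDerivAt_id' t).fun_pow 2).mul_const (‖x‖ ^ 2)).div_const 2
          convert! this using 1
          simp; ring
        exact h2.ofReal_comp
      convert! (hderiv t ht).mul h1.cexp using 1
      ring
    intro t ht
    refine IsOpen.is_const_of_deriv_eq_zero (𝕜 := ℝ) isOpen_Ioi (convex_Ioi 0).isPreconnected
      (s := Set.Ioi (0 : ℝ))
      (f := fun t : ℝ => φ (t • x) * Complex.exp ((t ^ 2 * ‖x‖ ^ 2 / 2 : ℝ) : ℂ))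
      (fun t ht => (hd t ht).differentiableAt.differentiableWithinAt)
      (fun t ht => (hd t ht).deriv) ht (Set.mem_Ioi.2 one_pos)
  -- The differential equation was derived only for t > 0; continuity of φ extends the constant
  -- value to t = 0, where φ(0) = c_k.
  have hlim : φ ((0 : ℝ) • x) * Complex.exp (((0 : ℝ) ^ 2 * ‖x‖ ^ 2 / 2 : ℝ) : ℂ) =
      φ ((1 : ℝ) • x) * Complex.exp (((1 : ℝ) ^ 2 * ‖x‖ ^ 2 / 2 : ℝ) : ℂ) := by
    have h1 : Continuous fun t : ℝ => φ (t • x) * Complex.exp ((t ^ 2 * ‖x‖ ^ 2 / 2 : ℝ) : ℂ) := by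
      fun_prop
    refine tendsto_nhds_unique (f := fun t : ℝ =>
      φ (t • x) * Complex.exp ((t ^ 2 * ‖x‖ ^ 2 / 2 : ℝ) : ℂ)) (l := nhdsWithin 0 (Set.Ioi 0))
      ((h1.tendsto 0).mono_left nhdsWithin_le_nhds) ?_
    refine tendsto_const_nhds.congr' ?_
    filter_upwards [self_mem_nhdsWithin] with t ht using (hconst t ht).symm
  rw [zero_smul, hφ0, one_smul] at hlim
  change φ x = _
  have h2 : gauss x = Complex.exp (-((1 : ℝ) ^ 2 * ‖x‖ ^ 2 / 2 : ℝ)) := by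
    rw [gauss_eq_cexp]; congr 1; push_cast; ring
  rw [h2]
  have h3 : mehta P k = φ x * Complex.exp (((1 : ℝ) ^ 2 * ‖x‖ ^ 2 / 2 : ℝ) : ℂ) := by
    rw [← hlim]; simp
  rw [h3, mul_assoc, ← Complex.exp_add, add_neg_cancel, Complex.exp_zero, mul_one]

theorem weight_smul {r : ℝ} (hr : 0 < r) (x : E) :
    weight P k (r • x) = (r : ℂ) ^ (2 * ∑ α ∈ P, k α) * weight P k x := by
  have hr' : (r : ℂ) ≠ 0 := Complex.ofReal_ne_zero.2 hr.ne'
  have h1 : (r : ℂ) ^ (2 * ∑ α ∈ P, k α) = ∏ α ∈ P, (r : ℂ) ^ (2 * k α) := by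
    rw [Complex.cpow_def_of_ne_zero hr', Finset.mul_sum, Finset.mul_sum, Complex.exp_sum]
    exact Finset.prod_congr rfl fun α _ => by rw [Complex.cpow_def_of_ne_zero hr']
  rw [h1, weight, weight, ← Finset.prod_mul_distrib]
  refine Finset.prod_congr rfl fun α _ => ?_
  rw [inner_smul_right, abs_mul, abs_of_pos hr, Complex.ofReal_mul,
    Complex.mul_cpow_ofReal_nonneg hr.le (abs_nonneg _)]

/-- The (unnormalized) Dunkl transform of a scaled Gaussian. -/
theorem integral_dunklExp_mul_gauss_smul (D : IsDatum R P k) {r : ℝ} (hr : 0 < r) (x : E) :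
    ∫ v, dunklExp P k (smulForm Complex.I v) x * weight P k v * gauss (r⁻¹ • v) =
      (r : ℂ) ^ (Module.finrank ℝ E) * (r : ℂ) ^ (2 * ∑ α ∈ P, k α) *
        (mehta P k * gauss (r • x)) := by
  have h1 := Measure.integral_comp_smul (volume : Measure E)
    (fun v => dunklExp P k (smulForm Complex.I v) x * weight P k v * gauss (r⁻¹ • v)) r
  have h2 : ∀ v : E, dunklExp P k (smulForm Complex.I (r • v)) x * weight P k (r • v) *
      gauss (r⁻¹ • r • v) = (r : ℂ) ^ (2 * ∑ α ∈ P, k α) *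
        (dunklExp P k (smulForm Complex.I v) (r • x) * weight P k v * gauss v) := by
    intro v
    rw [inv_smul_smul₀ hr.ne', weight_smul hr, dunklExp_smul D]; ring
  simp_rw [h2] at h1
  rw [integral_const_mul, integral_dunklExp_mul_gauss D] at h1
  rw [mul_assoc, h1, abs_of_pos (by positivity), Complex.real_smul]
  push_cast
  have hr' : (r : ℂ) ≠ 0 := Complex.ofReal_ne_zero.2 hr.ne'
  rw [← mul_assoc, mul_inv_cancel₀ (pow_ne_zero _ hr'), one_mul]

end Mehta


/-! ### Gaussians determine integrals of radial functions -/

section GaussianUniqueness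

variable {E : Type*} [NormedAddCommGroup E] [InnerProductSpace ℝ E] [FiniteDimensional ℝ E]
  [MeasurableSpace E] [BorelSpace E]

theorem norm_gauss_le_one (x : E) : ‖gauss x‖ ≤ 1 := by
  rw [norm_gauss, Real.exp_le_one_iff]
  nlinarith [sq_nonneg ‖x‖]

/-- Weierstrass approximation of H on [0, 1], where y = exp(-|v|²/2) takes its values. One factor of
the Gaussian is kept aside to make Φ integrable, so the polynomials tested are y p(y); this is why
only the powers n + 1 occur. -/
theorem integral_continuous_gauss_eq_zero {Φ : E → ℂ} (hm : Measurable Φ) (hg : ExpGrowth Φ)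
    (h : ∀ n : ℕ, ∫ v, Φ v * gauss v ^ (n + 1) = 0) {H : ℝ → ℝ} (hH : Continuous H) :
    ∫ v, (H (Real.exp (-‖v‖ ^ 2 / 2)) : ℂ) * (Φ v * gauss v) = 0 := by
  have hI : Integrable fun v => Φ v * gauss v := hg.integrable hm.aestronglyMeasurable
  have hpoly : ∀ p : Polynomial ℝ,
      ∫ v, ((p.eval (Real.exp (-‖v‖ ^ 2 / 2)) : ℝ) : ℂ) * (Φ v * gauss v) = 0 := by
    intro p
    have h1 : ∀ v : E, ((p.eval (Real.exp (-‖v‖ ^ 2 / 2)) : ℝ) : ℂ) * (Φ v * gauss v) =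
        ∑ i ∈ Finset.range (p.natDegree + 1), (p.coeff i : ℂ) * (Φ v * gauss v ^ (i + 1)) := by
      intro v
      rw [Polynomial.eval_eq_sum_range, Complex.ofReal_sum, Finset.sum_mul]
      refine Finset.sum_congr rfl fun i _ => ?_
      rw [gauss]; push_cast; ring
    simp_rw [h1]
    rw [integral_finsetSum]
    · refine Finset.sum_eq_zero fun i _ => ?_
      rw [integral_const_mul, h, mul_zero]
    · intro i _
      refine Integrable.const_mul ?_ _
      refine hI.mono (hm.mul (continuous_gauss.measurable.pow_const _)).aestronglyMeasurable
        (Filter.Eventually.of_forall fun v => ?_)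
      rw [norm_mul, norm_mul, norm_pow]
      gcongr
      exact pow_le_of_le_one (norm_nonneg _) (norm_gauss_le_one v) (Nat.succ_ne_zero i)
  have hsmall : ∀ ε : ℝ, 0 < ε → ‖∫ v, (H (Real.exp (-‖v‖ ^ 2 / 2)) : ℂ) * (Φ v * gauss v)‖ ≤
      ε * ∫ v, ‖Φ v * gauss v‖ := by
    intro ε hε
    obtain ⟨p, hp⟩ := exists_polynomial_near_of_continuousOn 0 1 H hH.continuousOn ε hε
    have hmem : ∀ v : E, Real.exp (-‖v‖ ^ 2 / 2) ∈ Set.Icc (0 : ℝ) 1 := fun v =>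
      ⟨(Real.exp_pos _).le, by rw [← norm_gauss]; exact norm_gauss_le_one v⟩
    have hdiff : ∀ v : E, ‖((H (Real.exp (-‖v‖ ^ 2 / 2)) -
        p.eval (Real.exp (-‖v‖ ^ 2 / 2)) : ℝ) : ℂ)‖ ≤ ε := fun v => by
      rw [Complex.norm_real, Real.norm_eq_abs, abs_sub_comm]
      exact (hp _ (hmem v)).le
    have hI1 : Integrable fun v => ((H (Real.exp (-‖v‖ ^ 2 / 2)) -
        p.eval (Real.exp (-‖v‖ ^ 2 / 2)) : ℝ) : ℂ) * (Φ v * gauss v) := by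
      refine hI.bdd_mul (c := ε) (Continuous.aestronglyMeasurable ?_)
        (Filter.Eventually.of_forall hdiff)
      have := p.continuous
      fun_prop
    have hI2 : Integrable fun v => ((p.eval (Real.exp (-‖v‖ ^ 2 / 2)) : ℝ) : ℂ) * (Φ v * gauss v) := by
      obtain ⟨B, hB⟩ := (isCompact_Icc (a := (0 : ℝ)) (b := 1)).exists_bound_of_continuousOn
        p.continuous.continuousOn
      refine hI.bdd_mul (c := B) (Continuous.aestronglyMeasurable ?_)
        (Filter.Eventually.of_forall fun v => ?_)
      · have := p.continuous
        fun_prop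
      · rw [Complex.norm_real]
        exact hB _ (hmem v)
    have h2 : ∫ v, (H (Real.exp (-‖v‖ ^ 2 / 2)) : ℂ) * (Φ v * gauss v) =
        ∫ v, ((H (Real.exp (-‖v‖ ^ 2 / 2)) - p.eval (Real.exp (-‖v‖ ^ 2 / 2)) : ℝ) : ℂ) *
          (Φ v * gauss v) := by
      rw [← add_zero (∫ v, ((H (Real.exp (-‖v‖ ^ 2 / 2)) -
        p.eval (Real.exp (-‖v‖ ^ 2 / 2)) : ℝ) : ℂ) * (Φ v * gauss v)), ← hpoly p,
        ← integral_add hI1 hI2]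
      refine integral_congr_ae (Filter.Eventually.of_forall fun v => ?_)
      simp only []
      push_cast; ring
    rw [h2, ← integral_const_mul]
    refine norm_integral_le_of_norm_le (hI.norm.const_mul ε) (Filter.Eventually.of_forall fun v => ?_)
    rw [norm_mul]
    gcongr
    exact hdiff v
  have hnn : 0 ≤ ∫ v, ‖Φ v * gauss v‖ := integral_nonneg fun v => norm_nonneg _
  rw [← norm_le_zero_iff]
  refine le_of_forall_pos_le_add fun ε hε => ?_
  refine (hsmall (ε / (1 + ∫ v, ‖Φ v * gauss v‖)) (by positivity)).trans ?_
  rw [zero_add, div_mul_eq_mul_div, div_le_iff₀ (by positivity)]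
  nlinarith

/-- Vectors of equal norm are exchanged by the reflection in the hyperplane orthogonal to their
difference. -/
theorem IsRadial.eq_of_norm_eq {g : E → ℂ} (hg : IsRadial g) {v w : E} (h : ‖v‖ = ‖w‖) :
    g v = g w := by
  rw [← hg (ℝ ∙ (v - w))ᗮ.reflection v, Submodule.reflection_sub h]

/-- A function of polynomial growth annihilating all Gaussians annihilates all radial functions. -/
theorem integral_radial_eq_zero {Φ : E → ℂ} (hm : Measurable Φ) (hΦ : ExpGrowth Φ)
    (h : ∀ n : ℕ, ∫ v, Φ v * gauss v ^ (n + 1) = 0) {g : E → ℂ} (hgc : Continuous g)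
    (hgr : IsRadial g) (hI : Integrable fun v => g v * Φ v) {e : E} (he : ‖e‖ = 1) :
    ∫ v, g v * Φ v = 0 := by
  -- Continuous cutoff: equal to 1 up to n, linear in between, and 0 from n + 1 on.
  let χ : ℕ → ℝ → ℝ := fun n s => max 0 (min 1 ((n : ℝ) + 1 - s))
  have hχc : ∀ n, Continuous (χ n) := fun n => by simp only [χ]; fun_prop
  have hχ0 : ∀ n s, 0 ≤ χ n s := fun n s => le_max_left _ _
  have hχ1 : ∀ n s, χ n s ≤ 1 := fun n s => max_le zero_le_one (min_le_left _ _)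
  have hχz : ∀ n : ℕ, ∀ s, (n : ℝ) + 1 ≤ s → χ n s = 0 := fun n s hs =>
    max_eq_left ((min_le_right _ _).trans (by linarith))
  have hχe : ∀ (n : ℕ) (s : ℝ), s ≤ n → χ n s = 1 := fun n s hs => by
    simp only [χ]
    rw [min_eq_left (by linarith), max_eq_right zero_le_one]
  have hcut : ∀ n, ∫ v, (χ n ‖v‖ : ℂ) * (g v * Φ v) = 0 := by
    intro n
    set ε := Real.exp (-((n : ℝ) + 1) ^ 2 / 2) with hε
    have hε0 : 0 < ε := Real.exp_pos _
    -- Recovers ‖v‖ from y = exp(-‖v‖²/2) as long as ‖v‖ ≤ n + 1. Truncating at ε, the value of y at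
    -- radius n + 1, keeps the logarithm continuous; beyond that radius A = n + 1, where the cutoff
    -- vanishes.
    let A : ℝ → ℝ := fun y => √(-2 * Real.log (max y ε))
    have hAc : Continuous A := by
      refine Real.continuous_sqrt.comp (continuous_const.mul (Continuous.log (by fun_prop) ?_))
      intro y; exact (lt_of_lt_of_le hε0 (le_max_right _ _)).ne'
    let Hc : ℝ → ℂ := fun y => (χ n (A y) : ℂ) * g (A y • e) * ((max y ε : ℝ) : ℂ)⁻¹
    have hHc : Continuous Hc := by
      refine ((Complex.continuous_ofReal.comp ((hχc n).comp hAc)).mul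
        (hgc.comp (hAc.smul continuous_const))).mul (Continuous.inv₀ (by fun_prop) fun y => ?_)
      exact Complex.ofReal_ne_zero.2 (lt_of_lt_of_le hε0 (le_max_right _ _)).ne'
    have hval : ∀ v : E, (χ n ‖v‖ : ℂ) * (g v * Φ v) =
        Hc (Real.exp (-‖v‖ ^ 2 / 2)) * (Φ v * gauss v) := by
      intro v
      have hgauss : gauss v ≠ 0 := by
        rw [gauss]; exact Complex.ofReal_ne_zero.2 (Real.exp_pos _).ne'
      rcases le_or_gt ‖v‖ ((n : ℝ) + 1) with hv | hv
      · have h1 : max (Real.exp (-‖v‖ ^ 2 / 2)) ε = Real.exp (-‖v‖ ^ 2 / 2) := by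
          refine max_eq_left (Real.exp_le_exp.2 ?_)
          nlinarith [norm_nonneg v]
        have h2 : A (Real.exp (-‖v‖ ^ 2 / 2)) = ‖v‖ := by
          simp only [A]
          rw [h1, Real.log_exp, show -2 * (-‖v‖ ^ 2 / 2) = ‖v‖ ^ 2 by ring,
            Real.sqrt_sq (norm_nonneg v)]
        have h3 : g (‖v‖ • e) = g v := hgr.eq_of_norm_eq (by rw [norm_smul, he]; simp)
        simp only [Hc]
        rw [h2, h1, h3]
        change _ = (χ n ‖v‖ : ℂ) * g v * (gauss v)⁻¹ * _
        field_simp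
      · have h1 : max (Real.exp (-‖v‖ ^ 2 / 2)) ε = ε := by
          refine max_eq_right (Real.exp_le_exp.2 ?_)
          have : (0 : ℝ) ≤ n := Nat.cast_nonneg n
          nlinarith
        have h2 : A (Real.exp (-‖v‖ ^ 2 / 2)) = (n : ℝ) + 1 := by
          simp only [A]
          rw [h1, hε, Real.log_exp, show -2 * (-((n : ℝ) + 1) ^ 2 / 2) = ((n : ℝ) + 1) ^ 2 by ring,
            Real.sqrt_sq (by positivity)]
        simp only [Hc]
        rw [h2, hχz n _ hv.le, hχz n _ le_rfl]
        simp
    have hre : Continuous fun y => (Hc y).re := Complex.continuous_re.comp hHc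
    have him : Continuous fun y => (Hc y).im := Complex.continuous_im.comp hHc
    have hIg : Integrable fun v => Φ v * gauss v := hΦ.integrable hm.aestronglyMeasurable
    have hbd : ∀ H : ℝ → ℝ, Continuous H →
        Integrable fun v => (H (Real.exp (-‖v‖ ^ 2 / 2)) : ℂ) * (Φ v * gauss v) := by
      intro H hH
      obtain ⟨B, hB⟩ := (isCompact_Icc (a := (0 : ℝ)) (b := 1)).exists_bound_of_continuousOn
        hH.continuousOn
      refine hIg.bdd_mul (c := B) (Continuous.aestronglyMeasurable (by fun_prop))
        (Filter.Eventually.of_forall fun v => ?_)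
      rw [Complex.norm_real]
      exact hB _ ⟨(Real.exp_pos _).le, by rw [← norm_gauss]; exact norm_gauss_le_one v⟩
    have hsplit : ∀ v : E, (χ n ‖v‖ : ℂ) * (g v * Φ v) =
        ((Hc (Real.exp (-‖v‖ ^ 2 / 2))).re : ℂ) * (Φ v * gauss v) +
        Complex.I * (((Hc (Real.exp (-‖v‖ ^ 2 / 2))).im : ℂ) * (Φ v * gauss v)) := by
      intro v
      rw [hval]
      conv_lhs => rw [← Complex.re_add_im (Hc (Real.exp (-‖v‖ ^ 2 / 2)))]
      ring
    simp_rw [hsplit]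
    rw [integral_add (hbd _ hre) ((hbd _ him).const_mul _), integral_const_mul,
      integral_continuous_gauss_eq_zero hm hΦ h hre, integral_continuous_gauss_eq_zero hm hΦ h him]
    simp
  have hlim : Filter.Tendsto (fun n : ℕ => ∫ v, (χ n ‖v‖ : ℂ) * (g v * Φ v)) Filter.atTop
      (nhds (∫ v, g v * Φ v)) := by
    refine tendsto_integral_of_dominated_convergence (fun v => ‖g v * Φ v‖) (fun n => ?_) hI.norm
      (fun n => Filter.Eventually.of_forall fun v => ?_) (Filter.Eventually.of_forall fun v => ?_)
    · refine AEStronglyMeasurable.mul (Continuous.aestronglyMeasurable ?_) hI.aestronglyMeasurable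
      exact Complex.continuous_ofReal.comp ((hχc n).comp continuous_norm)
    · rw [norm_mul, Complex.norm_real, Real.norm_of_nonneg (hχ0 _ _)]
      exact mul_le_of_le_one_left (norm_nonneg _) (hχ1 _ _)
    · refine tendsto_const_nhds.congr' ?_
      filter_upwards [Filter.eventually_ge_atTop ⌈‖v‖⌉₊] with n hn
      rw [hχe n _ (Nat.ceil_le.1 hn)]
      simp
  simp_rw [hcut] at hlim
  exact tendsto_nhds_unique tendsto_const_nhds hlim |>.symm

end GaussianUniqueness


/-! ### Slicing along a line and the Fourier slice theorem -/

section Slice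

variable {E : Type*} [NormedAddCommGroup E] [InnerProductSpace ℝ E] [FiniteDimensional ℝ E]
  [MeasurableSpace E] [BorelSpace E]

/-- The decomposition of a Euclidean space along a unit vector. -/
noncomputable def lineProdEquiv (e : E) (he : ‖e‖ = 1) : ℝ × (ℝ ∙ e)ᗮ ≃ᵐ E :=
  ((LinearIsometryEquiv.toSpanUnitSingleton e he).toMeasurableEquiv.prodCongr
    (MeasurableEquiv.refl _)).trans
    ((MeasurableEquiv.toLp 2 ((ℝ ∙ e) × (ℝ ∙ e)ᗮ)).trans
      (ℝ ∙ e).orthogonalDecomposition.symm.toMeasurableEquiv)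

theorem lineProdEquiv_apply (e : E) (he : ‖e‖ = 1) (p : ℝ × (ℝ ∙ e)ᗮ) :
    lineProdEquiv e he p = p.1 • e + p.2 := by
  change (ℝ ∙ e).orthogonalDecomposition.symm (WithLp.toLp 2 _) = _
  rw [Submodule.orthogonalDecomposition_symm_apply]
  rfl

theorem measurePreserving_lineProdEquiv (e : E) (he : ‖e‖ = 1) :
    MeasurePreserving (lineProdEquiv e he) := by
  refine MeasurePreserving.trans (MeasurePreserving.prod
    (LinearIsometryEquiv.measurePreserving _) (MeasurePreserving.id _)) ?_
  exact (WithLp.volume_preserving_toLp _ _).trans (LinearIsometryEquiv.measurePreserving _)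

theorem integrable_line {F : E → ℂ} (hF : Integrable F) (e : E) (he : ‖e‖ = 1) :
    Integrable (fun p : ℝ × (ℝ ∙ e)ᗮ => F (p.1 • e + p.2)) (volume.prod volume) := by
  have := ((measurePreserving_lineProdEquiv e he).integrable_comp_emb
    (lineProdEquiv e he).measurableEmbedding).2 hF
  exact this.congr (Filter.Eventually.of_forall fun p => by
    rw [Function.comp_apply, lineProdEquiv_apply])

theorem integral_line {F : E → ℂ} (hF : Integrable F) (e : E) (he : ‖e‖ = 1) :
    ∫ v, F v = ∫ r : ℝ, ∫ w : (ℝ ∙ e)ᗮ, F (r • e + w) := by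
  rw [← (measurePreserving_lineProdEquiv e he).integral_comp
    (lineProdEquiv e he).measurableEmbedding]
  simp_rw [lineProdEquiv_apply]
  exact integral_prod _ (integrable_line hF e he)

theorem inner_line (e : E) (he : ‖e‖ = 1) (r : ℝ) (w : (ℝ ∙ e)ᗮ) : ⟪e, r • e + (w : E)⟫_ℝ = r := by
  rw [inner_add_right, inner_smul_right, real_inner_self_eq_norm_sq, he,
    Submodule.mem_orthogonal_singleton_iff_inner_right.1 w.2]
  ring

theorem norm_sq_line (e : E) (he : ‖e‖ = 1) (r : ℝ) (w : (ℝ ∙ e)ᗮ) :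
    ‖r • e + (w : E)‖ ^ 2 = r ^ 2 + ‖w‖ ^ 2 := by
  rw [norm_add_sq_real, inner_smul_left, Submodule.mem_orthogonal_singleton_iff_inner_right.1 w.2,
    norm_smul, he]
  simp

/-- A Schwartz function times a function of polynomial growth is integrable. -/
theorem PolyGrowth.integrable_schwartz {Φ : E → ℂ} (hΦ : PolyGrowth Φ) (hm : Measurable Φ)
    (S : 𝓢(E, ℂ)) : Integrable fun v => S v * Φ v := by
  obtain ⟨C, N, hC⟩ := hΦ
  have h0 : 0 ≤ C := by simpa using (norm_nonneg _).trans (hC 0)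
  have h1 : Integrable fun v => C * (2 ^ (N - 1) * (‖v‖ ^ 0 * ‖S v‖ + ‖v‖ ^ N * ‖S v‖)) :=
    (((S.integrable_pow_mul volume 0).add (S.integrable_pow_mul volume N)).const_mul _).const_mul _
  refine h1.mono' (S.continuous.aestronglyMeasurable.mul hm.aestronglyMeasurable)
    (Filter.Eventually.of_forall fun v => ?_)
  have h2 : (1 + ‖v‖) ^ N ≤ 2 ^ (N - 1) * (1 ^ N + ‖v‖ ^ N) :=
    add_pow_le zero_le_one (norm_nonneg v) N
  rw [one_pow] at h2
  rw [norm_mul]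
  calc ‖S v‖ * ‖Φ v‖ ≤ ‖S v‖ * (C * (2 ^ (N - 1) * (1 + ‖v‖ ^ N))) := by
        gcongr
        exact (hC v).trans (by gcongr)
    _ = _ := by ring

/-- Schwartz decay of order dim e^⊥ + 1 in the orthogonal variable, uniform in r because ‖w‖ ≤ ‖r e
+ w‖, gives an integrable majorant. -/
theorem continuous_integral_slice (S : 𝓢(E, ℂ)) (e : E) (he : ‖e‖ = 1) :
    Continuous fun r : ℝ => ∫ w : (ℝ ∙ e)ᗮ, S (r • e + w) := by
  let N : ℕ := Module.finrank ℝ (ℝ ∙ e)ᗮ + 1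
  obtain ⟨C, hC⟩ : ∃ C : ℝ, ∀ x : E, (1 + ‖x‖) ^ N * ‖S x‖ ≤ C := by
    refine ⟨2 ^ N * (Finset.Iic (N, 0)).sup (fun m => SchwartzMap.seminorm ℝ m.1 m.2) S,
      fun x => ?_⟩
    have := S.one_add_le_sup_seminorm_apply (𝕜 := ℝ) (m := (N, 0)) le_rfl le_rfl x
    rwa [norm_iteratedFDeriv_zero] at this
  have hint := integrable_one_add_norm (E := (ℝ ∙ e)ᗮ) (μ := volume) (r := N)
    (by simp only [N]; push_cast; linarith)
  refine continuous_of_dominated (bound := fun w => C * (1 + ‖w‖) ^ (-(N : ℝ)))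
    (fun r => (S.continuous.comp (by fun_prop)).aestronglyMeasurable)
    (fun r => Filter.Eventually.of_forall fun w => ?_) (hint.const_mul C)
    (Filter.Eventually.of_forall fun w => S.continuous.comp (by fun_prop))
  have h1 : ‖w‖ ≤ ‖r • e + (w : E)‖ := by
    refine le_of_sq_le_sq ?_ (norm_nonneg _)
    rw [norm_sq_line e he]
    nlinarith [sq_nonneg r]
  rw [Real.rpow_neg (by positivity), Real.rpow_natCast, ← div_eq_mul_inv,
    le_div_iff₀ (by positivity), mul_comm]
  refine le_trans ?_ (hC (r • e + w))
  gcongr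

open FourierTransform in
/-- The Fourier slice theorem: the Fourier transform of a restriction to a line is obtained by
integrating the Fourier transform over the orthogonal directions. -/
theorem fourier_restrict_line (f : 𝓢(E, ℂ)) (e : E) (he : ‖e‖ = 1) (r : ℝ) :
    𝓕 (fun t : ℝ => f (t • e)) r = ∫ w : (ℝ ∙ e)ᗮ, (𝓕 f : 𝓢(E, ℂ)) (r • e + w) := by
  set S : 𝓢(E, ℂ) := 𝓕 f with hS
  let h : ℝ → ℂ := fun r => ∫ w : (ℝ ∙ e)ᗮ, S (r • e + w)
  have hhc : Continuous h := continuous_integral_slice S e he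
  have hhi : Integrable h := (integrable_line S.integrable e he).integral_prod_left
  -- It is easier to argue backwards: by Fubini, the inverse transform of h is the inverse transform
  -- of S at t e, and (v, t e) does not see the orthogonal component of v.
  have hinv : ∀ t : ℝ, 𝓕⁻ h t = f (t • e) := by
    intro t
    have h1 : f = 𝓕⁻ S := by rw [hS, fourierInv_fourier_eq]
    rw [h1, SchwartzMap.fourierInv_coe, Real.fourierInv_eq', Real.fourierInv_eq']
    have h2 : Integrable fun v : E => Complex.exp (((2 * Real.pi * ⟪v, t • e⟫_ℝ : ℝ) : ℂ) * Complex.I) • S v := by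
      refine S.integrable.bdd_mul (c := 1) (Continuous.aestronglyMeasurable (by fun_prop))
        (Filter.Eventually.of_forall fun v => ?_)
      rw [Complex.norm_exp_ofReal_mul_I]
    rw [integral_line h2 e he]
    refine integral_congr_ae (Filter.Eventually.of_forall fun r => ?_)
    simp only [h, smul_eq_mul]
    rw [← integral_const_mul]
    refine integral_congr_ae (Filter.Eventually.of_forall fun w => ?_)
    simp only []
    rw [inner_smul_right, real_inner_comm e (r • e + (w : E)), inner_line e he, Real.inner_apply,
      mul_comm r t]
  have hres : Integrable fun t : ℝ => f (t • e) := by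
    let L := LinearIsometryEquiv.toSpanUnitSingleton (𝕜 := ℝ) e he
    let ι : ℝ →ₗᵢ[ℝ] E := (ℝ ∙ e).subtypeₗᵢ.comp L.toLinearIsometry
    exact (SchwartzMap.compCLMOfAntilipschitz ℝ
      (ι.toContinuousLinearMap.hasTemperateGrowth) ι.antilipschitz f).integrable
  -- Needed for inversion on the line: the transform of h is the reflected restriction of f, a
  -- Schwartz function.
  have hfh : Integrable (𝓕 h) := by
    have h3 : 𝓕 h = fun t => f ((-t) • e) := by
      funext t
      rw [← hinv, Real.fourierInv_eq_fourier_neg, neg_neg]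
    rw [h3]
    exact hres.comp_neg
  have h4 := hhc.fourier_fourierInv_eq hhi hfh
  rw [← funext hinv, h4]

end Slice


/-! ### The rank one root system -/

section RankOneDatum

theorem isDatum_rankOne {κ : ℂ} (hκ : 0 ≤ κ.re) :
    IsDatum ({√2, -√2} : Finset ℝ) rankOnePos (fun _ => κ) where
  root := by
    have h2 : ∀ α ∈ ({√2, -√2} : Finset ℝ), ⟪α, α⟫_ℝ = 2 := by
      intro α hα
      rcases Finset.mem_insert.1 hα with rfl | hα
      · simp
      · rw [Finset.mem_singleton.1 hα]; simp
    refine ⟨h2, fun α hα β hβ => ?_⟩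
    rw [rootRefl_apply (h2 α hα), Real.inner_apply]
    have hs : √2 * √2 = 2 := Real.mul_self_sqrt zero_le_two
    simp only [Finset.mem_insert, Finset.mem_singleton, smul_eq_mul] at *
    rcases hα with rfl | rfl <;> rcases hβ with rfl | rfl
    · right; rw [hs]; ring
    · left; linear_combination √2 * hs
    · right; linear_combination -√2 * hs
    · left; linear_combination √2 * hs
  pos := by
    have hs : 0 < √2 := by positivity
    refine ⟨1, fun α hα => ?_, fun α => ?_⟩
    · simp only [Finset.mem_insert, Finset.mem_singleton] at hα
      rw [Real.inner_apply]
      rcases hα with rfl | rfl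
      · linarith
      · linarith
    · simp only [rankOnePos, Finset.mem_insert, Finset.mem_singleton, Real.inner_apply, one_mul]
      constructor
      · rintro rfl; exact ⟨Or.inl rfl, hs⟩
      · rintro ⟨rfl | rfl, h⟩
        · rfl
        · linarith
  mult := fun _ _ _ _ => rfl
  re_nonneg := fun _ _ => hκ

end RankOneDatum

/-! ### Multiplicity zero: comparison with the Fourier transform -/

section ZeroMultiplicity

variable {E : Type*} [NormedAddCommGroup E] [InnerProductSpace ℝ E] [FiniteDimensional ℝ E]
  [MeasurableSpace E] [BorelSpace E] {R P : Finset E} {k : E → ℂ}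

theorem weight_zero (x : E) : weight P 0 x = 1 := by simp [weight]

theorem integral_gauss : ∫ v : E, gauss v = ((√(2 * Real.pi) : ℝ) : ℂ) ^ Module.finrank ℝ E := by
  have h := GaussianFourier.integral_rexp_neg_mul_sq_norm (V := E) (b := 1 / 2) (by norm_num)
  have h1 : ∫ v : E, gauss v = ((∫ v : E, Real.exp (-(1 / 2) * ‖v‖ ^ 2) : ℝ) : ℂ) := by
    rw [← integral_complex_ofReal]
    refine integral_congr_ae (Filter.Eventually.of_forall fun v => ?_)
    simp only [gauss]
    congr 2
    ring
  rw [h1, h, ← Complex.ofReal_pow, Real.sqrt_eq_rpow, ← Real.rpow_natCast, ← Real.rpow_mul (by positivity)]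
  congr 2 <;> ring

theorem mehta_zero : mehta P 0 = ((√(2 * Real.pi) : ℝ) : ℂ) ^ Module.finrank ℝ E := by
  rw [mehta_eq, ← integral_gauss]
  simp_rw [weight_zero, one_mul]

open FourierTransform in
-- The kernel is exp(-i(v, x)) while `𝓕` uses exp(-2πi(v, x)), which accounts for the dilation by
-- 1/(2π).
theorem dunklTransform_zero (D : IsDatum R P k) (f : E → ℂ) (v : E) :
    dunklTransform P 0 f v =
      (((√(2 * Real.pi) : ℝ) : ℂ) ^ Module.finrank ℝ E)⁻¹ * 𝓕 f ((2 * Real.pi)⁻¹ • v) := by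
  rw [dunklTransform, mehta_zero, Real.fourier_eq']
  congr 1
  refine integral_congr_ae (Filter.Eventually.of_forall fun x => ?_)
  have hpi : (Real.pi : ℂ) ≠ 0 := Complex.ofReal_ne_zero.2 Real.pi_ne_zero
  simp only [weight_zero, mul_one, dunklExp_zero_mult D, smul_eq_mul]
  rw [mul_comm, inner_smul_right, real_inner_comm x v]
  congr 2
  push_cast
  field_simp

end ZeroMultiplicity

/-! ### Restriction to a line and the rank one Gaussian integral -/

section Restriction

variable {E : Type*} [NormedAddCommGroup E] [InnerProductSpace ℝ E] [FiniteDimensional ℝ E]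
  [MeasurableSpace E] [BorelSpace E] {R P : Finset E} {k : E → ℂ}

theorem sum_rankOnePos (κ : ℂ) : ∑ _α ∈ rankOnePos, κ = κ := by simp [rankOnePos]

theorem finrank_orthogonal_line {e : E} (he : ‖e‖ = 1) :
    Module.finrank ℝ (ℝ ∙ e)ᗮ + 1 = Module.finrank ℝ E := by
  have h0 : e ≠ 0 := by rintro rfl; simp at he
  rw [← (ℝ ∙ e).finrank_add_finrank_orthogonal, finrank_span_singleton h0, add_comm]

open FourierTransform in
/-- The transform with multiplicity zero, as a Schwartz function. -/
noncomputable def schwartzTransform (f : 𝓢(E, ℂ)) : 𝓢(E, ℂ) :=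
  (((√(2 * Real.pi) : ℝ) : ℂ) ^ Module.finrank ℝ E)⁻¹ •
    SchwartzMap.compCLMOfContinuousLinearEquiv ℂ (ContinuousLinearEquiv.smulLeft
      (Units.mk0 (2 * Real.pi)⁻¹ (by positivity))) (𝓕 f)

open FourierTransform in
theorem schwartzTransform_apply (f : 𝓢(E, ℂ)) (v : E) : schwartzTransform f v =
    (((√(2 * Real.pi) : ℝ) : ℂ) ^ Module.finrank ℝ E)⁻¹ * 𝓕 f ((2 * Real.pi)⁻¹ • v) := rfl

theorem dunklTransform_zero_eq (D : IsDatum R P k) (f : 𝓢(E, ℂ)) :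
    dunklTransform P 0 f = schwartzTransform f := by
  funext v
  rw [dunklTransform_zero D, schwartzTransform_apply, SchwartzMap.fourier_coe]

theorem isRadial_schwartzTransform {f : 𝓢(E, ℂ)} (hf : IsRadial f) :
    IsRadial (schwartzTransform f) := by
  intro g v
  rw [schwartzTransform_apply, schwartzTransform_apply, SchwartzMap.fourier_coe, Real.fourier_eq',
    Real.fourier_eq', ← integral_map_isometry g]
  simp_rw [hf g, ← map_smul g, LinearIsometryEquiv.inner_map_map]

/-- The rank one transform with multiplicity zero of a restriction to a line. -/
theorem dunklTransformZ2_zero_restrict (f : 𝓢(E, ℂ)) (e : E) (he : ‖e‖ = 1) (r : ℝ) :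
    dunklTransformZ2 0 (fun t => f (t • e)) r =
      (((√(2 * Real.pi) : ℝ) : ℂ) ^ Module.finrank ℝ (ℝ ∙ e)ᗮ)⁻¹ *
        ∫ w : (ℝ ∙ e)ᗮ, schwartzTransform f (r • e + w) := by
  have D : IsDatum ({√2, -√2} : Finset ℝ) rankOnePos (fun _ => (0 : ℂ)) :=
    isDatum_rankOne le_rfl
  have h0 := dunklTransform_zero D (fun t => f (t • e)) r
  -- Undoing the dilation by 1/(2π) in the orthogonal directions produces (2π)^(dim - 1) =
  -- (√(2π)^(dim - 1))², which reconciles the normalizing constants in dimensions dim and 1.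
  have h1 := Measure.integral_comp_smul (volume : Measure (ℝ ∙ e)ᗮ)
    (fun w => (FourierTransform.fourier f : 𝓢(E, ℂ)) (((2 * Real.pi)⁻¹ * r) • e + w))
    (2 * Real.pi)⁻¹
  have hq : (0 : ℝ) < 2 * Real.pi := by positivity
  have hs : ((√(2 * Real.pi) : ℝ) : ℂ) ≠ 0 := Complex.ofReal_ne_zero.2 (by positivity)
  have hsq : ((√(2 * Real.pi) : ℝ) : ℂ) ^ 2 = ((2 * Real.pi : ℝ) : ℂ) := by
    rw [← Complex.ofReal_pow, Real.sq_sqrt hq.le]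
  rw [dunklTransformZ2]
  refine h0.trans ?_
  rw [fourier_restrict_line f e he, smul_eq_mul]
  simp_rw [schwartzTransform_apply]
  rw [integral_const_mul]
  have h2 : ∀ w : (ℝ ∙ e)ᗮ, (2 * Real.pi)⁻¹ • (r • e + (w : E)) =
      ((2 * Real.pi)⁻¹ * r) • e + (((2 * Real.pi)⁻¹ • w : (ℝ ∙ e)ᗮ) : E) := fun w => by
    rw [smul_add, smul_smul, Submodule.coe_smul]
  simp_rw [h2]
  rw [h1, ← finrank_orthogonal_line he, Module.finrank_self, Complex.real_smul,
    abs_of_nonneg (by positivity), inv_pow, inv_inv, Complex.ofReal_pow, ← hsq]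
  field_simp
  ring

theorem gauss_line {e : E} (he : ‖e‖ = 1) (r t : ℝ) (w : (ℝ ∙ e)ᗮ) :
    gauss (r • (t • e + (w : E))) = gauss (r • t) * gauss (r • w) := by
  have h := norm_sq_line e he (r * t) (r • w)
  rw [gauss_eq_cexp, gauss_eq_cexp, gauss_eq_cexp, ← Complex.exp_add, smul_add, smul_smul,
    ← Submodule.coe_smul, h]
  congr 1
  rw [smul_eq_mul, Real.norm_eq_abs, sq_abs]
  push_cast
  ring

/-- The kernel is defined separately for each parameter, so regularity in the parameter comes from
symmetry. -/
theorem continuous_dunklExp_left (D : IsDatum R P k) (x : E) :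
    Continuous fun v => dunklExp P k (smulForm Complex.I v) x := by
  simp_rw [dunklExp_comm D Complex.I _ x]
  exact (D.isDunklKernel _).contDiff.continuous

theorem polyGrowth_dunklExp_mul_weight (D : IsDatum R P k) (x : E) :
    PolyGrowth fun v => dunklExp P k (smulForm Complex.I v) x * weight P k v := by
  obtain ⟨B, hB⟩ := exists_norm_dunklExp_le D
  exact (PolyGrowth.of_bounded B fun v => hB v x).mul (polyGrowth_weight D)

theorem PolyGrowth.comp_inner {h : ℝ → ℂ} (hh : PolyGrowth h) {e : E} (he : ‖e‖ = 1) :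
    PolyGrowth fun v => h ⟪e, v⟫_ℝ := by
  obtain ⟨C, N, hC⟩ := hh
  have h0 : 0 ≤ C := by simpa using (norm_nonneg _).trans (hC 0)
  refine ⟨C, N, fun v => (hC _).trans ?_⟩
  gcongr
  simpa [he] using norm_inner_le_norm (𝕜 := ℝ) e v

/-- The Gaussian factors along e and e^⊥. The line gives the rank one transform with r^(1 + 2κ), and
the complement a plain Gaussian integral with r^(dim - 1); the total power of r agrees with that of
a weight of degree 2κ on the full space. -/
theorem integral_rankOne_mul_gauss_smul {κ : ℂ} (hκ : 0 ≤ κ.re) {e : E} (he : ‖e‖ = 1) (s : ℝ)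
    {r : ℝ} (hr : 0 < r) :
    ∫ v : E, dunklExp rankOnePos (fun _ => κ) (smulForm Complex.I ⟪e, v⟫_ℝ) s *
        weight rankOnePos (fun _ => κ) ⟪e, v⟫_ℝ * gauss (r⁻¹ • v) =
      ((√(2 * Real.pi) : ℝ) : ℂ) ^ Module.finrank ℝ (ℝ ∙ e)ᗮ *
        ((r : ℂ) ^ Module.finrank ℝ E * (r : ℂ) ^ (2 * κ) *
          (mehta rankOnePos (fun _ => κ) * gauss (r • s))) := by
  have D := isDatum_rankOne hκ
  set Ψ : ℝ → ℂ := fun t => dunklExp rankOnePos (fun _ => κ) (smulForm Complex.I t) s *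
    weight rankOnePos (fun _ => κ) t with hΨ
  have hm : Measurable Ψ := (continuous_dunklExp_left D s).measurable.mul measurable_weight
  have hp : PolyGrowth Ψ := polyGrowth_dunklExp_mul_weight D s
  have hI : Integrable fun v : E => Ψ ⟪e, v⟫_ℝ * gauss (r⁻¹ • v) := by
    have h1 : PolyGrowth fun v : E => Ψ ⟪r • e, v⟫_ℝ := by
      obtain ⟨C, N, hC⟩ := hp.comp_inner he
      have h0 : 0 ≤ C := by simpa using (norm_nonneg _).trans (hC 0)
      refine ⟨C * (1 + r) ^ N, N, fun v => ?_⟩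
      have h2 := hC (r • v)
      simp only [inner_smul_right, norm_smul, Real.norm_of_nonneg hr.le] at h2
      simp only [real_inner_smul_left]
      refine h2.trans ?_
      rw [mul_assoc, ← mul_pow]
      gcongr
      nlinarith [norm_nonneg v]
    have h3 : Integrable fun v : E => Ψ ⟪r • e, v⟫_ℝ * gauss v :=
      h1.expGrowth.integrable (hm.comp (by fun_prop)).aestronglyMeasurable
    refine (h3.comp_smul (inv_ne_zero hr.ne')).congr (Filter.Eventually.of_forall fun v => ?_)
    simp only [real_inner_smul_left, inner_smul_right]
    rw [inv_mul_cancel_left₀ hr.ne']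
  change ∫ v : E, Ψ ⟪e, v⟫_ℝ * gauss (r⁻¹ • v) = _
  rw [integral_line hI e he]
  have hW : ∫ w : (ℝ ∙ e)ᗮ, gauss (r⁻¹ • w) = (r : ℂ) ^ Module.finrank ℝ (ℝ ∙ e)ᗮ *
      ((√(2 * Real.pi) : ℝ) : ℂ) ^ Module.finrank ℝ (ℝ ∙ e)ᗮ := by
    rw [Measure.integral_comp_smul, integral_gauss, Complex.real_smul,
      abs_of_nonneg (by positivity), inv_pow, inv_inv, Complex.ofReal_pow]
  simp_rw [inner_line e he, gauss_line he, integral_const_mul, hW]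
  have h4 := integral_dunklExp_mul_gauss_smul D hr s
  rw [sum_rankOnePos, Module.finrank_self, pow_one] at h4
  have h5 : ∀ t : ℝ, Ψ t * (gauss (r⁻¹ • t) * ((r : ℂ) ^ Module.finrank ℝ (ℝ ∙ e)ᗮ *
      ((√(2 * Real.pi) : ℝ) : ℂ) ^ Module.finrank ℝ (ℝ ∙ e)ᗮ)) = ((r : ℂ) ^ Module.finrank ℝ (ℝ ∙ e)ᗮ *
      ((√(2 * Real.pi) : ℝ) : ℂ) ^ Module.finrank ℝ (ℝ ∙ e)ᗮ) *
      (dunklExp rankOnePos (fun _ => κ) (smulForm Complex.I t) s *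
        weight rankOnePos (fun _ => κ) t * gauss (r⁻¹ • t)) := fun t => by
    simp only [hΨ]; ring
  simp_rw [h5]
  rw [integral_const_mul, h4, ← finrank_orthogonal_line he]
  ring

end Restriction

end Dunkl

/-! ### The theorem: comparing two functionals on radial Schwartz functions -/

open Dunkl in
theorem proposition4p4 {E : Type*} [NormedAddCommGroup E] [InnerProductSpace ℝ E]
    [FiniteDimensional ℝ E] [MeasurableSpace E] [BorelSpace E]
    (R P : Finset E) (hR : Dunkl.IsRootSystem R) (hP : Dunkl.IsPositiveSystem R P)
    (k : E → ℂ) (hk : Dunkl.IsMultiplicity R k) (hre : ∀ α ∈ R, 0 ≤ (k α).re)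
    (f : 𝓢(E, ℂ)) (hf : Dunkl.IsRadial f) (x₀ : E) (hx₀ : x₀ ≠ 0) :
    Dunkl.resLine x₀ (Dunkl.invDunklTransform P k (Dunkl.dunklTransform P 0 f)) =
      Dunkl.invDunklTransformZ2 (∑ α ∈ P, k α)
        (Dunkl.dunklTransformZ2 0 (Dunkl.resLine x₀ f)) := by
  have D : IsDatum R P k := ⟨hR, hP, hk, hre⟩
  set e : E := ‖x₀‖⁻¹ • x₀ with he_def
  have he : ‖e‖ = 1 := norm_smul_inv_norm (𝕜 := ℝ) hx₀
  set γ := ∑ α ∈ P, k α with hγ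
  have hγ0 : 0 ≤ γ.re := by
    rw [hγ, Complex.re_sum]
    exact Finset.sum_nonneg fun α hα => D.re_nonneg' hα
  have D' := isDatum_rankOne hγ0
  set S := schwartzTransform f with hS
  set M : ℂ := ((√(2 * Real.pi) : ℝ) : ℂ) ^ Module.finrank ℝ (ℝ ∙ e)ᗮ with hM
  have hM0 : M ≠ 0 := pow_ne_zero _ (Complex.ofReal_ne_zero.2 (by positivity))
  funext s
  set Φ₁ : E → ℂ := fun v => (mehta P k)⁻¹ *
    (dunklExp P k (smulForm Complex.I v) (s • e) * weight P k v) with hΦ₁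
  set Ψ : ℝ → ℂ := fun t => dunklExp rankOnePos (fun _ => γ) (smulForm Complex.I t) s *
    weight rankOnePos (fun _ => γ) t with hΨ
  -- The kernel of the right-hand side lifted to the full space; M⁻¹ is the normalizing factor left
  -- over from the slice formula.
  set Φ₂ : E → ℂ := fun v => ((mehta rankOnePos fun _ => γ)⁻¹ * M⁻¹) * Ψ ⟪e, v⟫_ℝ with hΦ₂
  have hm₁ : Measurable Φ₁ :=
    ((continuous_dunklExp_left D _).measurable.mul measurable_weight).const_mul _
  have hmΨ : Measurable Ψ := (continuous_dunklExp_left D' s).measurable.mul measurable_weight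
  have hm₂ : Measurable Φ₂ := (hmΨ.comp (by fun_prop)).const_mul _
  have hp₁ : PolyGrowth Φ₁ := (PolyGrowth.const _).mul (polyGrowth_dunklExp_mul_weight D _)
  have hpΨ : PolyGrowth fun v : E => Ψ ⟪e, v⟫_ℝ :=
    (polyGrowth_dunklExp_mul_weight D' s).comp_inner he
  have hp₂ : PolyGrowth Φ₂ := (PolyGrowth.const _).mul hpΨ
  have hI₁ := hp₁.integrable_schwartz hm₁ S
  have hI₂ := hp₂.integrable_schwartz hm₂ S
  have hl : resLine x₀ (invDunklTransform P k (dunklTransform P 0 f)) s = ∫ v, S v * Φ₁ v := by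
    rw [resLine, invDunklTransform, dunklTransform_zero_eq D, ← integral_const_mul]
    refine integral_congr_ae (Filter.Eventually.of_forall fun v => ?_)
    simp only [hΦ₁, ← he_def, ← hS]
    ring
  have hr : invDunklTransformZ2 γ (dunklTransformZ2 0 (resLine x₀ f)) s = ∫ v, S v * Φ₂ v := by
    have hres : resLine x₀ f = fun t => f (t • e) := rfl
    rw [integral_line hI₂ e he, invDunklTransformZ2, invDunklTransform, ← integral_const_mul]
    refine integral_congr_ae (Filter.Eventually.of_forall fun t => ?_)
    simp only [hres, dunklTransformZ2_zero_restrict f e he, hΦ₂, inner_line e he]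
    rw [integral_mul_const]
    simp only [hΨ, ← hM, ← hS]
    ring
  have hmain : ∫ v, S v * (Φ₁ v + (-1) * Φ₂ v) = 0 := by
    have hp₃ : PolyGrowth fun v => (-1) * Φ₂ v := (PolyGrowth.const _).mul hp₂
    refine integral_radial_eq_zero (Φ := fun v => Φ₁ v + (-1) * Φ₂ v) (hm₁.add (hm₂.const_mul _))
      (hp₁.expGrowth.add hp₃.expGrowth) (fun n => ?_) S.continuous
      (isRadial_schwartzTransform hf) ?_ he
    -- The power n + 1 of the Gaussian is the Gaussian of width r = 1/√(n + 1).
    · set r : ℝ := (√((n : ℝ) + 1))⁻¹ with hr_def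
      have hr0 : 0 < r := by positivity
      have hg : ∀ v : E, gauss v ^ (n + 1) = gauss (r⁻¹ • v) := fun v => by
        rw [gauss, gauss, ← Complex.ofReal_pow, ← Real.exp_nat_mul, norm_smul, mul_pow,
          hr_def, inv_inv, Real.norm_of_nonneg (Real.sqrt_nonneg _), Real.sq_sqrt (by positivity)]
        congr 2
        push_cast
        ring
      have hgi : ∀ {Φ : E → ℂ}, PolyGrowth Φ → Measurable Φ →
          Integrable fun v => Φ v * gauss (r⁻¹ • v) := by
        intro Φ hp hm
        simp_rw [← hg, pow_succ, ← mul_assoc]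
        refine ExpGrowth.integrable (h := fun v => Φ v * gauss v ^ n) ?_ ?_
        · refine hp.expGrowth.mono fun v => ?_
          rw [norm_mul, norm_pow]
          exact mul_le_of_le_one_right (norm_nonneg _)
            (pow_le_one₀ (norm_nonneg _) (norm_gauss_le_one v))
        · exact (hm.mul (continuous_gauss.measurable.pow_const n)).aestronglyMeasurable
      have e₁ : ∫ v, Φ₁ v * gauss (r⁻¹ • v) =
          (r : ℂ) ^ Module.finrank ℝ E * (r : ℂ) ^ (2 * γ) * gauss (r • s) := by
        simp only [hΦ₁, mul_assoc]
        rw [integral_const_mul]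
        simp only [← mul_assoc]
        rw [integral_dunklExp_mul_gauss_smul D hr0]
        have h1 : gauss (r • s • e) = gauss (r • s) := by
          rw [gauss, gauss, smul_smul, norm_smul, he, mul_one, smul_eq_mul]
        rw [h1]
        have := mehta_ne_zero D
        rw [← hγ]
        field_simp
      have e₂ : ∫ v, Φ₂ v * gauss (r⁻¹ • v) =
          (r : ℂ) ^ Module.finrank ℝ E * (r : ℂ) ^ (2 * γ) * gauss (r • s) := by
        simp only [hΦ₂, hΨ, mul_assoc]
        rw [integral_const_mul, integral_const_mul]
        simp only [← mul_assoc]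
        rw [integral_rankOne_mul_gauss_smul hγ0 he s hr0]
        have := mehta_ne_zero D'
        rw [← hM]
        field_simp
      simp_rw [hg, add_mul, mul_assoc]
      rw [integral_add (hgi hp₁ hm₁) ((hgi hp₂ hm₂).const_mul _), integral_const_mul, e₁, e₂]
      ring
    · refine (hI₁.add (hI₂.const_mul (-1))).congr (Filter.Eventually.of_forall fun v => ?_)
      simp only [Pi.add_apply]
      ring
  rw [hl, hr, ← sub_eq_zero, ← integral_sub hI₁ hI₂, ← hmain]
  refine integral_congr_ae (Filter.Eventually.of_forall fun v => ?_)
  simp only []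
  ring
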